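/- Conventions. $\mathbb T$ is the unit circle with normalized Haar measure $\mu$; functions on $\mathbb T$ are identified with $2\pi$-periodic functions of $x$ through $z=e^{-ix}$; inner products are conjugate-linear in the first variable; $\hat\psi(x)=\int_{\mathbb R}\psi(t)e^{-itx}\,dt$; $\operatorname{Per}(g)(x)=\sum_{k\in\mathbb Z}g(x+2k\pi)$. Let $p\ge 1$ be an odd integer, $N=2$, $m_0(z)=\frac1{\sqrt2}(1+z^p)$, $$Rf(z)=\tfrac12\sum_{w^2=z}|m_0(w)|^2f(w).$$ On $L^2(\mathbb R)$ let $U\psi(x)=\frac1{\sqrt2}\psi(\frac x2)$ and $(\pi(f)\psi)^{\wedge}=f\hat\psi$ for $f\in L^\infty(\mathbb T)$ (so $\pi(z)\psi=\psi(\cdot-1)$), and let $\varphi=\frac1p\chi_{(0,p)}$, $h_\varphi=\operatorname{Per}(|\hat\varphi|^2)$. For $h\ge 0$ in $L^1(\mathbb T)$ with $Rh=h$, the cyclic representation of $\mathfrak A_2$ associated to $h$ consists of a normal unital $*$-representation $\pi'$ of $L^\infty(\mathbb T)$ and a unitary $U'$ on a Hilbert space, with $U'\pi'(f)U'^{-1}=\pi'(f(z^2))$,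 and a vector $\varphi'$, cyclic for $(\pi',U')$, with $U'\varphi'=\pi'(m_0)\varphi'$ and $\langle\varphi',\pi'(f)\varphi'\rangle=\int fh\,d\mu$ for all $f\in L^\infty(\mathbb T)$. Put $\rho=e^{2\pi i/p}$, $(\alpha_\eta f)(z)=f(\eta z)$, let $\sigma$ be the permutation $\sigma(k)=2k\bmod p$ of $\{0,\dots,p-1\}$, and on $\mathcal H_1=L^2(\mathbb R)^{\oplus p}$ put $$\pi_1(f)(\xi_k)_k=(\pi(\alpha_{\rho^k}(f))\xi_k)_k,\quad U_1(\xi_k)_k=(U\xi_{\sigma(k)})_k,\quad \varphi_1=(\varphi,\dots,\varphi).$$ Let $(\hat\pi_1,\hat U_1)$ be given by the same formulas with $\pi(f),U$ replaced by $\hat\pi(f)\psi=f\psi$, $\hat U\psi(x)=\sqrt2\,\psi(2x)$. For a cycle $O$ of $\sigma$ (fixed points included) let $h_O=\sum_{l\in O}h_\varphi(\cdot+\frac{2\pi l}p)$, and let $P_O$ be the projection of $\mathcal H_1$ onto the components in $O$. (1) $R\mathbb 1=\mathbb 1$; $\hat\varphi(x)=e^{-ipx/2}\frac{\sin(px/2)}{px/2}$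 for $x\ne 0$; $h_\varphi(t)=\frac1{p^2}\frac{\sin^2(pt/2)}{\sin^2(t/2)}$ where $\sin(t/2)\neq 0$; $\sum_{k=0}^{p-1}h_\varphi(t+\frac{2k\pi}p)=1$ for all $t$. $(\pi,U,L^2(\mathbb R),\varphi)$ is the cyclic representation associated to $h_\varphi$. (2) $(\pi_1,U_1,\mathcal H_1,\varphi_1)$ is the cyclic representation associated to $\mathbb 1$. The componentwise Fourier transform carries $(\pi_1,U_1)$ to $(\hat\pi_1,\hat U_1)$, and the commutant of the latter is the set of all operators $(\xi_k)_k\mapsto(f_k\xi_k)_k$ with $f_k\in L^\infty(\mathbb R)$, $f_k(x)=f_{\sigma(k)}(2x)$ a.e. for all $k$. (3) The relation $\langle\varphi_1,\pi_1(g)A\varphi_1\rangle=\int gh\,d\mu$ for all $g\in L^\infty(\mathbb T)$ is a bijection between the operators $A$ in the commutant of $(\pi_1,U_1)$ and the $h\in L^\infty(\mathbb T)$ with $Rh=h$. If $A$ corresponds to $(f_k)$ after the Fourier transform, the relation is equivalent to $$\frac1{2\pi}\sum_{k=0}^{p-1}\langle\hat\varphi,\alpha_{\rho^k}(g)f_k\hat\varphi\rangle=\int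 gh\,d\mu\quad(g\in L^\infty(\mathbb T))$$ and to $$h=\sum_{k=0}^{p-1}\operatorname{Per}\Big(f_k\big(x+\tfrac{2k\pi}p\big)|\hat\varphi|^2\big(x+\tfrac{2k\pi}p\big)\Big)\ \text{a.e.}\qquad(*)$$ Hence $h\in L^\infty(\mathbb T)$ satisfies $Rh=h$ if and only if $(*)$ holds for some $f_k\in L^\infty(\mathbb R)$ with $f_k(x)=f_{\sigma(k)}(2x)$ a.e. (4) The functions $h_O$, one for each cycle $O$ of $\sigma$, form a basis of the space of continuous $h:\mathbb T\to\mathbb C$ with $Rh=h$. The zeros of $h_O$ are the points $x\in-\frac{2\pi l}p+2\pi\mathbb Z$, $l\in\{0,\dots,p-1\}\setminus O$. The cyclic representation associated to $h_O$ is given by $P_O\pi_1$, $P_OU_1$ on $P_O\mathcal H_1$, with vector $P_O\varphi_1$. (5) For $p=9$ the cycles of $\sigma$ are $O_1=\{0\}$, $O_2=\{1,2,4,5,7,8\}$, $O_3=\{3,6\}$; $h_{O_1}=h_\varphi$, $h_{O_1}+h_{O_2}+h_{O_3}=\mathbb 1$, $h_{O_1}+h_{O_3}=\frac1{3^2}\frac{\sin^2(9x/2)}{\sin^2(3x/2)}$,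 and a basis of the space of continuous solutions of $Rh=h$ is $$\Big\{\mathbb 1,\ \frac1{3^2}\frac{\sin^2(9x/2)}{\sin^2(3x/2)},\ \frac1{9^2}\frac{\sin^2(9x/2)}{\sin^2(x/2)}\Big\},$$ the quotients being extended continuously to the zeros of their denominators. -/

import Mathlib

open MeasureTheory Set Filter Topology
open scoped ENNReal ComplexConjugate

noncomputable section

namespace RuelleExample

/-! ### The circle -/

instance instMeasurableSpaceCircle : MeasurableSpace Circle := borel Circle

instance instBorelSpaceCircle : BorelSpace Circle := ⟨rfl⟩

/-- The normalized Haar measure on the unit circle `𝕋`. -/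
def haarT : Measure Circle := Measure.haarMeasure ⊤

instance instIsHaarMeasureHaarT : Measure.IsHaarMeasure haarT := by
  unfold haarT; infer_instance

instance instIsProbabilityMeasureHaarT : IsProbabilityMeasure haarT :=
  ⟨by simpa [haarT] using
    Measure.haarMeasure_self (K₀ := (⊤ : TopologicalSpace.PositiveCompacts Circle))⟩

/-- `L^∞(𝕋)`. -/
abbrev LinfT : Type := Lp ℂ ∞ haarT

/-- `L^∞(ℝ)`. -/
abbrev LinfR : Type := Lp ℂ ∞ (volume : Measure ℝ)

/-- `L²(ℝ)`. -/
abbrev L2R : Type := Lp ℂ 2 (volume : Measure ℝ)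

/-- A continuous function on `𝕋` as an element of `L^∞(𝕋)`. -/
def ofCont (f : C(Circle, ℂ)) : LinfT := ContinuousMap.toLp ∞ haarT ℂ f

/-- The point `e^{-ix}` of the circle. Functions on `𝕋` and `2π`-periodic functions of `x` are
identified through `z = e^{-ix}`. -/
def cis (x : ℝ) : Circle := Circle.exp (-x)

/-- The function on `𝕋` that corresponds to a `2π`-periodic function `g` through `z = e^{-ix}`. -/
def onCircle {E : Type*} (g : ℝ → E) (z : Circle) : E := g (-(Complex.arg (z : ℂ)))

/-! ### Composition of essentially bounded functions with non-singular maps -/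

section Comp

variable {X Y : Type*} [MeasurableSpace X] [MeasurableSpace Y] {μ : Measure X} {ν : Measure Y}

theorem memLp_comp {g : X → Y} (hg : Measure.QuasiMeasurePreserving g μ ν) (f : Lp ℂ ∞ ν) :
    MemLp (fun x => f (g x)) ∞ μ := by
  refine memLp_top_of_bound
    ((Lp.aestronglyMeasurable f).comp_quasiMeasurePreserving hg) ‖f‖ ?_
  suffices h : ∀ᵐ y ∂ν, ‖f y‖ ≤ ‖f‖ from hg.ae h
  filter_upwards [ae_le_eLpNormEssSup (f := (f : Y → ℂ)) (μ := ν)] with y hy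
  have h2 := (ENNReal.toReal_le_toReal (by simp) (by
    have := Lp.eLpNorm_lt_top f
    rw [eLpNorm_exponent_top] at this
    exact this.ne)).2 hy
  rw [Lp.norm_def, eLpNorm_exponent_top]
  simpa using h2

/-- The class of `x ↦ f (g x)`, for `f ∈ L^∞` and `g` measurable and non-singular. -/
def compLinf (g : X → Y) (hg : Measure.QuasiMeasurePreserving g μ ν) (f : Lp ℂ ∞ ν) :
    Lp ℂ ∞ μ := (memLp_comp hg f).toLp (fun x => f (g x))

end Comp

theorem qmp_pow (N : ℕ) (hN : N ≠ 0) :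
    Measure.QuasiMeasurePreserving (fun z : Circle => z ^ N) haarT haarT := by
  have hs : Function.Surjective (powMonoidHom N : Circle →* Circle) := by
    intro z
    refine ⟨Circle.exp (Complex.arg (z : ℂ) / N), ?_⟩
    rw [powMonoidHom_apply, ← Circle.exp_nsmul]
    have : N • (Complex.arg (z : ℂ) / N) = Complex.arg (z : ℂ) := by
      rw [nsmul_eq_mul]; field_simp
    rw [this, Circle.exp_arg]
  exact ((powMonoidHom N : Circle →* Circle).measurePreserving (μ := haarT) (ν := haarT)
    (continuous_pow N) hs rfl).quasiMeasurePreserving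

theorem qmp_rot (w : Circle) :
    Measure.QuasiMeasurePreserving (fun z : Circle => w * z) haarT haarT :=
  (measurePreserving_mul_left haarT w).quasiMeasurePreserving

theorem qmp_cis : Measure.QuasiMeasurePreserving cis (volume : Measure ℝ) haarT := by
  have hc : Continuous cis := Circle.exp.continuous.comp continuous_neg
  refine ⟨hc.measurable, ?_⟩
  refine Measure.AbsolutelyContinuous.mk fun s hs h0 => ?_
  rw [Measure.map_apply hc.measurable hs]
  -- By Fubini, almost every rotation of the set has a null preimage.
  have hm : Measurable (fun q : Circle × ℝ => cis q.2 * q.1) :=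
    ((hc.comp continuous_snd).mul continuous_fst).measurable
  have hS : MeasurableSet ((fun q : Circle × ℝ => cis q.2 * q.1) ⁻¹' s) := hm hs
  have hS' : (haarT.prod (volume : Measure ℝ))
      ((fun q : Circle × ℝ => cis q.2 * q.1) ⁻¹' s) = 0 := by
    rw [Measure.prod_apply_symm hS]
    have : ∀ y : ℝ, haarT ((fun x => (x, y)) ⁻¹' ((fun q : Circle × ℝ => cis q.2 * q.1) ⁻¹' s))
        = 0 := by
      intro y
      have := measure_preimage_mul haarT (cis y) s
      rw [h0] at this
      exact this
    simp [this]
  have h1 := (Measure.measure_prod_null hS).1 hS'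
  obtain ⟨z, hz⟩ := h1.exists
  have hz' : z = cis (-(Complex.arg (z : ℂ))) := by simp [cis, Circle.exp_arg]
  have h2 : (fun x : ℝ => x + -(Complex.arg (z : ℂ))) ⁻¹' (cis ⁻¹' s) =
      Prod.mk z ⁻¹' ((fun q : Circle × ℝ => cis q.2 * q.1) ⁻¹' s) := by
    ext x
    have : cis (x + -(Complex.arg (z : ℂ))) = cis x * z := by
      conv_rhs => rw [hz']
      simp only [cis, neg_add, Circle.exp_add]
    simp only [Set.mem_preimage, this]
  have h3 := measure_preimage_add_right (volume : Measure ℝ) (-(Complex.arg (z : ℂ))) (cis ⁻¹' s)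
  rw [← h3, h2]
  exact hz

/-- `f ↦ f(z^N)` on `L^∞(𝕋)`. -/
def powT (N : ℕ) (hN : N ≠ 0) : LinfT → LinfT := compLinf (fun z => z ^ N) (qmp_pow N hN)

/-- The rotation `(α_η f)(z) = f(η z)` on `L^∞(𝕋)`. -/
def alpha (η : Circle) : LinfT → LinfT := compLinf (fun z => η * z) (qmp_rot η)

/-- The `2π`-periodic function `x ↦ f(e^{-ix})`, in `L^∞(ℝ)`, for `f ∈ L^∞(𝕋)`. -/
def lift (f : LinfT) : LinfR := compLinf cis qmp_cis f

/-! ### The Ruelle transfer operator -/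

/-- `(R f)(z) = (1/N) ∑_{w^N = z} |m₀(w)|² f(w)`. -/
def ruelle (N : ℕ) (m₀ : C(Circle, ℂ)) (f : Circle → ℂ) (z : Circle) : ℂ :=
  (1 / (N : ℂ)) * ∑ᶠ w ∈ {w : Circle | w ^ N = z}, ((‖m₀ w‖ ^ 2 : ℝ) : ℂ) * f w

/-! ### Representations of `𝔄_N` -/

section Rep

variable {H : Type*} [NormedAddCommGroup H] [InnerProductSpace ℂ H]

/-- `(π, U)` is a normal representation of `𝔄_N`: `π` is a unital `*`-representation of `L^∞(𝕋)`,
continuous from the weak-`*` topology to the weak operator topology, and the unitary `U` satisfies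
`U π(f) U⁻¹ = π(f(z^N))`. -/
structure IsRep (N : ℕ) (hN : N ≠ 0) (π : LinfT → H →L[ℂ] H) (U : H ≃ₗᵢ[ℂ] H) : Prop where
  map_one : π (ofCont 1) = 1
  map_add : ∀ f g, π (f + g) = π f + π g
  map_smul : ∀ (c : ℂ) f, π (c • f) = c • π f
  map_mul : ∀ f g : LinfT, π (f • g) = π f ∘L π g
  map_star : ∀ f ξ η, inner ℂ (π (star f) ξ) η = inner ℂ ξ (π f η)
  normal : ∀ ξ η : H, ∃ k : Lp ℂ 1 haarT, ∀ f : LinfT,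
    inner ℂ ξ (π f η) = ∫ z, f z * k z ∂haarT
  covariant : ∀ f ξ, U (π f (U.symm ξ)) = π (powT N hN f) ξ

/-- `(π, U, H, φ)` is the cyclic representation of `𝔄_N` associated to the eigenfunction `h` of the
transfer operator with filter `m₀`. -/
structure IsCyclicRep (N : ℕ) (hN : N ≠ 0) (m₀ : C(Circle, ℂ)) (h : Circle → ℝ)
    (π : LinfT → H →L[ℂ] H) (U : H ≃ₗᵢ[ℂ] H) (φ : H) : Prop where
  rep : IsRep N hN π U
  integrable : Integrable h haarT
  nonneg : ∀ᵐ z ∂haarT, 0 ≤ h z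
  eigen : ∀ᵐ z ∂haarT, ruelle N m₀ (fun w => (h w : ℂ)) z = (h z : ℂ)
  scaling : U φ = π (ofCont m₀) φ
  state : ∀ f : LinfT, inner ℂ φ (π f φ) = ∫ z, f z * (h z : ℂ) ∂haarT
  cyclic : (Submodule.span ℂ {ξ : H | ∃ (n : ℤ) (f : LinfT), ξ = (U ^ n) (π f φ)}).topologicalClosure
    = ⊤

/-- The commutant of `(π, U)` in the bounded operators. -/
def commutant (π : LinfT → H →L[ℂ] H) (U : H ≃ₗᵢ[ℂ] H) : Set (H →L[ℂ] H) :=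
  {A | (∀ f ξ, A (π f ξ) = π f (A ξ)) ∧ ∀ ξ, A (U ξ) = U (A ξ)}

end Rep

/-! ### Operators on `L²(ℝ)` -/

theorem eLpNorm_dil (c : ℝ) (hc : 0 < c) (f : ℝ → ℂ) :
    eLpNorm (fun x => (Real.sqrt c : ℂ) * f (c * x)) 2 volume = eLpNorm f 2 volume := by
  have hemb : MeasurableEmbedding (fun x : ℝ => c * x) :=
    (Homeomorph.mulLeft₀ c hc.ne').measurableEmbedding
  have h1 : eLpNorm (fun x => f (c * x)) 2 volume =
      eLpNorm f 2 (Measure.map (fun x => c * x) volume) :=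
    (hemb.eLpNorm_map_measure).symm
  have h2 : (fun x => (Real.sqrt c : ℂ) * f (c * x)) =
      (Real.sqrt c : ℂ) • (fun x => f (c * x)) := rfl
  rw [h2, eLpNorm_const_smul, h1, Real.map_volume_mul_left hc.ne',
    eLpNorm_smul_measure_of_ne_top (by norm_num)]
  rw [smul_eq_mul, ← mul_assoc]
  have : ‖(Real.sqrt c : ℂ)‖ₑ * ENNReal.ofReal |c⁻¹| ^ (1 / (2 : ℝ≥0∞)).toReal = 1 := by
    rw [← ofReal_norm, Complex.norm_real, Real.norm_of_nonneg (Real.sqrt_nonneg c),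
      abs_of_pos (inv_pos.2 hc), ENNReal.ofReal_rpow_of_pos (inv_pos.2 hc),
      ← ENNReal.ofReal_mul (Real.sqrt_nonneg c)]
    have h3 : (1 / (2 : ℝ≥0∞)).toReal = 1 / 2 := by simp
    rw [h3, ← Real.sqrt_eq_rpow, ← Real.sqrt_mul hc.le, mul_inv_cancel₀ hc.ne']
    simp
  rw [this, one_mul]

theorem qmp_mul (c : ℝ) (hc : 0 < c) :
    Measure.QuasiMeasurePreserving (fun x : ℝ => c * x) volume volume := by
  refine ⟨measurable_const_mul c, ?_⟩
  rw [Real.map_volume_mul_left hc.ne']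
  exact Measure.smul_absolutelyContinuous

theorem memLp_dil (c : ℝ) (hc : 0 < c) (ψ : L2R) :
    MemLp (fun x => (Real.sqrt c : ℂ) * ψ (c * x)) 2 volume := by
  refine ⟨((Lp.aestronglyMeasurable ψ).comp_quasiMeasurePreserving (qmp_mul c hc)).const_mul _, ?_⟩
  rw [eLpNorm_dil c hc ψ]
  exact Lp.eLpNorm_lt_top ψ

/-- The underlying function of `dil`. -/
def dilFun (c : ℝ) (hc : 0 < c) (ψ : L2R) : L2R :=
  (memLp_dil c hc ψ).toLp (fun x => (Real.sqrt c : ℂ) * ψ (c * x))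

theorem dilFun_ae (c : ℝ) (hc : 0 < c) (ψ : L2R) :
    ∀ᵐ x, dilFun c hc ψ x = (Real.sqrt c : ℂ) * ψ (c * x) :=
  (memLp_dil c hc ψ).coeFn_toLp

theorem dilFun_dilFun (c d : ℝ) (hc : 0 < c) (hd : 0 < d) (h : c * d = 1) (ψ : L2R) :
    dilFun c hc (dilFun d hd ψ) = ψ := by
  refine Lp.ext ?_
  filter_upwards [dilFun_ae c hc (dilFun d hd ψ), (qmp_mul c hc).ae (dilFun_ae d hd ψ)]
    with x h1 h2
  rw [h1, h2, ← mul_assoc d, mul_comm d c, h, one_mul, ← mul_assoc, ← Complex.ofReal_mul,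
    ← Real.sqrt_mul hc.le, h]
  simp

/-- The unitary dilation `ψ ↦ √c ψ(c ·)` of `L²(ℝ)`, for `c > 0`. -/
def dil (c : ℝ) (hc : 0 < c) : L2R ≃ₗᵢ[ℂ] L2R where
  toFun := dilFun c hc
  invFun := dilFun c⁻¹ (inv_pos.2 hc)
  left_inv := dilFun_dilFun c⁻¹ c (inv_pos.2 hc) hc (inv_mul_cancel₀ hc.ne')
  right_inv := dilFun_dilFun c c⁻¹ hc (inv_pos.2 hc) (mul_inv_cancel₀ hc.ne')
  map_add' ψ χ := by
    refine Lp.ext ?_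
    filter_upwards [dilFun_ae c hc (ψ + χ), dilFun_ae c hc ψ, dilFun_ae c hc χ,
      Lp.coeFn_add (dilFun c hc ψ) (dilFun c hc χ), (qmp_mul c hc).ae (Lp.coeFn_add ψ χ)]
      with x h1 h2 h3 h4 h5
    rw [h1, h4, h5, Pi.add_apply, Pi.add_apply, h2, h3, mul_add]
  map_smul' a ψ := by
    refine Lp.ext ?_
    filter_upwards [dilFun_ae c hc (a • ψ), dilFun_ae c hc ψ,
      Lp.coeFn_smul a (dilFun c hc ψ), (qmp_mul c hc).ae (Lp.coeFn_smul a ψ)]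
      with x h1 h2 h3 h4
    rw [RingHom.id_apply, h1, h3, h4, Pi.smul_apply, Pi.smul_apply, h2, smul_eq_mul, smul_eq_mul,
      mul_left_comm]
  norm_map' ψ := by
    change ‖dilFun c hc ψ‖ = ‖ψ‖
    rw [dilFun, Lp.norm_toLp, eLpNorm_dil c hc ψ, Lp.norm_def]

/-- The multiplication operator `M_g` on `L²(ℝ)`, for `g ∈ L^∞(ℝ)`. -/
def mulOp (g : LinfR) : L2R →L[ℂ] L2R :=
  (ContinuousLinearMap.mul ℂ ℂ).holderL volume ∞ 2 2 g

/-- The unitary Fourier transform `ψ ↦ (2π)^{-1/2} ψ̂` of `L²(ℝ)`, where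
`ψ̂(x) = ∫ ψ(t) e^{-itx} dt`. -/
def fourierU : L2R ≃ₗᵢ[ℂ] L2R :=
  (Lp.fourierTransformₗᵢ ℝ ℂ).trans (dil (2 * Real.pi)⁻¹ (by positivity))

/-- `U ψ(x) = (1/√2) ψ(x/2)`. -/
def waveU : L2R ≃ₗᵢ[ℂ] L2R := dil (1 / 2) (by norm_num)

/-- `Û ψ(x) = √2 ψ(2x)`. -/
def waveUHat : L2R ≃ₗᵢ[ℂ] L2R := dil 2 (by norm_num)

/-- `π̂(f) ψ = f ψ`, with `f` seen as a `2π`-periodic function. -/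
def wavePiHat (f : LinfT) : L2R →L[ℂ] L2R := mulOp (lift f)

/-- `π(f)`, defined by `(π(f) ψ)^ = f ψ̂`. -/
def wavePi (f : LinfT) : L2R →L[ℂ] L2R :=
  (fourierU.symm : L2R →L[ℂ] L2R) ∘L wavePiHat f ∘L (fourierU : L2R →L[ℂ] L2R)

/-! ### The filter, the scaling function and the function `h_φ` -/

/-- The filter `m₀(z) = (1 + z^p)/√2`. -/
def filter₀ (p : ℕ) : C(Circle, ℂ) :=
  ⟨fun z => (1 + (z : ℂ) ^ p) / (Real.sqrt 2 : ℂ), by fun_prop⟩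

/-- The function `(1/p) χ_{(0,p)}`. -/
def phiFun (p : ℕ) : ℝ → ℂ := (Ioo (0 : ℝ) p).indicator fun _ => (1 / (p : ℂ))

/-- The scaling function `φ = (1/p) χ_{(0,p)}` in `L²(ℝ)`. -/
def phi (p : ℕ) : L2R :=
  indicatorConstLp 2 (measurableSet_Ioo (a := (0 : ℝ)) (b := p))
    (by simp [Real.volume_Ioo]) (1 / (p : ℂ))

/-- `φ̂(x) = ∫ φ(t) e^{-itx} dt`. -/
def phiHat (p : ℕ) (x : ℝ) : ℂ :=
  ∫ t : ℝ, phiFun p t * Complex.exp (-(Complex.I * (t : ℂ) * (x : ℂ)))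

/-- `Per(g)(x) = ∑_{k ∈ ℤ} g(x + 2kπ)`. -/
def per {E : Type*} [AddCommMonoid E] [TopologicalSpace E] (g : ℝ → E) (x : ℝ) : E :=
  ∑' k : ℤ, g (x + 2 * k * Real.pi)

/-- `h_φ = Per(|φ̂|²)`, as a `2π`-periodic function. -/
def hPhi (p : ℕ) : ℝ → ℝ := per fun x => ‖phiHat p x‖ ^ 2

/-- `∑_{l ∈ O} h_φ(· + 2πl/p)`, as a `2π`-periodic function. -/
def hOrb (p : ℕ) (O : Finset (Fin p)) (x : ℝ) : ℝ :=
  ∑ l ∈ O, hPhi p (x + 2 * Real.pi * (l : ℕ) / p)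

/-- `∑_{l ∈ O} h_φ(· + 2πl/p)`, as a complex-valued function on `𝕋`. -/
def hOrbC (p : ℕ) (O : Finset (Fin p)) : Circle → ℂ := onCircle fun x => (hOrb p O x : ℂ)

/-- The continuous functions `h` on `𝕋` with `R h = h`. -/
def contSol (p : ℕ) : Set (Circle → ℂ) := {h | Continuous h ∧ ruelle 2 (filter₀ p) h = h}

/-! ### The permutation `k ↦ 2k mod p` and its cycles -/

theorem sigma_injective (p : ℕ) (hp : Odd p) :
    Function.Injective fun k : Fin p =>
      (⟨2 * k.1 % p, Nat.mod_lt _ hp.pos⟩ : Fin p) := by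
  intro a b h
  have h1 : 2 * a.1 ≡ 2 * b.1 [MOD p] := congrArg Fin.val h
  have h2 : a.1 ≡ b.1 [MOD p] :=
    Nat.ModEq.cancel_left_of_coprime (Nat.coprime_two_right.2 hp) h1
  exact Fin.ext (Nat.ModEq.eq_of_lt_of_lt h2 a.2 b.2)

/-- The permutation `σ(k) = 2k mod p` of `{0, …, p-1}`, for odd `p`. -/
def sigma (p : ℕ) (hp : Odd p) : Equiv.Perm (Fin p) :=
  Equiv.ofBijective (fun k => ⟨2 * k.1 % p, Nat.mod_lt _ hp.pos⟩)
    (Finite.injective_iff_bijective.1 (sigma_injective p hp))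

/-- The cycles of a permutation, fixed points included, as sets. -/
def cycles {ι : Type*} (s : Equiv.Perm ι) : Set (Finset ι) :=
  {O | ∃ k, ∀ l, l ∈ O ↔ s.SameCycle k l}

/-! ### The `p`-fold representation -/

/-- `H₁`, the orthogonal direct sum of `p` copies of `L²(ℝ)`. -/
abbrev H1 (p : ℕ) : Type := PiLp 2 fun _ : Fin p => L2R

/-- `ρ^k` with `ρ = e^{2πi/p}`. -/
def rhoPow (p k : ℕ) : Circle := Circle.exp (2 * Real.pi / p) ^ k

/-- `(ξ_k)_k ↦ (π(α_{ρ^k}(f)) ξ_k)_k`. -/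
def ampPi (p : ℕ) (π : LinfT → L2R →L[ℂ] L2R) (f : LinfT) : H1 p →L[ℂ] H1 p :=
  ((PiLp.continuousLinearEquiv 2 ℂ fun _ : Fin p => L2R).symm : (Fin p → L2R) →L[ℂ] H1 p) ∘L
    (ContinuousLinearMap.pi fun k : Fin p =>
      π (alpha (rhoPow p k) f) ∘L PiLp.proj 2 (fun _ : Fin p => L2R) k)

/-- `(ξ_k)_k ↦ (U ξ_{σ(k)})_k`. -/
def ampU (p : ℕ) (hp : Odd p) (U : L2R ≃ₗᵢ[ℂ] L2R) : H1 p ≃ₗᵢ[ℂ] H1 p :=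
  (LinearIsometryEquiv.piLpCongrLeft 2 ℂ L2R (sigma p hp).symm).trans
    (LinearIsometryEquiv.piLpCongrRight 2 fun _ => U)

/-- `π₁`. -/
def pi1 (p : ℕ) : LinfT → H1 p →L[ℂ] H1 p := ampPi p wavePi

/-- `U₁`. -/
def U1 (p : ℕ) (hp : Odd p) : H1 p ≃ₗᵢ[ℂ] H1 p := ampU p hp waveU

/-- `π̂₁`. -/
def pi1Hat (p : ℕ) : LinfT → H1 p →L[ℂ] H1 p := ampPi p wavePiHat

/-- `Û₁`. -/
def U1Hat (p : ℕ) (hp : Odd p) : H1 p ≃ₗᵢ[ℂ] H1 p := ampU p hp waveUHat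

/-- `φ₁ = (φ, …, φ)`. -/
def phi1 (p : ℕ) : H1 p := WithLp.toLp 2 fun _ => phi p

/-- The Fourier transform, applied to each of the `p` components. -/
def fourier1 (p : ℕ) : H1 p ≃ₗᵢ[ℂ] H1 p :=
  LinearIsometryEquiv.piLpCongrRight 2 fun _ => fourierU

/-- The families `(f_k)` in `L^∞(ℝ)` with `f_k(x) = f_{σ(k)}(2x)` a.e. -/
def invFamilies (p : ℕ) (hp : Odd p) : Set (Fin p → LinfR) :=
  {f | ∀ k, ∀ᵐ x : ℝ, f k x = f (sigma p hp k) (2 * x)}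

/-- `A` is the operator `(ξ_k)_k ↦ (f_k ξ_k)_k`. -/
def IsDiag (p : ℕ) (A : H1 p →L[ℂ] H1 p) (f : Fin p → LinfR) : Prop :=
  ∀ ξ k, A ξ k = mulOp (f k) (ξ k)

/-- `A` and `h` correspond to each other: `⟨φ₁, π₁(g) A φ₁⟩ = ∫ g h dμ` for all `g ∈ L^∞(𝕋)`. -/
def Corresponds (p : ℕ) (A : H1 p →L[ℂ] H1 p) (h : LinfT) : Prop :=
  ∀ g : LinfT, inner ℂ (phi1 p) (pi1 p g (A (phi1 p))) = ∫ z, g z * h z ∂haarT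

/-- The subspace `P_O H₁` of vectors with all components outside `O` equal to zero. -/
def subH (p : ℕ) (O : Finset (Fin p)) : Submodule ℂ (H1 p) where
  carrier := {ξ | ∀ k, k ∉ O → ξ k = 0}
  add_mem' {a b} ha hb k hk := by
    rw [PiLp.add_apply, ha k hk, hb k hk, add_zero]
  zero_mem' k _ := rfl
  smul_mem' c a ha k hk := by
    rw [PiLp.smul_apply, ha k hk, smul_zero]

/-- The projection `P_O` of `H₁` onto the components in `O`. -/
def projO (p : ℕ) (O : Finset (Fin p)) (ξ : H1 p) : H1 p :=
  WithLp.toLp 2 fun k => if k ∈ O then ξ k else 0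

end RuelleExample

end

open RuelleExample

noncomputable section

namespace RuelleExample

/-! ### The parametrization `x ↦ e^{-ix}` of the circle -/

/-! Continuous solutions are governed by the `p`-th roots of unity. With `z = e^{-ix}` and `p` odd,
the weights `|m₀|²/2` at the two square roots of `z` are `cos²(px/4)` and `sin²(px/4)`, so `R` is an
averaging operator. Suppose a continuous fixed point vanishes at all `p`-th roots of unity, and let
its modulus be maximal at `x`. The weight of `x/2` is zero only if `e^{-ix}` is such a root, so the
maximum passes on to `x/2`, `x/4`, ... and in the limit to `0`, where the function vanishes
(`eq_zero_of_contSol`). A continuous fixed point is therefore determined by its values at these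
roots. At a root one of the weights is `1`, which makes the values constant along the cycles of `σ`.
The refinement equation of `φ̂` makes `h_φ` a fixed point; it is `1` at `z = 1` and `0` at the other
roots. This gives its closed form by comparison with the Fejér kernel, the identity `∑ h_φ(· +
2πk/p) = 1`, and the basis `h_O`, whose values at the roots are `0` and `1`.

The commutant is found on the Fourier side. There `U^{-n} π(f) U^n` multiplies component `k` by `f`,
read at scale `2^{-n}` around the root of unity with index `σ^{-n}(k)`. Different components see
different roots, so a suitable sequence `f_n` has as weak limit the multiplication by the indicator
of a bounded set in one component only (`exists_localization`). Since every component of `φ̂₁` is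
nonzero a.e., it follows that `φ̂₁` is cyclic and that every operator in the commutant is a family
of multiplications; commuting with `U` is then `f_k(x) = f_{σ(k)}(2x)`.

From an operator to `h`: unfolding `⟨φ₁, π₁(g) A φ₁⟩` over periods gives the density in `(*)`, which
is bounded because `h_φ ≤ 1`. It is fixed by `R` because `Uφ₁ = π₁(m₀)φ₁` and `R` is dual to `f ↦
|m₀|² f(z²)`. From `h` to an operator: the spaces of vectors `U^{-n} π(f) φ₁` increase with `n`. If
`Rh = h`, the matrix coefficients of `U^{-m} π(h) U^m` between two vectors of level `n` are the same
for all `m ≥ n` (`inner_cycVec_conjPi`), and a weak limit is the required operator. It is unique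
because its matrix coefficients on this total set depend only on the state (`commutant_ext`).

All the cyclic representations come from `isCyclicRep_of_projO`: for `σ`-invariant `O` the
projection `P_O` commutes with the representation, and the state of `P_O φ₁` has density `h_O`. The
cases used are all indices, `{0}`, and a cycle. -/

theorem continuous_cis : Continuous cis := Circle.exp.continuous.comp continuous_neg

theorem cis_add (x y : ℝ) : cis (x + y) = cis x * cis y := by
  simp only [cis, neg_add, Circle.exp_add]

theorem cis_zero : cis 0 = 1 := by simp [cis]

theorem coe_cis (x : ℝ) : (cis x : ℂ) = Complex.exp (-(Complex.I * x)) := by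
  rw [cis, Circle.coe_exp]; congr 1; push_cast; ring

theorem cis_neg (x : ℝ) : cis (-x) = (cis x)⁻¹ := by
  simp [cis, Circle.exp_neg]

theorem cis_nsmul (n : ℕ) (x : ℝ) : cis (n * x) = cis x ^ n := by
  induction n with
  | zero => simp [cis_zero]
  | succ n ih => rw [pow_succ, ← ih, ← cis_add]; congr 1; push_cast; ring

theorem cis_two_pi : cis (2 * Real.pi) = 1 := by
  simp [cis, Circle.exp_neg, Circle.exp_two_pi]

theorem cis_int (n : ℤ) : cis (2 * Real.pi * n) = 1 := by
  rw [cis, ← Circle.exp_zero, Circle.exp_eq_exp]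
  exact ⟨-n, by push_cast; ring⟩

theorem cis_periodic : Function.Periodic cis (2 * Real.pi) := fun x => by
  rw [cis_add, cis_two_pi, mul_one]

theorem cis_eq_cis {x y : ℝ} : cis x = cis y ↔ ∃ n : ℤ, x = y + 2 * Real.pi * n := by
  rw [cis, cis, Circle.exp_eq_exp]
  constructor
  · rintro ⟨m, h⟩; exact ⟨-m, by push_cast; linarith⟩
  · rintro ⟨m, h⟩; exact ⟨-m, by push_cast; linarith⟩

/-- The section `z ↦ -arg z` of `cis`. -/
def argNeg (z : Circle) : ℝ := -(Complex.arg (z : ℂ))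

theorem cis_argNeg (z : Circle) : cis (argNeg z) = z := by
  simp [cis, argNeg, Circle.exp_arg]

theorem argNeg_cis {x : ℝ} (h₁ : -Real.pi ≤ x) (h₂ : x < Real.pi) : argNeg (cis x) = x := by
  rw [argNeg, cis, Circle.arg_exp (by linarith) (by linarith), neg_neg]

theorem measurable_argNeg : Measurable argNeg :=
  (Complex.measurable_arg.comp (Continuous.measurable (by fun_prop : Continuous fun z : Circle => (z : ℂ)))).neg

theorem cis_surjective : Function.Surjective cis := fun z => ⟨_, cis_argNeg z⟩

theorem onCircle_eq {E : Type*} (g : ℝ → E) (z : Circle) : onCircle g z = g (argNeg z) := rfl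

theorem onCircle_cis {E : Type*} {g : ℝ → E} (hg : Function.Periodic g (2 * Real.pi)) (x : ℝ) :
    onCircle g (cis x) = g x := by
  rw [onCircle_eq]
  obtain ⟨n, hn⟩ := cis_eq_cis.1 (cis_argNeg (cis x))
  rw [hn, mul_comm]
  exact hg.int_mul n x

/-- The argument jumps at `-1`, so continuity is tested after composition with `cis`, which is an
open quotient map; there the jump is invisible by periodicity. -/
theorem continuous_onCircle {E : Type*} [TopologicalSpace E] {g : ℝ → E} (hc : Continuous g)
    (hg : Function.Periodic g (2 * Real.pi)) : Continuous (onCircle g) := by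
  have hq : IsOpenQuotientMap cis := by
    refine ⟨cis_surjective, continuous_cis, ?_⟩
    have : IsOpenMap Circle.exp := isLocalHomeomorph_circleExp.isOpenMap
    exact this.comp (Homeomorph.neg ℝ).isOpenMap
  rw [hq.isQuotientMap.continuous_iff]
  have : onCircle g ∘ cis = g := funext fun x => onCircle_cis hg x
  rwa [this]

theorem rhoPow_eq (p k : ℕ) : rhoPow p k = cis (-(2 * Real.pi * k / p)) := by
  rw [rhoPow, ← Circle.exp_nsmul, cis, neg_neg]
  congr 1
  rw [nsmul_eq_mul]; ring

theorem rhoPow_mul_cis (p k : ℕ) (x : ℝ) : rhoPow p k * cis x = cis (x - 2 * Real.pi * k / p) := by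
  rw [rhoPow_eq, ← cis_add]; congr 1; ring

/-! ### Haar measure in the parametrization -/

/-- The normalized Lebesgue measure on a period. -/
def periodMeasure : Measure ℝ :=
  ENNReal.ofReal (2 * Real.pi)⁻¹ • (volume : Measure ℝ).restrict (Ico (-Real.pi) Real.pi)

/-- The image measure is a translation-invariant probability measure on the circle, hence the Haar
measure by uniqueness. The additive circle of length `2π` serves as intermediary. -/
theorem measurePreserving_cis : MeasurePreserving cis periodMeasure haarT := by
  refine ⟨continuous_cis.measurable, ?_⟩
  have : Fact (0 < 2 * Real.pi) := ⟨Real.two_pi_pos⟩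
  let q : AddCircle (2 * Real.pi) → Circle := fun a => AddCircle.toCircle (-a)
  have hq : Continuous q := AddCircle.continuous_toCircle.comp continuous_neg
  have hqm : ∀ x : ℝ, q (x : AddCircle (2 * Real.pi)) = cis x := by
    intro x
    change AddCircle.toCircle (-(x : AddCircle (2 * Real.pi))) = cis x
    rw [← AddCircle.coe_neg, AddCircle.toCircle_apply_mk, cis]
    congr 1
    field_simp
  have hadd : ∀ a b, q (a + b) = q a * q b := by
    intro a b
    change AddCircle.toCircle (-(a + b)) = AddCircle.toCircle (-a) * AddCircle.toCircle (-b)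
    rw [neg_add, AddCircle.toCircle_add]
  have hmap : Measure.map cis periodMeasure = Measure.map q AddCircle.haarAddCircle := by
    have h1 := (AddCircle.measurePreserving_mk (2 * Real.pi) (-Real.pi)).map_eq
    have h2 : (volume : Measure ℝ).restrict (Ico (-Real.pi) Real.pi) =
        volume.restrict (Ioc (-Real.pi) (-Real.pi + 2 * Real.pi)) := by
      rw [restrict_Ico_eq_restrict_Ioc]; congr 2; ring
    have h3 : cis = q ∘ (QuotientAddGroup.mk : ℝ → AddCircle (2 * Real.pi)) :=
      funext fun x => (hqm x).symm
    rw [periodMeasure, h2, Measure.map_smul, h3,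
      ← Measure.map_map hq.measurable (AddCircle.measurable_mk'), h1,
      AddCircle.volume_eq_smul_haarAddCircle, Measure.map_smul, smul_smul,
      ← ENNReal.ofReal_mul (by positivity), inv_mul_cancel₀ Real.two_pi_pos.ne', ENNReal.ofReal_one,
      one_smul]
  rw [hmap]
  have hinv : (Measure.map q AddCircle.haarAddCircle).IsMulLeftInvariant := by
    refine ⟨fun w => ?_⟩
    obtain ⟨x, rfl⟩ := cis_surjective w
    rw [Measure.map_map (measurable_const_mul _) hq.measurable]
    have : (fun z => cis x * z) ∘ q = q ∘ fun a => (x : AddCircle (2 * Real.pi)) + a := by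
      funext a
      simp only [Function.comp_apply, hadd, hqm]
    rw [this, ← Measure.map_map hq.measurable (measurable_const_add _), map_add_left_eq_self]
  have : IsProbabilityMeasure (Measure.map q AddCircle.haarAddCircle) :=
    Measure.isProbabilityMeasure_map hq.measurable.aemeasurable
  have := Measure.haarMeasure_unique (Measure.map q AddCircle.haarAddCircle)
    (⊤ : TopologicalSpace.PositiveCompacts Circle)
  rw [this, haarT]
  simp

theorem argNeg_cis_ae : ∀ᵐ x ∂periodMeasure, argNeg (cis x) = x := by
  refine Measure.ae_smul_measure ?_ _
  filter_upwards [ae_restrict_mem measurableSet_Ico] with x hx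
  exact argNeg_cis hx.1 hx.2

theorem measurePreserving_argNeg : MeasurePreserving argNeg haarT periodMeasure := by
  refine ⟨measurable_argNeg, ?_⟩
  rw [← measurePreserving_cis.map_eq, Measure.map_map measurable_argNeg continuous_cis.measurable]
  have : argNeg ∘ cis =ᵐ[periodMeasure] id := argNeg_cis_ae
  rw [Measure.map_congr this, Measure.map_id]

theorem periodMeasure_ac : periodMeasure ≪ volume :=
  (Measure.smul_absolutelyContinuous).trans Measure.absolutelyContinuous_restrict

theorem ae_circle_iff {P : Circle → Prop} : (∀ᵐ z ∂haarT, P z) ↔ ∀ᵐ x : ℝ, P (cis x) := by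
  refine ⟨fun h => qmp_cis.ae h, fun h => ?_⟩
  have := measurePreserving_argNeg.quasiMeasurePreserving.ae (periodMeasure_ac.ae_le h)
  filter_upwards [this] with z hz
  rwa [cis_argNeg] at hz

theorem integral_comp_argNeg {g : ℝ → ℂ} (hg : AEStronglyMeasurable g periodMeasure) :
    ∫ z, g (argNeg z) ∂haarT = ∫ x, g x ∂periodMeasure := by
  rw [← measurePreserving_argNeg.map_eq, integral_map measurable_argNeg.aemeasurable]
  rwa [measurePreserving_argNeg.map_eq]

theorem integral_periodMeasure (g : ℝ → ℂ) :
    ∫ x, g x ∂periodMeasure = (2 * Real.pi : ℂ)⁻¹ * ∫ x in Ico (-Real.pi) Real.pi, g x := by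
  rw [periodMeasure, integral_smul_measure, ENNReal.toReal_ofReal (by positivity),
    Complex.real_smul]
  push_cast; rfl

theorem integral_circle {G : Circle → ℂ} (hG : AEStronglyMeasurable G haarT) :
    ∫ z, G z ∂haarT = (2 * Real.pi : ℂ)⁻¹ * ∫ x in (-Real.pi)..Real.pi, G (cis x) := by
  rw [intervalIntegral.integral_of_le (by linarith [Real.pi_pos]), ← integral_Ico_eq_integral_Ioc,
    ← integral_periodMeasure, ← measurePreserving_cis.map_eq,
    integral_map continuous_cis.measurable.aemeasurable]
  rwa [measurePreserving_cis.map_eq]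

theorem integrable_cis {G : Circle → ℂ} (hG : Integrable G haarT) (a b : ℝ) :
    IntervalIntegrable (fun x => G (cis x)) volume a b := by
  have h1 : Integrable (fun x => G (cis x)) periodMeasure :=
    measurePreserving_cis.integrable_comp_of_integrable hG
  rw [periodMeasure, integrable_smul_measure (by simp [Real.pi_pos]) (by simp)] at h1
  have h2 : IntervalIntegrable (fun x => G (cis x)) volume (-Real.pi) (-Real.pi + 2 * Real.pi) := by
    rw [intervalIntegrable_iff_integrableOn_Ioc_of_le (by linarith [Real.pi_pos]),
      IntegrableOn, ← restrict_Ico_eq_restrict_Ioc]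
    have h3 : -Real.pi + 2 * Real.pi = Real.pi := by ring
    rw [h3]; exact h1
  refine Function.Periodic.intervalIntegrable (f := fun x => G (cis x)) ?_ Real.two_pi_pos.ne' h2 a b
  intro x
  simp only [cis_periodic x]

/-! ### Periodization -/

theorem per_periodic {E : Type*} [AddCommMonoid E] [TopologicalSpace E] (g : ℝ → E) :
    Function.Periodic (per g) (2 * Real.pi) := by
  intro x
  rw [per, per, ← (Equiv.addRight (1 : ℤ)).tsum_eq fun k : ℤ => g (x + 2 * k * Real.pi)]
  congr 1; funext k; congr 1
  simp only [Equiv.coe_addRight]; push_cast; ring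

theorem per_shift {E : Type*} [AddCommMonoid E] [TopologicalSpace E] (g : ℝ → E) (a x : ℝ) :
    per (fun y => g (y + a)) x = per g (x + a) := by
  rw [per, per]; congr 1; funext k; congr 1; ring

/-- Integrals over the line of periodic multiples. -/
theorem hasSum_periods {F : ℝ → ℂ} (hF : Integrable F) :
    HasSum (fun k : ℤ => ∫ x in Ico (-Real.pi) Real.pi, F (x + 2 * k * Real.pi)) (∫ x, F x) := by
  have h1 := hasSum_integral_iUnion (f := F) (μ := volume)
    (s := fun n : ℤ => Ico (-Real.pi + n • (2 * Real.pi)) (-Real.pi + (n + 1) • (2 * Real.pi)))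
    (fun _ => measurableSet_Ico) (pairwise_disjoint_Ico_add_zsmul _ _)
    (by rw [iUnion_Ico_add_zsmul Real.two_pi_pos]; exact hF.integrableOn)
  rw [iUnion_Ico_add_zsmul Real.two_pi_pos, setIntegral_univ] at h1
  refine (congrArg (HasSum · (∫ x, F x)) (funext fun k => ?_)).mpr h1
  rw [integral_Ico_eq_integral_Ioc, integral_Ico_eq_integral_Ioc,
    ← intervalIntegral.integral_of_le (by linarith [Real.pi_pos]),
    ← intervalIntegral.integral_of_le (by simp only [zsmul_eq_mul]; push_cast; nlinarith [Real.pi_pos]),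
    intervalIntegral.integral_comp_add_right]
  congr 1 <;> simp only [zsmul_eq_mul] <;> push_cast <;> ring

theorem norm_per_le (F : ℝ → ℂ) {x : ℝ} :
    ‖per F x‖ₑ ≤ ∑' k : ℤ, ‖F (x + 2 * k * Real.pi)‖ₑ := by
  by_cases hs : Summable fun k : ℤ => ‖F (x + 2 * k * Real.pi)‖
  · have h2 : ∑' k : ℤ, ‖F (x + 2 * k * Real.pi)‖ₑ
        = ENNReal.ofReal (∑' k : ℤ, ‖F (x + 2 * k * Real.pi)‖) := by
      rw [ENNReal.ofReal_tsum_of_nonneg (fun _ => norm_nonneg _) hs]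
      simp
    rw [h2, ← ofReal_norm]
    exact ENNReal.ofReal_le_ofReal (norm_tsum_le_tsum_norm hs)
  -- Without absolute convergence the series is not summable in `ℂ`, and `tsum` takes its default
  -- value `0`.
  · have : per F x = 0 := tsum_eq_zero_of_not_summable fun h => hs h.norm
    simp [this]

/-- Tonelli: the integrals of `|F|` over the translates of one period add up to the integral of
`|F|` over the line. -/
theorem integrable_per {F : ℝ → ℂ} (hF : Integrable F) :
    IntegrableOn (per F) (Ico (-Real.pi) Real.pi) := by
  have hm : ∀ k : ℤ, AEStronglyMeasurable (fun x => F (x + 2 * k * Real.pi)) volume := fun k =>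
    (hF.comp_add_right (2 * k * Real.pi)).aestronglyMeasurable
  have hmr : ∀ k : ℤ, AEStronglyMeasurable (fun x => F (x + 2 * k * Real.pi))
    (volume.restrict (Ico (-Real.pi) Real.pi)) := fun k => (hm k).restrict
  have hfin : ∑' k : ℤ, ∫⁻ x in Ico (-Real.pi) Real.pi, ‖F (x + 2 * k * Real.pi)‖ₑ ≠ ∞ := by
    have hs := (hasSum_periods (F := fun x => ((‖F x‖ : ℝ) : ℂ)) hF.norm.ofReal).summable
    have hs' : Summable fun k : ℤ => ∫ x in Ico (-Real.pi) Real.pi, ‖F (x + 2 * k * Real.pi)‖ := by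
      rw [← Complex.summable_ofReal]
      convert hs using 2 with k
      exact integral_ofReal.symm
    have h3 : ∀ k : ℤ, ∫⁻ x in Ico (-Real.pi) Real.pi, ‖F (x + 2 * k * Real.pi)‖ₑ =
        ENNReal.ofReal (∫ x in Ico (-Real.pi) Real.pi, ‖F (x + 2 * k * Real.pi)‖) := fun k => by
      rw [ofReal_integral_norm_eq_lintegral_enorm]
      exact (hF.comp_add_right (2 * k * Real.pi)).integrableOn
    simp_rw [h3]
    rw [← ENNReal.ofReal_tsum_of_nonneg (fun _ => integral_nonneg fun _ => norm_nonneg _) hs']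
    exact ENNReal.ofReal_ne_top
  refine ⟨?_, ?_⟩
  · choose G hG hFG using hmr
    refine ⟨fun x => ∑' k, G k x, ?_, ?_⟩
    · exact (Measurable.tsum fun k => (hG k).measurable).stronglyMeasurable
    · filter_upwards [ae_all_iff.2 hFG] with x hx
      simp only [per, hx]
  · refine lt_of_le_of_lt (lintegral_mono fun x => norm_per_le F) ?_
    rw [lintegral_tsum fun k => (hmr k).enorm]
    exact hfin.lt_top

/-- Unfolding: an integral over the line against a periodic function is an integral over the
circle. -/
theorem integral_unfold {F : ℝ → ℂ} {g : Circle → ℂ} (hF : Integrable F)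
    (hg : AEStronglyMeasurable g haarT) (hgF : Integrable fun x => g (cis x) * F x) :
    (2 * Real.pi : ℂ)⁻¹ * ∫ x, g (cis x) * F x = ∫ z, g z * onCircle (per F) z ∂haarT := by
  have h1 := hasSum_periods hgF
  have hk : ∀ (k : ℤ) (x : ℝ), cis (x + 2 * k * Real.pi) = cis x := fun k x =>
    cis_eq_cis.2 ⟨k, by ring⟩
  have h2 := hasSum_integral_of_summable_integral_norm
    (μ := volume.restrict (Ico (-Real.pi) Real.pi))
    (F := fun (k : ℤ) x => g (cis (x + 2 * k * Real.pi)) * F (x + 2 * k * Real.pi))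
    (fun k => (hgF.comp_add_right (2 * k * Real.pi)).integrableOn) (by
      have hs := (hasSum_periods (F := fun x => ((‖g (cis x) * F x‖ : ℝ) : ℂ)) hgF.norm.ofReal).summable
      rw [← Complex.summable_ofReal]
      convert hs using 2 with k
      exact integral_ofReal.symm)
  rw [h1.unique h2]
  have h3 : ∀ x, ∑' k : ℤ, g (cis (x + 2 * k * Real.pi)) * F (x + 2 * k * Real.pi) =
      g (cis x) * per F x := fun x => by
    simp only [hk, per, tsum_mul_left]
  simp only [h3]
  rw [← integral_periodMeasure, ← integral_comp_argNeg]
  · simp only [cis_argNeg]; rfl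
  · refine AEStronglyMeasurable.mul ?_ ?_
    · exact hg.comp_measurePreserving measurePreserving_cis
    · exact (integrable_per hF).aestronglyMeasurable.smul_measure _

theorem integrable_onCircle_per {F : ℝ → ℂ} (hF : Integrable F) :
    Integrable (onCircle (per F)) haarT := by
  refine measurePreserving_argNeg.integrable_comp_of_integrable ?_
  exact (integrable_per hF).smul_measure (by simp)

/-! ### The transfer operator of the filter `m₀` -/

theorem cis_add_pi (x : ℝ) : cis (x + Real.pi) = -cis x := by
  ext
  rw [cis_add, Circle.coe_mul, Circle.coe_neg, coe_cis Real.pi, mul_comm Complex.I,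
    Complex.exp_neg, Complex.exp_pi_mul_I]
  simp

theorem circle_ne_neg (w : Circle) : w ≠ -w := by
  intro h
  have h1 := congrArg (fun z : Circle => (z : ℂ)) h
  simp only [Circle.coe_neg] at h1
  exact Circle.coe_ne_zero w (self_eq_neg.1 h1)

theorem ruelle_sq (m : C(Circle, ℂ)) (f : Circle → ℂ) (w : Circle) :
    ruelle 2 m f (w ^ 2) = 1 / 2 * (((‖m w‖ ^ 2 : ℝ) : ℂ) * f w +
      ((‖m (-w)‖ ^ 2 : ℝ) : ℂ) * f (-w)) := by
  have hset : {v : Circle | v ^ 2 = w ^ 2} = {w, -w} := by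
    ext v
    simp only [mem_ofPred_eq, mem_insert_iff, mem_singleton_iff]
    rw [Circle.ext_iff, Circle.ext_iff, Circle.ext_iff, Circle.coe_neg, Circle.coe_pow,
      Circle.coe_pow, sq_eq_sq_iff_eq_or_eq_neg]
  rw [ruelle, hset, finsum_mem_pair (circle_ne_neg w)]
  norm_num

theorem ruelle_cis (m : C(Circle, ℂ)) (f : Circle → ℂ) (x : ℝ) :
    ruelle 2 m f (cis x) = 1 / 2 * (((‖m (cis (x / 2))‖ ^ 2 : ℝ) : ℂ) * f (cis (x / 2)) +
      ((‖m (cis (x / 2 + Real.pi))‖ ^ 2 : ℝ) : ℂ) * f (cis (x / 2 + Real.pi))) := by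
  rw [cis_add_pi, ← ruelle_sq, ← cis_nsmul]
  congr 2; push_cast; ring

theorem norm_one_add_cis (x : ℝ) : ‖(1 : ℂ) + (cis x : ℂ)‖ ^ 2 = 4 * Real.cos (x / 2) ^ 2 := by
  rw [← Complex.normSq_eq_norm_sq, coe_cis]
  have h : Complex.exp (-(Complex.I * x)) = ((Real.cos x : ℝ) : ℂ) - (Real.sin x : ℝ) * Complex.I := by
    rw [show -(Complex.I * (x : ℂ)) = (-(x : ℂ)) * Complex.I by ring, Complex.exp_mul_I]
    simp [Complex.cos_neg, Complex.sin_neg]; ring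
  rw [h, Complex.normSq_apply]
  simp only [Complex.add_re, Complex.one_re, Complex.sub_re, Complex.ofReal_re, Complex.mul_re,
    Complex.I_re, mul_zero, Complex.ofReal_im, Complex.I_im, Complex.add_im, Complex.one_im,
    Complex.sub_im, Complex.mul_im]
  rw [Real.cos_sq, show 2 * (x / 2) = x by ring]
  nlinarith [Real.sin_sq_add_cos_sq x]

theorem filter₀_apply (p : ℕ) (z : Circle) :
    filter₀ p z = (1 + (z : ℂ) ^ p) / (Real.sqrt 2 : ℂ) := rfl

theorem norm_filter₀_cis (p : ℕ) (x : ℝ) :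
    ‖filter₀ p (cis x)‖ ^ 2 = 2 * Real.cos (p * x / 2) ^ 2 := by
  rw [filter₀_apply, norm_div, div_pow, ← Circle.coe_pow, ← cis_nsmul, norm_one_add_cis,
    Complex.norm_real, Real.norm_eq_abs, sq_abs, Real.sq_sqrt (by norm_num)]
  ring

/-- The source of the two complementary weights in `R`: going from `w` to `-w` moves the angle by an
odd multiple of `π/2`, which exchanges `cos²` and `sin²`. -/
theorem cos_sq_add_odd_half_pi {p : ℕ} (hp : Odd p) (x : ℝ) :
    Real.cos (x + p * (Real.pi / 2)) ^ 2 = Real.sin x ^ 2 := by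
  obtain ⟨m, rfl⟩ := hp
  have : x + ((2 * m + 1 : ℕ) : ℝ) * (Real.pi / 2) = (x + Real.pi / 2) + m * Real.pi := by
    push_cast; ring
  rw [this, Real.cos_add_nat_mul_pi, Real.cos_add_pi_div_two, mul_pow, neg_sq, ← pow_mul, mul_comm m,
    pow_mul]
  norm_num

theorem cos_sq_add_int_mul_pi (x : ℝ) (n : ℤ) :
    Real.cos (x + n * Real.pi) ^ 2 = Real.cos x ^ 2 := by
  rw [Real.cos_add_int_mul_pi, mul_pow, ← zpow_natCast ((-1 : ℝ) ^ n), ← zpow_mul, mul_comm n,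
    zpow_mul]
  norm_num

theorem ruelle_filter₀_cis {p : ℕ} (hp : Odd p) (f : Circle → ℂ) (x : ℝ) :
    ruelle 2 (filter₀ p) f (cis x) = (Real.cos (p * x / 4) ^ 2 : ℝ) * f (cis (x / 2)) +
      (Real.sin (p * x / 4) ^ 2 : ℝ) * f (cis (x / 2 + Real.pi)) := by
  rw [ruelle_cis, norm_filter₀_cis, norm_filter₀_cis]
  have h1 : (p : ℝ) * (x / 2 + Real.pi) / 2 = p * x / 4 + p * (Real.pi / 2) := by ring
  have h2 : (p : ℝ) * (x / 2) / 2 = p * x / 4 := by ring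
  rw [h1, h2, cos_sq_add_odd_half_pi hp]
  push_cast; ring

theorem ruelle_one {p : ℕ} (hp : Odd p) (z : Circle) :
    ruelle 2 (filter₀ p) (fun _ => 1) z = 1 := by
  obtain ⟨x, rfl⟩ := cis_surjective z
  rw [ruelle_filter₀_cis hp, mul_one, mul_one, ← Complex.ofReal_add, Real.cos_sq_add_sin_sq,
    Complex.ofReal_one]

/-- `Rh = h` in terms of periodic functions. -/
theorem ruelle_eq_iff {p : ℕ} (hp : Odd p) {f : Circle → ℂ} :
    ruelle 2 (filter₀ p) f = f ↔ ∀ x : ℝ, f (cis x) =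
      (Real.cos (p * x / 4) ^ 2 : ℝ) * f (cis (x / 2)) +
      (Real.sin (p * x / 4) ^ 2 : ℝ) * f (cis (x / 2 + Real.pi)) := by
  rw [funext_iff]
  refine ⟨fun h x => by rw [← ruelle_filter₀_cis hp, h], fun h z => ?_⟩
  obtain ⟨x, rfl⟩ := cis_surjective z
  rw [ruelle_filter₀_cis hp, ← h]

/-! ### A maximum principle -/

/-- A convex combination of numbers of modulus at most `s` has modulus `s` only if each term with
positive weight has modulus `s`. -/
theorem norm_half_eq_max {p : ℕ} {g : ℝ → ℂ} {s : ℝ} (hs : s ≠ 0)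
    (h0 : ∀ n : ℤ, g (2 * Real.pi * n / p) = 0) (hp : Odd p)
    (hR : ∀ x : ℝ, g x = (Real.cos (p * x / 4) ^ 2 : ℝ) * g (x / 2) +
      (Real.sin (p * x / 4) ^ 2 : ℝ) * g (x / 2 + Real.pi))
    (hmax : ∀ x, ‖g x‖ ≤ s) {x : ℝ} (hx : ‖g x‖ = s) : ‖g (x / 2)‖ = s := by
  have hp0 : (p : ℝ) ≠ 0 := by exact_mod_cast hp.pos.ne'
  -- The weight of `x/2` vanishes exactly at odd multiples of `2π/p`, where `g` is zero by
  -- hypothesis; the maximum `s ≠ 0` is not attained there.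
  by_cases hc : Real.cos (p * x / 4) = 0
  · exfalso
    obtain ⟨k, hk⟩ := Real.cos_eq_zero_iff.1 hc
    apply hs
    rw [← hx, show x = 2 * Real.pi * ((2 * k + 1 : ℤ) : ℝ) / p by
      push_cast; field_simp; linarith, h0, norm_zero]
  · have h1 : ‖g x‖ ≤ Real.cos (p * x / 4) ^ 2 * ‖g (x / 2)‖ +
        Real.sin (p * x / 4) ^ 2 * ‖g (x / 2 + Real.pi)‖ := by
      conv_lhs => rw [hR x]
      refine (norm_add_le _ _).trans (le_of_eq ?_)
      rw [norm_mul, norm_mul, Complex.norm_real, Complex.norm_real, Real.norm_of_nonneg (sq_nonneg _),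
        Real.norm_of_nonneg (sq_nonneg _)]
    have h2 : 0 < Real.cos (p * x / 4) ^ 2 := by positivity
    refine le_antisymm (hmax _) ?_
    have h3 := mul_le_mul_of_nonneg_left (hmax (x / 2 + Real.pi)) (sq_nonneg (Real.sin (p * x / 4)))
    have h4 : Real.sin (p * x / 4) ^ 2 = 1 - Real.cos (p * x / 4) ^ 2 := Real.sin_sq _
    rw [hx] at h1
    rw [h4] at h1 h3
    have : Real.cos (p * x / 4) ^ 2 * s ≤ Real.cos (p * x / 4) ^ 2 * ‖g (x / 2)‖ := by linarith
    exact le_of_mul_le_mul_left this h2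

/-- A continuous fixed point of the transfer operator that vanishes at the `p`-th roots of unity
is zero. -/
theorem eq_zero_of_contSol {p : ℕ} (hp : Odd p) {g : Circle → ℂ} (hg : g ∈ contSol p)
    (h0 : ∀ n : ℤ, g (cis (2 * Real.pi * n / p)) = 0) : g = 0 := by
  obtain ⟨hc, hR⟩ := hg
  rw [ruelle_eq_iff hp] at hR
  obtain ⟨z, -, hz⟩ := isCompact_univ.exists_isMaxOn univ_nonempty hc.norm.continuousOn
  have hmax : ∀ w, ‖g w‖ ≤ ‖g z‖ := fun w => hz (mem_univ w)
  suffices h : ‖g z‖ = 0 by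
    funext w
    exact norm_le_zero_iff.1 (h ▸ hmax w)
  by_contra hs
  obtain ⟨x, rfl⟩ := cis_surjective z
  -- Halving repeatedly transports the maximum to points that converge to `0`, and `0` is itself one
  -- of the prescribed zeros.
  have h1 : ∀ n : ℕ, ‖g (cis (x / 2 ^ n))‖ = ‖g (cis x)‖ := by
    intro n
    induction n with
    | zero => simp
    | succ n ih =>
      have := norm_half_eq_max (g := fun y => g (cis y)) hs h0 hp hR (fun y => hmax _) ih
      rw [pow_succ, ← div_div]
      exact this
  have h2 : Tendsto (fun n : ℕ => x / 2 ^ n) atTop (𝓝 0) := by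
    have := (tendsto_pow_atTop_nhds_zero_of_lt_one (r := (1 / 2 : ℝ)) (by norm_num)
      (by norm_num)).const_mul x
    simpa [div_eq_mul_inv] using this
  have h3 : Tendsto (fun n : ℕ => ‖g (cis (x / 2 ^ n))‖) atTop (𝓝 ‖g (cis 0)‖) :=
    ((hc.comp continuous_cis).norm.tendsto 0).comp h2
  simp only [h1] at h3
  have h4 : ‖g (cis x)‖ = ‖g (cis 0)‖ := tendsto_nhds_unique tendsto_const_nhds h3
  have h5 := h0 0
  rw [Int.cast_zero, mul_zero, zero_div] at h5
  rw [h4, h5, norm_zero] at hs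
  exact hs rfl

/-- The continuous fixed points of the transfer operator, as a submodule. -/
def contSolSub (p : ℕ) (hp : Odd p) : Submodule ℂ (Circle → ℂ) where
  carrier := contSol p
  add_mem' {a b} ha hb := by
    refine ⟨ha.1.add hb.1, (ruelle_eq_iff hp).2 fun x => ?_⟩
    simp only [Pi.add_apply]
    rw [(ruelle_eq_iff hp).1 ha.2 x, (ruelle_eq_iff hp).1 hb.2 x]
    ring
  zero_mem' := ⟨continuous_const, (ruelle_eq_iff hp).2 fun x => by simp⟩
  smul_mem' c a ha := by
    refine ⟨ha.1.const_smul c, (ruelle_eq_iff hp).2 fun x => ?_⟩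
    simp only [Pi.smul_apply, smul_eq_mul]
    rw [(ruelle_eq_iff hp).1 ha.2 x]
    ring

/-- The uniqueness principle behind the closed form of `h_φ`, the sum formula and the basis:
identities between continuous fixed points need only be checked at `p`-th roots of unity. -/
theorem contSol_ext {p : ℕ} (hp : Odd p) {g h : Circle → ℂ} (hg : g ∈ contSol p)
    (hh : h ∈ contSol p)
    (h0 : ∀ n : ℤ, g (cis (2 * Real.pi * n / p)) = h (cis (2 * Real.pi * n / p))) : g = h := by
  have := eq_zero_of_contSol hp ((contSolSub p hp).sub_mem hg hh) fun n => by simp [h0]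
  exact sub_eq_zero.1 this

theorem one_mem_contSol {p : ℕ} (hp : Odd p) : (fun _ => 1) ∈ contSol p :=
  ⟨continuous_const, funext (ruelle_one hp)⟩

/-! ### The Fejér kernel -/

/-- `z ↦ |∑_{j < p} z^j|² / p²`. -/
def fejer (p : ℕ) (z : Circle) : ℝ := ‖∑ j ∈ Finset.range p, (z : ℂ) ^ j‖ ^ 2 / (p : ℝ) ^ 2

theorem continuous_fejer (p : ℕ) : Continuous (fejer p) := by
  unfold fejer; fun_prop

/-- With `D(u) = ∑_{j<p} u^j`, the geometric sum of length `2p` can be grouped in two ways, so `(1 +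
u^p) D(u) = (1 + u) D(u²)`. Taking squared moduli at `u = ±w` and adding, the parallelogram law
`|1+w|² + |1-w|² = 4` gives the fixed point equation. -/
theorem ruelle_fejer (p : ℕ) :
    ruelle 2 (filter₀ p) (fun z => (fejer p z : ℂ)) = fun z => (fejer p z : ℂ) := by
  funext z
  obtain ⟨x, rfl⟩ := cis_surjective z
  have hx : cis x = cis (x / 2) ^ 2 := by rw [← cis_nsmul]; congr 1; push_cast; ring
  rw [hx, ruelle_sq]
  generalize cis (x / 2) = w
  have hsplit : ∀ u : ℂ, (1 + u ^ p) * ∑ j ∈ Finset.range p, u ^ j =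
      (1 + u) * ∑ j ∈ Finset.range p, (u ^ 2) ^ j := by
    intro u
    have e1 : ∑ j ∈ Finset.range (2 * p), u ^ j = (1 + u ^ p) * ∑ j ∈ Finset.range p, u ^ j := by
      rw [two_mul, Finset.sum_range_add, add_mul, one_mul, Finset.mul_sum]
      simp only [pow_add]
    have e2 : ∀ n, ∑ j ∈ Finset.range (2 * n), u ^ j =
        (1 + u) * ∑ j ∈ Finset.range n, (u ^ 2) ^ j := by
      intro n
      induction n with
      | zero => simp
      | succ n ih =>
        rw [mul_add, mul_one, Finset.sum_range_succ, Finset.sum_range_succ, ih,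
          Finset.sum_range_succ, mul_add, ← pow_mul]
        ring
    rw [← e1, e2]
  have h1 := congrArg (fun u : ℂ => ‖u‖ ^ 2) (hsplit w)
  have h2 := congrArg (fun u : ℂ => ‖u‖ ^ 2) (hsplit (-w))
  simp only [norm_mul, mul_pow, neg_sq] at h1 h2
  have h3 : ‖(1 : ℂ) + w‖ ^ 2 + ‖(1 : ℂ) + -w‖ ^ 2 = 4 := by
    have := parallelogram_law_with_norm ℝ (1 : ℂ) (w : ℂ)
    rw [norm_one, Circle.norm_coe, ← sub_eq_add_neg] at *
    nlinarith
  have key : ‖filter₀ p w‖ ^ 2 * fejer p w + ‖filter₀ p (-w)‖ ^ 2 * fejer p (-w) =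
      2 * fejer p (w ^ 2) := by
    simp only [filter₀_apply, fejer, Circle.coe_neg, Circle.coe_pow, norm_div, div_pow,
      Complex.norm_real, Real.norm_eq_abs, sq_abs]
    rw [Real.sq_sqrt (by norm_num)]
    set S := ‖∑ j ∈ Finset.range p, ((w : ℂ) ^ 2) ^ j‖ ^ 2
    calc _ = (‖(1 : ℂ) + (w : ℂ) ^ p‖ ^ 2 * ‖∑ j ∈ Finset.range p, (w : ℂ) ^ j‖ ^ 2 +
          ‖(1 : ℂ) + (-(w : ℂ)) ^ p‖ ^ 2 * ‖∑ j ∈ Finset.range p, (-(w : ℂ)) ^ j‖ ^ 2) /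
          (2 * (p : ℝ) ^ 2) := by ring
      _ = ((‖(1 : ℂ) + w‖ ^ 2 + ‖(1 : ℂ) + -w‖ ^ 2) * S) / (2 * (p : ℝ) ^ 2) := by
          rw [h1, h2]; ring
      _ = _ := by rw [h3]; ring
  have key' := congrArg (fun r : ℝ => (r : ℂ)) key
  push_cast at key' ⊢
  rw [key']
  ring

theorem fejer_mem_contSol (p : ℕ) : (fun z => (fejer p z : ℂ)) ∈ contSol p :=
  ⟨Complex.continuous_ofReal.comp (continuous_fejer p), ruelle_fejer p⟩

theorem fejer_one {p : ℕ} (hp : Odd p) : fejer p 1 = 1 := by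
  have hp0 : (p : ℝ) ≠ 0 := by exact_mod_cast hp.pos.ne'
  simp [fejer, hp0]

theorem fejer_root {p : ℕ} {z : Circle} (h1 : z ≠ 1) (h : z ^ p = 1) : fejer p z = 0 := by
  have h2 : (z : ℂ) - 1 ≠ 0 := sub_ne_zero.2 fun h => h1 (Circle.ext h)
  have h3 := mul_geom_sum (z : ℂ) p
  rw [← Circle.coe_pow, h, Circle.coe_one, sub_self] at h3
  rw [fejer, (mul_eq_zero.1 h3).resolve_left h2]
  simp

theorem norm_cis_sub_one (x : ℝ) : ‖(cis x : ℂ) - 1‖ ^ 2 = 4 * Real.sin (x / 2) ^ 2 := by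
  rw [coe_cis, show -(Complex.I * (x : ℂ)) = Complex.I * ((-x : ℝ) : ℂ) by push_cast; ring,
    Complex.norm_exp_I_mul_ofReal_sub_one, Real.norm_eq_abs, sq_abs, neg_div, Real.sin_neg]
  ring

theorem fejer_mul_sin_sq (p : ℕ) (x : ℝ) :
    fejer p (cis x) * Real.sin (x / 2) ^ 2 = 1 / (p : ℝ) ^ 2 * Real.sin (p * x / 2) ^ 2 := by
  have h3 := congrArg (fun u : ℂ => ‖u‖ ^ 2) (mul_geom_sum (cis x : ℂ) p)
  simp only [norm_mul, mul_pow] at h3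
  rw [← Circle.coe_pow, ← cis_nsmul, norm_cis_sub_one, norm_cis_sub_one] at h3
  rw [fejer, div_mul_eq_mul_div, mul_comm, div_eq_mul_inv, one_div, mul_comm _ (Real.sin _ ^ 2)]
  have h4 : Real.sin (x / 2) ^ 2 * ‖∑ j ∈ Finset.range p, (cis x : ℂ) ^ j‖ ^ 2 =
      Real.sin (p * x / 2) ^ 2 := by linarith
  rw [h4]

/-! ### The Fourier transform of the scaling function -/

theorem phiHat_eq_integral (p : ℕ) (x : ℝ) :
    phiHat p x = (1 / (p : ℂ)) * ∫ t in (0 : ℝ)..p, Complex.exp (-(Complex.I * x) * t) := by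
  rw [intervalIntegral.integral_of_le (by positivity), ← integral_Ioc_eq_integral_Ioo.symm,
    ← integral_const_mul, ← integral_indicator measurableSet_Ioo, phiHat]
  congr 1
  funext t
  by_cases ht : t ∈ Ioo (0 : ℝ) p
  · rw [phiFun, indicator_of_mem ht, indicator_of_mem ht]
    congr 2; ring
  · rw [phiFun, indicator_of_notMem ht, indicator_of_notMem ht, zero_mul]

theorem phiHat_of_ne_zero {p : ℕ} (hp : Odd p) {x : ℝ} (hx : x ≠ 0) :
    phiHat p x = Complex.exp (-(Complex.I * (p * x / 2 : ℝ))) *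
        ((Real.sin (p * x / 2) / (p * x / 2) : ℝ) : ℂ) := by
  have hp0 : (p : ℂ) ≠ 0 := by exact_mod_cast hp.pos.ne'
  have hx0 : (x : ℂ) ≠ 0 := by exact_mod_cast hx
  rw [phiHat_eq_integral, integral_exp_mul_complex (by simp [hx])]
  push_cast
  have h1 := Complex.two_sin ((p : ℂ) * x / 2)
  have h2 : Complex.sin ((p : ℂ) * x / 2) = (Complex.exp (-((p : ℂ) * x / 2) * Complex.I) -
    Complex.exp ((p : ℂ) * x / 2 * Complex.I)) * Complex.I / 2 := by rw [← h1]; ring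
  have h3 : Complex.exp (-(Complex.I * x) * p) = Complex.exp (-((p : ℂ) * x / 2) * Complex.I) ^ 2 := by
    rw [← Complex.exp_nat_mul]; congr 1; push_cast; ring
  have h4 : Complex.exp (-(Complex.I * ((p : ℂ) * x / 2))) =
    Complex.exp (-((p : ℂ) * x / 2) * Complex.I) := by congr 1; ring
  have h5 : Complex.exp (-((p : ℂ) * x / 2) * Complex.I) * Complex.exp ((p : ℂ) * x / 2 * Complex.I) = 1 := by
    rw [← Complex.exp_add]; simp
  rw [h2, h3, h4, mul_zero, Complex.exp_zero]
  generalize Complex.exp (-((p : ℂ) * x / 2) * Complex.I) = e at *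
  generalize Complex.exp ((p : ℂ) * x / 2 * Complex.I) = e' at *
  have : e * ((e - e') * Complex.I / 2 / (p * x / 2)) = (e ^ 2 - e * e') * Complex.I / (p * x) := by
    field_simp
  rw [this, h5]
  field_simp
  linear_combination (1 - e ^ 2) * Complex.I_sq

/-- The form with `sinc` includes `x = 0`, and continuity and all later estimates are read off from
it. -/
theorem phiHat_eq {p : ℕ} (hp : Odd p) (x : ℝ) :
    phiHat p x = Complex.exp (-(Complex.I * (p * x / 2 : ℝ))) * (Real.sinc (p * x / 2) : ℝ) := by
  have hp0 : (p : ℝ) ≠ 0 := by exact_mod_cast hp.pos.ne'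
  by_cases hx : x = 0
  · subst hx
    rw [phiHat_eq_integral]
    simp
    exact inv_mul_cancel₀ (by exact_mod_cast hp0)
  · rw [phiHat_of_ne_zero hp hx, Real.sinc_of_ne_zero (by positivity)]

theorem continuous_phiHat {p : ℕ} (hp : Odd p) : Continuous (phiHat p) := by
  rw [funext (phiHat_eq hp)]
  have := Real.continuous_sinc
  fun_prop

theorem norm_phiHat_sq {p : ℕ} (hp : Odd p) (x : ℝ) :
    ‖phiHat p x‖ ^ 2 = Real.sinc (p * x / 2) ^ 2 := by
  rw [phiHat_eq hp, norm_mul, mul_pow, Complex.norm_real, Real.norm_eq_abs, sq_abs,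
    show -(Complex.I * ((p * x / 2 : ℝ) : ℂ)) = ((-(p * x / 2) : ℝ) : ℂ) * Complex.I by
      push_cast; ring, Complex.norm_exp_ofReal_mul_I, one_pow, one_mul]

/-- The refinement equation, that is, the Fourier form of `Uφ = π(m₀)φ`. It rests on `sinc 2θ = cos
θ · sinc θ`. -/
theorem phiHat_two_mul {p : ℕ} (hp : Odd p) (x : ℝ) :
    (Real.sqrt 2 : ℂ) * phiHat p (2 * x) = filter₀ p (cis x) * phiHat p x := by
  rw [phiHat_eq hp, phiHat_eq hp, filter₀_apply, ← Circle.coe_pow, ← cis_nsmul, coe_cis]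
  have hs : (Real.sqrt 2 : ℂ) * Real.sqrt 2 = 2 := by
    rw [← Complex.ofReal_mul, Real.mul_self_sqrt (by norm_num)]; norm_num
  have hs0 : (Real.sqrt 2 : ℂ) ≠ 0 := by
    intro h; rw [h] at hs; norm_num at hs
  have hsinc : Real.sinc (p * (2 * x) / 2) = Real.cos (p * x / 2) * Real.sinc (p * x / 2) := by
    by_cases h : (p : ℝ) * x / 2 = 0
    · rw [show (p : ℝ) * (2 * x) / 2 = 2 * (p * x / 2) by ring, h]; simp
    · rw [show (p : ℝ) * (2 * x) / 2 = 2 * (p * x / 2) by ring, Real.sinc_of_ne_zero h,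
        Real.sinc_of_ne_zero (by simpa using h), Real.sin_two_mul]
      field_simp
  rw [hsinc]
  have e1 : Complex.exp (-(Complex.I * ((p * (2 * x) / 2 : ℝ) : ℂ))) =
      Complex.exp (-((p * x / 2 : ℝ) : ℂ) * Complex.I) ^ 2 := by
    rw [← Complex.exp_nat_mul]; congr 1; push_cast; ring
  have e2 : Complex.exp (-(Complex.I * ((p * x / 2 : ℝ) : ℂ))) =
      Complex.exp (-((p * x / 2 : ℝ) : ℂ) * Complex.I) := by congr 1; ring
  have e3 : Complex.exp (-(Complex.I * ((p * x : ℝ) : ℂ))) =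
      Complex.exp (-((p * x / 2 : ℝ) : ℂ) * Complex.I) ^ 2 := by
    rw [← Complex.exp_nat_mul]; congr 1; push_cast; ring
  have e4 : 2 * ((Real.cos (p * x / 2) : ℝ) : ℂ) * Complex.exp (-((p * x / 2 : ℝ) : ℂ) * Complex.I) =
      1 + Complex.exp (-((p * x / 2 : ℝ) : ℂ) * Complex.I) ^ 2 := by
    rw [Complex.ofReal_cos, Complex.two_cos, add_mul, ← Complex.exp_add]
    simp [sq]
  rw [e1, e2, e3, ← e4, Complex.ofReal_mul]
  field_simp
  rw [sq, hs]
  ring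

/-! ### The function `h_φ` -/

/-- The constant is `5 = 1 + 4`: the square of `sinc` is at most `1`, and multiplied by `x²` it is
at most `4/p² ≤ 4`. -/
theorem sinc_sq_le {p : ℕ} (hp : Odd p) (x : ℝ) : Real.sinc (p * x / 2) ^ 2 ≤ 5 / (1 + x ^ 2) := by
  have hp1 : (1 : ℝ) ≤ p := by exact_mod_cast hp.pos
  rw [le_div_iff₀ (by positivity)]
  have h1 : Real.sinc (p * x / 2) ^ 2 ≤ 1 := by
    rw [sq_le_one_iff_abs_le_one]; exact Real.abs_sinc_le_one _
  have h2 : Real.sinc (p * x / 2) ^ 2 * (p * x / 2) ^ 2 ≤ 1 := by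
    by_cases h : (p : ℝ) * x / 2 = 0
    · rw [h]; norm_num
    · rw [Real.sinc_of_ne_zero h, div_pow, div_mul_cancel₀ _ (pow_ne_zero 2 h)]
      exact Real.sin_sq_le_one _
  have h3 : Real.sinc (p * x / 2) ^ 2 * x ^ 2 ≤ 4 := by
    have h4 : x ^ 2 ≤ (p : ℝ) ^ 2 * x ^ 2 := by
      have : (1 : ℝ) ≤ (p : ℝ) ^ 2 := one_le_pow₀ hp1
      nlinarith [sq_nonneg x]
    have := mul_le_mul_of_nonneg_left h4 (sq_nonneg (Real.sinc (p * x / 2)))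
    nlinarith
  nlinarith

/-- With `y = x + 2kπ` one has `k² ≤ (2kπ)² ≤ 2y² + 2M²`, hence `5k² ≤ 10(1 + M²)(1 + y²)`, and
`sinc_sq_le` applies at `y`. The bound is uniform in `|x| ≤ M`. -/
theorem sinc_sq_shift_le {p : ℕ} (hp : Odd p) {M x : ℝ} (hx : |x| ≤ M) {k : ℤ} (hk : k ≠ 0) :
    Real.sinc (p * (x + 2 * k * Real.pi) / 2) ^ 2 ≤ 10 * (1 + M ^ 2) * (1 / (k : ℝ) ^ 2) := by
  refine (sinc_sq_le hp _).trans ?_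
  have hk0 : (0 : ℝ) < (k : ℝ) ^ 2 := by positivity
  rw [mul_one_div, div_le_div_iff₀ (by positivity) hk0]
  have hM : x ^ 2 ≤ M ^ 2 := sq_le_sq' (by linarith [abs_le.1 hx]) (abs_le.1 hx).2
  have h1 : (k : ℝ) ^ 2 ≤ (2 * k * Real.pi) ^ 2 := by
    have : (1 : ℝ) ≤ (2 * Real.pi) ^ 2 := one_le_pow₀ (by linarith [Real.pi_gt_three])
    nlinarith
  have h2 : (2 * k * Real.pi) ^ 2 ≤ 2 * (x + 2 * k * Real.pi) ^ 2 + 2 * x ^ 2 := by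
    nlinarith [sq_nonneg (2 * x + 2 * k * Real.pi)]
  nlinarith [mul_nonneg (sq_nonneg M) (sq_nonneg (x + 2 * k * Real.pi))]

theorem summable_norm_phiHat_sq {p : ℕ} (hp : Odd p) (x : ℝ) :
    Summable fun k : ℤ => ‖phiHat p (x + 2 * k * Real.pi)‖ ^ 2 := by
  refine Summable.of_norm_bounded_eventually
    ((Real.summable_one_div_int_pow.2 one_lt_two).mul_left (10 * (1 + |x| ^ 2))) ?_
  filter_upwards [(finite_singleton (0 : ℤ)).compl_mem_cofinite] with k hk
  rw [norm_phiHat_sq hp, Real.norm_of_nonneg (sq_nonneg _)]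
  exact sinc_sq_shift_le hp le_rfl hk

theorem hPhi_periodic (p : ℕ) : Function.Periodic (hPhi p) (2 * Real.pi) := per_periodic _

theorem continuous_hPhi {p : ℕ} (hp : Odd p) : Continuous (hPhi p) := by
  rw [continuous_iff_continuousAt]
  intro x
  set M := |x| + 1
  have hcont : ∀ k : ℤ, Continuous fun y : ℝ => ‖phiHat p (y + 2 * k * Real.pi)‖ ^ 2 := fun k => by
    have := continuous_phiHat hp
    fun_prop
  have h : ContinuousOn (hPhi p) (Metric.ball 0 M) := by
    -- Weierstrass test on a ball around `x`. Since `1 / 0 = 0`, the first summand is `0` at `k =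
    -- 0`; the second one supplies the bound `1` there.
    refine continuousOn_tsum (u := fun k : ℤ => 10 * (1 + M ^ 2) * (1 / (k : ℝ) ^ 2) +
      if k = 0 then 1 else 0) (fun k => (hcont k).continuousOn) ?_ ?_
    · refine ((Real.summable_one_div_int_pow.2 one_lt_two).mul_left _).add ?_
      exact summable_of_ne_finset_zero (s := {0}) fun k hk => if_neg (by simpa using hk)
    · intro k y hy
      have hy' : |y| ≤ M := by
        have := mem_ball_zero_iff.1 hy
        rw [Real.norm_eq_abs] at this
        exact this.le
      beta_reduce
      rw [norm_phiHat_sq hp, Real.norm_of_nonneg (sq_nonneg _)]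
      by_cases hk : k = 0
      · subst hk
        have : Real.sinc (p * (y + 2 * (0 : ℤ) * Real.pi) / 2) ^ 2 ≤ 1 := by
          rw [sq_le_one_iff_abs_le_one]; exact Real.abs_sinc_le_one _
        simpa using this
      · rw [if_neg hk, add_zero]
        exact sinc_sq_shift_le hp hy' hk
  refine h.continuousAt (Metric.isOpen_ball.mem_nhds ?_)
  rw [mem_ball_zero_iff, Real.norm_eq_abs]
  exact lt_add_one _

theorem norm_phiHat_half {p : ℕ} (hp : Odd p) (x : ℝ) :
    ‖phiHat p x‖ ^ 2 = Real.cos (p * x / 4) ^ 2 * ‖phiHat p (x / 2)‖ ^ 2 := by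
  have h := congrArg (fun u : ℂ => ‖u‖ ^ 2) (phiHat_two_mul hp (x / 2))
  simp only [norm_mul, mul_pow, norm_filter₀_cis, Complex.norm_real, Real.norm_eq_abs, sq_abs] at h
  rw [Real.sq_sqrt (by norm_num), show 2 * (x / 2) = x by ring,
    show (p : ℝ) * (x / 2) / 2 = p * x / 4 by ring] at h
  linarith

/-- The periodization is split by the parity of `k`. By `norm_phiHat_half`, the even translates of
`x` contribute the translates of `x/2` with weight `cos²`, the odd ones those of `x/2 + π`, where
oddness of `p` turns the weight into `sin²`. -/
theorem hPhi_eq {p : ℕ} (hp : Odd p) (x : ℝ) :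
    hPhi p x = Real.cos (p * x / 4) ^ 2 * hPhi p (x / 2) +
      Real.sin (p * x / 4) ^ 2 * hPhi p (x / 2 + Real.pi) := by
  have he : HasSum (fun k : ℤ => ‖phiHat p (x + 2 * (2 * k : ℤ) * Real.pi)‖ ^ 2)
      (Real.cos (p * x / 4) ^ 2 * hPhi p (x / 2)) := by
    refine (congrArg (HasSum · _) (funext fun k => ?_)).mpr
      ((summable_norm_phiHat_sq hp (x / 2)).hasSum.mul_left (Real.cos (p * x / 4) ^ 2))
    rw [norm_phiHat_half hp]
    have h1 : (p : ℝ) * (x + 2 * (2 * k : ℤ) * Real.pi) / 4 = p * x / 4 + ((p * k : ℤ) : ℝ) * Real.pi := by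
      push_cast; ring
    have h2 : (x + 2 * (2 * k : ℤ) * Real.pi) / 2 = x / 2 + 2 * k * Real.pi := by push_cast; ring
    rw [h1, h2, cos_sq_add_int_mul_pi]
  have ho : HasSum (fun k : ℤ => ‖phiHat p (x + 2 * (2 * k + 1 : ℤ) * Real.pi)‖ ^ 2)
      (Real.sin (p * x / 4) ^ 2 * hPhi p (x / 2 + Real.pi)) := by
    refine (congrArg (HasSum · _) (funext fun k => ?_)).mpr
      ((summable_norm_phiHat_sq hp (x / 2 + Real.pi)).hasSum.mul_left (Real.sin (p * x / 4) ^ 2))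
    rw [norm_phiHat_half hp]
    have h1 : (p : ℝ) * (x + 2 * (2 * k + 1 : ℤ) * Real.pi) / 4 =
        (p * x / 4 + p * (Real.pi / 2)) + ((p * k : ℤ) : ℝ) * Real.pi := by
      push_cast; ring
    have h2 : (x + 2 * (2 * k + 1 : ℤ) * Real.pi) / 2 = x / 2 + Real.pi + 2 * k * Real.pi := by
      push_cast; ring
    rw [h1, h2, cos_sq_add_int_mul_pi, cos_sq_add_odd_half_pi hp]
  have h2 : Function.Injective fun k : ℤ => 2 * k := mul_right_injective₀ two_ne_zero
  replace ho := ((add_left_injective (1 : ℤ)).comp h2).hasSum_range_iff (f := fun k : ℤ =>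
    ‖phiHat p (x + 2 * k * Real.pi)‖ ^ 2) |>.2 ho
  refine HasSum.tsum_eq (((h2.hasSum_range_iff (f := fun k : ℤ =>
    ‖phiHat p (x + 2 * k * Real.pi)‖ ^ 2)).2 he).add_isCompl ?_ ho)
  have e1 : range (fun k : ℤ => 2 * k) = {n : ℤ | Even n} := by
    ext k
    rw [mem_range, mem_ofPred_eq, even_iff_exists_two_mul]
    exact exists_congr fun _ => eq_comm
  have e2 : range ((fun k : ℤ => k + 1) ∘ fun k => 2 * k) = {n : ℤ | Odd n} := by
    ext k
    exact exists_congr fun _ => eq_comm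
  rw [e1, e2]
  exact Int.isCompl_even_odd

theorem hPhi_zero {p : ℕ} (hp : Odd p) : hPhi p 0 = 1 := by
  have hp0 : (p : ℝ) ≠ 0 := by exact_mod_cast hp.pos.ne'
  rw [hPhi, per, tsum_eq_single 0]
  · rw [norm_phiHat_sq hp]; simp
  · intro k hk
    rw [norm_phiHat_sq hp, Real.sinc_of_ne_zero (by simp [hp0, hk, Real.pi_ne_zero]),
      show (p : ℝ) * (0 + 2 * k * Real.pi) / 2 = ((p * k : ℤ) : ℝ) * Real.pi by push_cast; ring,
      Real.sin_int_mul_pi]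
    simp

/-- Each term of the periodization is `sinc²` at an integer multiple of `π`, and the integer `n +
pk` is never `0`. -/
theorem hPhi_root {p : ℕ} (hp : Odd p) {n : ℤ} (hn : ¬ (p : ℤ) ∣ n) :
    hPhi p (2 * Real.pi * n / p) = 0 := by
  have hp0 : (p : ℝ) ≠ 0 := by exact_mod_cast hp.pos.ne'
  rw [hPhi, per]
  convert tsum_zero with k
  have h1 : (p : ℝ) * (2 * Real.pi * n / p + 2 * k * Real.pi) / 2 = ((n + p * k : ℤ) : ℝ) * Real.pi := by
    push_cast; field_simp
  have h3 : n + p * k ≠ 0 := fun h => hn ⟨-k, by linarith⟩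
  rw [norm_phiHat_sq hp, h1, Real.sinc_of_ne_zero (mul_ne_zero (by exact_mod_cast h3) Real.pi_ne_zero),
    Real.sin_int_mul_pi]
  simp

theorem hPhi_mem_contSol {p : ℕ} (hp : Odd p) : (onCircle fun x => (hPhi p x : ℂ)) ∈ contSol p := by
  have hper : Function.Periodic (fun x => (hPhi p x : ℂ)) (2 * Real.pi) := fun x => by
    simp only [hPhi_periodic p x]
  refine ⟨continuous_onCircle (Complex.continuous_ofReal.comp (continuous_hPhi hp)) hper,
    (ruelle_eq_iff hp).2 fun x => ?_⟩
  rw [onCircle_cis hper, onCircle_cis hper, onCircle_cis hper, hPhi_eq hp x]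
  push_cast; ring

theorem cis_root_pow {p : ℕ} (hp : Odd p) (n : ℤ) : cis (2 * Real.pi * n / p) ^ p = 1 := by
  have hp0 : (p : ℝ) ≠ 0 := by exact_mod_cast hp.pos.ne'
  rw [← cis_nsmul, mul_div_cancel₀ _ hp0, cis_int]

/-- Two continuous fixed points of `R` with value `1` at `z = 1` and `0` at the other `p`-th roots
of unity coincide, so the series is evaluated without summing it. -/
theorem hPhi_eq_fejer {p : ℕ} (hp : Odd p) (x : ℝ) : hPhi p x = fejer p (cis x) := by
  have hp0 : (p : ℝ) ≠ 0 := by exact_mod_cast hp.pos.ne'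
  have hper : Function.Periodic (fun x => (hPhi p x : ℂ)) (2 * Real.pi) := fun x => by
    simp only [hPhi_periodic p x]
  have h := contSol_ext hp (hPhi_mem_contSol hp) (fejer_mem_contSol p) fun n => ?_
  · have := congrFun h (cis x)
    rw [onCircle_cis hper] at this
    exact_mod_cast this
  · rw [onCircle_cis hper]
    congr 1
    by_cases hn : (p : ℤ) ∣ n
    · obtain ⟨m, rfl⟩ := hn
      have h1 : 2 * Real.pi * ((p * m : ℤ) : ℝ) / p = 0 + m * (2 * Real.pi) := by
        push_cast; field_simp; ring
      have h2 : cis (2 * Real.pi * ((p * m : ℤ) : ℝ) / p) = 1 := by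
        rw [h1, zero_add, mul_comm, cis_int]
      rw [h2, fejer_one hp, h1, (hPhi_periodic p).int_mul m 0, hPhi_zero hp]
    · rw [hPhi_root hp hn, fejer_root _ (cis_root_pow hp n)]
      intro h
      rw [← cis_zero, cis_eq_cis] at h
      obtain ⟨m, hm⟩ := h
      apply hn
      refine ⟨m, ?_⟩
      rw [div_eq_iff hp0, zero_add, mul_assoc, mul_assoc, mul_assoc] at hm
      have := mul_left_cancel₀ two_ne_zero hm
      have := mul_left_cancel₀ Real.pi_ne_zero this
      rw [mul_comm]; exact_mod_cast this

theorem hPhi_mul_sin_sq {p : ℕ} (hp : Odd p) (t : ℝ) :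
    hPhi p t * Real.sin (t / 2) ^ 2 = 1 / (p : ℝ) ^ 2 * Real.sin (p * t / 2) ^ 2 := by
  rw [hPhi_eq_fejer hp, fejer_mul_sin_sq]

theorem hPhi_closed_form {p : ℕ} (hp : Odd p) {t : ℝ} (ht : Real.sin (t / 2) ≠ 0) :
    hPhi p t = 1 / (p : ℝ) ^ 2 * (Real.sin (p * t / 2) ^ 2 / Real.sin (t / 2) ^ 2) := by
  rw [← mul_div_assoc, eq_div_iff (pow_ne_zero 2 ht), hPhi_mul_sin_sq hp]

theorem hPhi_nonneg (p : ℕ) (x : ℝ) : 0 ≤ hPhi p x := tsum_nonneg fun _ => sq_nonneg _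

/-! ### The functions `h_O` -/

theorem cis_congr_mod {p : ℕ} (hp : Odd p) {m n : ℤ} (h : m ≡ n [ZMOD p]) :
    cis (2 * Real.pi * m / p) = cis (2 * Real.pi * n / p) := by
  have hp0 : (p : ℝ) ≠ 0 := by exact_mod_cast hp.pos.ne'
  obtain ⟨k, hk⟩ := h.symm.dvd
  refine cis_eq_cis.2 ⟨k, ?_⟩
  have : (m : ℝ) = n + p * k := by exact_mod_cast (by linarith : m = n + p * k)
  rw [this]; field_simp

/-- The sign is chosen to fit the shifts `+2πl/p` in `h_O`: the nodes are `-2πm/p`, with `m` the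
residue of `-n`. -/
theorem exists_root {p : ℕ} (hp : Odd p) (n : ℤ) :
    ∃ m : Fin p, cis (2 * Real.pi * n / p) = cis (-(2 * Real.pi * (m : ℕ) / p)) := by
  have hp0 : (p : ℤ) ≠ 0 := by exact_mod_cast hp.pos.ne'
  have h1 := Int.emod_nonneg (-n) hp0
  have h2 := Int.emod_lt_of_pos (-n) (by exact_mod_cast hp.pos : (0 : ℤ) < p)
  refine ⟨⟨((-n) % p).toNat, by omega⟩, ?_⟩
  have h3 : ((((-n) % p).toNat : ℕ) : ℝ) = (((-n) % p : ℤ) : ℝ) := by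
    rw [← Int.cast_natCast, Int.toNat_of_nonneg h1]
  rw [show -(2 * Real.pi * (((⟨((-n) % p).toNat, by omega⟩ : Fin p) : ℕ) : ℝ) / p) =
    2 * Real.pi * ((-((-n) % p) : ℤ) : ℝ) / p by rw [h3]; push_cast; ring]
  refine cis_congr_mod hp ?_
  have := (Int.mod_modEq (-n) p).neg
  rw [neg_neg] at this
  exact this.symm

theorem contSol_ext_root {p : ℕ} (hp : Odd p) {g h : Circle → ℂ} (hg : g ∈ contSol p)
    (hh : h ∈ contSol p)
    (h0 : ∀ m : Fin p, g (cis (-(2 * Real.pi * (m : ℕ) / p))) =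
      h (cis (-(2 * Real.pi * (m : ℕ) / p)))) : g = h :=
  contSol_ext hp hg hh fun n => by
    obtain ⟨m, hm⟩ := exists_root hp n
    rw [hm, h0]

theorem sigma_val {p : ℕ} (hp : Odd p) (k : Fin p) : ((sigma p hp k : Fin p) : ℕ) = 2 * k % p := rfl

theorem cis_sigma {p : ℕ} (hp : Odd p) (k : Fin p) :
    cis (2 * Real.pi * ((sigma p hp k : Fin p) : ℕ) / p) = cis (2 * Real.pi * (2 * (k : ℕ)) / p) := by
  have := cis_congr_mod hp (m := ((sigma p hp k : Fin p) : ℕ)) (n := 2 * (k : ℕ)) (by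
    rw [sigma_val]
    push_cast
    exact Int.mod_modEq _ _)
  push_cast at this
  exact this

theorem hPhi_congr_cis {p : ℕ} {x y : ℝ} (h : cis x = cis y) : hPhi p x = hPhi p y := by
  rw [← onCircle_cis (hPhi_periodic p), h, onCircle_cis (hPhi_periodic p)]

theorem hOrb_periodic (p : ℕ) (O : Finset (Fin p)) : Function.Periodic (hOrb p O) (2 * Real.pi) := by
  intro x
  refine Finset.sum_congr rfl fun l _ => ?_
  rw [← hPhi_periodic p (x + _)]
  congr 1; ring

theorem hOrbC_cis (p : ℕ) (O : Finset (Fin p)) (x : ℝ) : hOrbC p O (cis x) = hOrb p O x := by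
  refine onCircle_cis (g := fun x => (hOrb p O x : ℂ)) (fun x => ?_) x
  simp only [hOrb_periodic p O x]

theorem continuous_hOrb {p : ℕ} (hp : Odd p) (O : Finset (Fin p)) : Continuous (hOrb p O) := by
  have := continuous_hPhi hp
  unfold hOrb; fun_prop

theorem hOrb_nonneg (p : ℕ) (O : Finset (Fin p)) (x : ℝ) : 0 ≤ hOrb p O x :=
  Finset.sum_nonneg fun _ _ => hPhi_nonneg p _

/-- Reindexing the sum by `σ` replaces the shift `2πl/p` by `4πl/p` modulo `2π`. After halving it is
`2πl/p` again, and the angle `px/4` in the weights changes only by `lπ`. -/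
theorem hOrb_eq {p : ℕ} (hp : Odd p) {O : Finset (Fin p)} (hO : ∀ l, sigma p hp l ∈ O ↔ l ∈ O)
    (x : ℝ) : hOrb p O x = Real.cos (p * x / 4) ^ 2 * hOrb p O (x / 2) +
      Real.sin (p * x / 4) ^ 2 * hOrb p O (x / 2 + Real.pi) := by
  have hp0 : (p : ℝ) ≠ 0 := by exact_mod_cast hp.pos.ne'
  have h1 : hOrb p O x = ∑ l ∈ O, hPhi p (x + 2 * Real.pi * ((sigma p hp l : Fin p) : ℕ) / p) := by
    rw [hOrb]
    exact (Finset.sum_equiv (sigma p hp) (fun l => (hO l).symm) fun l _ => rfl).symm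
  rw [h1, hOrb, hOrb, Finset.mul_sum, Finset.mul_sum, ← Finset.sum_add_distrib]
  refine Finset.sum_congr rfl fun l _ => ?_
  rw [hPhi_congr_cis (p := p) (y := x + 2 * Real.pi * (2 * (l : ℕ)) / p)
    (by rw [cis_add, cis_add, cis_sigma hp]), hPhi_eq hp]
  have e1 : (p : ℝ) * (x + 2 * Real.pi * (2 * (l : ℕ)) / p) / 4 =
      p * x / 4 + ((l : ℕ) : ℤ) * Real.pi := by
    push_cast; field_simp; ring
  have e2 : (x + 2 * Real.pi * (2 * (l : ℕ)) / p) / 2 = x / 2 + 2 * Real.pi * (l : ℕ) / p := by ring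
  have e3 : x / 2 + 2 * Real.pi * (l : ℕ) / p + Real.pi =
    x / 2 + Real.pi + 2 * Real.pi * (l : ℕ) / p := by ring
  rw [e1, e2, e3, cos_sq_add_int_mul_pi, Real.sin_sq, cos_sq_add_int_mul_pi, ← Real.sin_sq]

theorem hOrbC_mem_contSol {p : ℕ} (hp : Odd p) {O : Finset (Fin p)}
    (hO : ∀ l, sigma p hp l ∈ O ↔ l ∈ O) : hOrbC p O ∈ contSol p := by
  refine ⟨continuous_onCircle (Complex.continuous_ofReal.comp (continuous_hOrb hp O)) fun x => ?_,
    (ruelle_eq_iff hp).2 fun x => ?_⟩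
  · simp only [hOrb_periodic p O x]
  · rw [hOrbC_cis, hOrbC_cis, hOrbC_cis, hOrb_eq hp hO]
    push_cast; rfl

/-- At the node `-2πm/p` the summand with index `l` is `h_φ` at `2π(l-m)/p`, which is `1` for `l =
m` and `0` otherwise. -/
theorem hOrb_root {p : ℕ} (hp : Odd p) (O : Finset (Fin p)) (m : Fin p) :
    hOrb p O (-(2 * Real.pi * (m : ℕ) / p)) = if m ∈ O then 1 else 0 := by
  have h1 : ∀ l : Fin p, hPhi p (-(2 * Real.pi * (m : ℕ) / p) + 2 * Real.pi * (l : ℕ) / p) =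
      if l = m then 1 else 0 := by
    intro l
    have e : -(2 * Real.pi * (m : ℕ) / p) + 2 * Real.pi * (l : ℕ) / p =
      2 * Real.pi * (((l : ℕ) : ℤ) - ((m : ℕ) : ℤ) : ℤ) / p := by push_cast; ring
    rw [e]
    split_ifs with h
    · subst h; simp [hPhi_zero hp]
    · refine hPhi_root hp fun hd => h ?_
      have h2 : ((m : ℕ) : ℤ) ≡ ((l : ℕ) : ℤ) [ZMOD p] := (Int.modEq_iff_dvd).2 hd
      have h3 : (m : ℕ) ≡ (l : ℕ) [MOD p] := (Int.natCast_modEq_iff).1 h2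
      exact Fin.ext (Nat.ModEq.eq_of_lt_of_lt h3 m.2 l.2).symm
  rw [hOrb, Finset.sum_congr rfl fun l _ => h1 l]
  simp

theorem hOrb_univ {p : ℕ} (hp : Odd p) (x : ℝ) : hOrb p Finset.univ x = 1 := by
  have h := contSol_ext_root hp (hOrbC_mem_contSol hp (O := Finset.univ) (by simp))
    (one_mem_contSol hp) fun m => by rw [hOrbC_cis, hOrb_root hp]; simp
  have := congrFun h (cis x)
  rw [hOrbC_cis] at this
  exact_mod_cast this

theorem hOrb_le_one {p : ℕ} (hp : Odd p) (O : Finset (Fin p)) (x : ℝ) : hOrb p O x ≤ 1 := by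
  rw [← hOrb_univ hp x]
  exact Finset.sum_le_sum_of_subset_of_nonneg (Finset.subset_univ _) fun _ _ _ => hPhi_nonneg p _

theorem sigma_mem_cycle {p : ℕ} (hp : Odd p) {O : Finset (Fin p)} (hO : O ∈ cycles (sigma p hp))
    (l : Fin p) : sigma p hp l ∈ O ↔ l ∈ O := by
  obtain ⟨k, hk⟩ := hO
  rw [hk, hk, Equiv.Perm.sameCycle_apply_right]

theorem cycle_nonempty {p : ℕ} {s : Equiv.Perm (Fin p)} {O : Finset (Fin p)}
    (hO : O ∈ cycles s) : O.Nonempty := by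
  obtain ⟨k, hk⟩ := hO
  exact ⟨k, (hk k).2 (Equiv.Perm.SameCycle.refl s k)⟩

/-- The summands are nonnegative, so a zero of the sum is a zero of one of them. By
`hPhi_mul_sin_sq` it then lies over a `p`-th root of unity, where `hOrb_root` gives the value. -/
theorem hOrb_eq_zero_iff {p : ℕ} (hp : Odd p) {O : Finset (Fin p)} (hO : O.Nonempty) (x : ℝ) :
    hOrb p O x = 0 ↔
      ∃ l : Fin p, l ∉ O ∧ ∃ n : ℤ, x = -(2 * Real.pi * (l : ℕ) / p) + 2 * Real.pi * n := by
  have hp0 : (p : ℝ) ≠ 0 := by exact_mod_cast hp.pos.ne'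
  constructor
  · intro h
    obtain ⟨l, hl⟩ := hO
    have h1 := (Finset.sum_eq_zero_iff_of_nonneg fun _ _ => hPhi_nonneg p _).1 h l hl
    have h2 := hPhi_mul_sin_sq hp (x + 2 * Real.pi * (l : ℕ) / p)
    rw [h1, zero_mul] at h2
    have h3 : Real.sin (p * (x + 2 * Real.pi * (l : ℕ) / p) / 2) = 0 := by
      have : (1 : ℝ) / (p : ℝ) ^ 2 ≠ 0 := by positivity
      simpa [this, hp0] using h2.symm
    obtain ⟨k, hk⟩ := Real.sin_eq_zero_iff.1 h3
    have h4 : x = 2 * Real.pi * ((k - (l : ℕ) : ℤ) : ℝ) / p := by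
      push_cast; field_simp at hk ⊢; linarith
    obtain ⟨m, hm⟩ := exists_root hp (k - (l : ℕ))
    rw [← h4] at hm
    obtain ⟨n, hn⟩ := cis_eq_cis.1 hm
    refine ⟨m, fun hmO => ?_, n, hn⟩
    rw [hn, mul_comm (2 * Real.pi) (n : ℝ), (hOrb_periodic p O).int_mul n, hOrb_root hp,
      if_pos hmO] at h
    exact one_ne_zero h
  · rintro ⟨l, hl, n, rfl⟩
    rw [mul_comm (2 * Real.pi) (n : ℝ), (hOrb_periodic p O).int_mul n, hOrb_root hp, if_neg hl]

/-- At the point `-4πm/p` the two weights are `cos²(mπ) = 1` and `sin²(mπ) = 0`, so the fixed point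
equation reduces to equality of the values at the node and at its square. -/
theorem contSol_root_sigma {p : ℕ} (hp : Odd p) {h : Circle → ℂ} (hh : h ∈ contSol p) (m : Fin p) :
    h (cis (-(2 * Real.pi * ((sigma p hp m : Fin p) : ℕ) / p))) =
      h (cis (-(2 * Real.pi * (m : ℕ) / p))) := by
  have hp0 : (p : ℝ) ≠ 0 := by exact_mod_cast hp.pos.ne'
  rw [cis_neg, cis_sigma hp, ← cis_neg, (ruelle_eq_iff hp).1 hh.2]
  have e1 : (p : ℝ) * -(2 * Real.pi * (2 * (m : ℕ)) / p) / 4 = -((m : ℕ) * Real.pi) := by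
    field_simp
    ring
  have e2 : -(2 * Real.pi * (2 * (m : ℕ)) / p) / 2 = -(2 * Real.pi * (m : ℕ) / p) := by ring
  rw [e1, e2, Real.sin_neg, Real.sin_nat_mul_pi, Real.cos_neg, Real.cos_nat_mul_pi, ← pow_mul,
    mul_comm (m : ℕ), pow_mul]
  simp

theorem contSol_root_sameCycle {p : ℕ} (hp : Odd p) {h : Circle → ℂ} (hh : h ∈ contSol p)
    {k l : Fin p} (hkl : (sigma p hp).SameCycle k l) :
    h (cis (-(2 * Real.pi * (k : ℕ) / p))) = h (cis (-(2 * Real.pi * (l : ℕ) / p))) := by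
  obtain ⟨i, -, hi⟩ := hkl.exists_pow_eq'
  rw [← hi]
  clear hi hkl
  induction i with
  | zero => simp
  | succ i ih => rw [pow_succ', Equiv.Perm.mul_apply, contSol_root_sigma hp hh, ih]

theorem exists_cycle {p : ℕ} (s : Equiv.Perm (Fin p)) (m : Fin p) : ∃ O : cycles s, m ∈ O.1 := by
  classical
  exact ⟨⟨Finset.univ.filter (s.SameCycle m), m, fun l => by simp⟩,
    by simpa using Equiv.Perm.SameCycle.refl s m⟩

theorem cycle_eq {p : ℕ} {s : Equiv.Perm (Fin p)} {O O' : cycles s} {m : Fin p} (h : m ∈ O.1)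
    (h' : m ∈ O'.1) : O = O' := by
  obtain ⟨O, k, hk⟩ := O
  obtain ⟨O', k', hk'⟩ := O'
  refine Subtype.ext (Finset.ext fun l => ?_)
  rw [hk, hk']
  have h1 := (hk m).1 h
  have h2 := (hk' m).1 h'
  exact ⟨fun h => h2.trans (h1.symm.trans h), fun h => h1.trans (h2.symm.trans h)⟩

theorem sum_hOrbC_root {p : ℕ} (hp : Odd p) {s : Equiv.Perm (Fin p)} [Fintype (cycles s)]
    (c : cycles s → ℂ) (O : cycles s) {m : Fin p} (hm : m ∈ O.1) :
    (∑ O', c O' • hOrbC p O') (cis (-(2 * Real.pi * (m : ℕ) / p))) = c O := by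
  rw [Finset.sum_apply, Finset.sum_eq_single O]
  · rw [Pi.smul_apply, hOrbC_cis, hOrb_root hp, if_pos hm]; simp
  · intro O' _ hne
    rw [Pi.smul_apply, hOrbC_cis, hOrb_root hp, if_neg fun h => hne (cycle_eq h hm)]; simp
  · simp

theorem linearIndependent_hOrbC {p : ℕ} (hp : Odd p) :
    LinearIndependent ℂ fun O : cycles (sigma p hp) => hOrbC p O := by
  classical
  have := Fintype.ofFinite (cycles (sigma p hp))
  rw [Fintype.linearIndependent_iff]
  intro c hc O
  obtain ⟨m, hm⟩ := cycle_nonempty O.2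
  rw [← sum_hOrbC_root hp c O hm, hc, Pi.zero_apply]

theorem contSol_eq_span {p : ℕ} (hp : Odd p) :
    contSol p = (Submodule.span ℂ
      (Set.range fun O : cycles (sigma p hp) => hOrbC p O) : Set (Circle → ℂ)) := by
  classical
  have := Fintype.ofFinite (cycles (sigma p hp))
  have hmem : ∀ O : cycles (sigma p hp), hOrbC p O ∈ contSolSub p hp := fun O =>
    hOrbC_mem_contSol hp (sigma_mem_cycle hp O.2)
  refine Subset.antisymm (fun h hh => ?_) ?_
  · choose r hr using fun O : cycles (sigma p hp) => cycle_nonempty O.2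
    -- Interpolation: the coefficient of `h_O` is the value of `h` at one node of the cycle, and any
    -- node of the cycle gives the same value.
    have h1 : h = ∑ O : cycles (sigma p hp),
        h (cis (-(2 * Real.pi * (r O : ℕ) / p))) • hOrbC p O := by
      refine contSol_ext_root hp hh
        ((contSolSub p hp).sum_mem fun O _ => (contSolSub p hp).smul_mem _ (hmem O)) fun m => ?_
      obtain ⟨O, hO⟩ := exists_cycle (sigma p hp) m
      rw [sum_hOrbC_root hp (fun O => h (cis (-(2 * Real.pi * (r O : ℕ) / p)))) O hO]
      refine contSol_root_sameCycle hp hh ?_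
      obtain ⟨k, hk⟩ := O.2
      exact ((hk m).1 hO).symm.trans ((hk _).1 (hr O))
    rw [h1]
    exact Submodule.sum_mem _ fun O _ => Submodule.smul_mem _ _ (Submodule.subset_span ⟨O, rfl⟩)
  · change Submodule.span ℂ _ ≤ contSolSub p hp
    rw [Submodule.span_le]
    rintro _ ⟨O, rfl⟩
    exact hmem O

/-! ### Representatives of the basic operators -/

theorem mulOp_ae (g : LinfR) (ψ : L2R) : ∀ᵐ x, mulOp g ψ x = g x * ψ x := by
  have := ContinuousLinearMap.coeFn_holder (r := 2) (ContinuousLinearMap.mul ℂ ℂ) g ψ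
  filter_upwards [this] with x hx
  exact hx

theorem compLinf_ae {X Y : Type*} [MeasurableSpace X] [MeasurableSpace Y] {μ : Measure X}
    {ν : Measure Y} {g : X → Y} (hg : Measure.QuasiMeasurePreserving g μ ν) (f : Lp ℂ ∞ ν) :
    ∀ᵐ x ∂μ, compLinf g hg f x = f (g x) := (memLp_comp hg f).coeFn_toLp

theorem lift_ae (f : LinfT) : ∀ᵐ x, lift f x = f (cis x) := compLinf_ae qmp_cis f

theorem alpha_ae (η : Circle) (f : LinfT) : ∀ᵐ z ∂haarT, alpha η f z = f (η * z) :=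
  compLinf_ae (qmp_rot η) f

theorem powT_ae (N : ℕ) (hN : N ≠ 0) (f : LinfT) : ∀ᵐ z ∂haarT, powT N hN f z = f (z ^ N) :=
  compLinf_ae (qmp_pow N hN) f

theorem ofCont_ae (f : C(Circle, ℂ)) : ∀ᵐ z ∂haarT, ofCont f z = f z :=
  ContinuousMap.coeFn_toLp haarT f

theorem lift_alpha_ae (p k : ℕ) (f : LinfT) :
    ∀ᵐ x, lift (alpha (rhoPow p k) f) x = f (cis (x - 2 * Real.pi * k / p)) := by
  filter_upwards [lift_ae (alpha (rhoPow p k) f), qmp_cis.ae (alpha_ae (rhoPow p k) f)]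
    with x h1 h2
  rw [h1, h2, rhoPow_mul_cis]

theorem dil_ae (c : ℝ) (hc : 0 < c) (ψ : L2R) :
    ∀ᵐ x, dil c hc ψ x = (Real.sqrt c : ℂ) * ψ (c * x) := dilFun_ae c hc ψ

theorem phi_ae (p : ℕ) : ∀ᵐ x, phi p x = phiFun p x := indicatorConstLp_coeFn

/-! ### The Fourier transform of integrable functions -/

/-- `∫ f(t) e^{-itx} dt`. -/
def ft (f : ℝ → ℂ) (x : ℝ) : ℂ := ∫ t : ℝ, f t * Complex.exp (-(Complex.I * (t : ℂ) * (x : ℂ)))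

open scoped FourierTransform in
theorem fourier_eq_ft (f : ℝ → ℂ) (w : ℝ) : 𝓕 f w = ft f (2 * Real.pi * w) := by
  rw [Real.fourier_real_eq_integral_exp_smul, ft]
  congr 1; funext t
  rw [smul_eq_mul, mul_comm]
  congr 2; push_cast; ring

open scoped FourierTransform in
-- On `L¹ ∩ L²` the Plancherel transform is the Fourier integral: both have the same integrals
-- against smooth compactly supported functions, one side through tempered distributions, the other
-- through Fubini.
theorem Lp_fourier_ae {f : L2R} (hf : Integrable f) :
    ∀ᵐ x, Lp.fourierTransformₗᵢ ℝ ℂ f x = 𝓕 (f : ℝ → ℂ) x := by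
  have hcont : Continuous (𝓕 (f : ℝ → ℂ)) :=
    VectorFourier.fourierIntegral_continuous Real.continuous_fourierChar continuous_inner hf
  refine ae_eq_of_integral_contDiff_smul_eq
    ((Lp.memLp (Lp.fourierTransformₗᵢ ℝ ℂ f)).locallyIntegrable (by norm_num))
    hcont.locallyIntegrable fun g hg hgc => ?_
  have hg' : ContDiff ℝ (⊤ : ℕ∞) fun x => (g x : ℂ) := Complex.ofRealCLM.contDiff.comp hg
  have hgc' : HasCompactSupport fun x => (g x : ℂ) := hgc.comp_left Complex.ofReal_zero
  let G := hgc'.toSchwartzMap hg'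
  have h1 : (𝓕 (Lp.toTemperedDistribution f)) G = (Lp.toTemperedDistribution (𝓕 f)) G := by
    rw [Lp.fourier_toTemperedDistribution_eq]
  rw [TemperedDistribution.fourier_apply, Lp.toTemperedDistribution_apply,
    Lp.toTemperedDistribution_apply] at h1
  have h2 := VectorFourier.integral_fourierIntegral_smul_eq_flip (L := innerₗ ℝ) (μ := volume)
    (ν := volume) (f := fun x => (g x : ℂ)) (g := (f : ℝ → ℂ)) Real.continuous_fourierChar
    continuous_inner G.integrable hf
  rw [flip_innerₗ] at h2
  have h3 : ∫ x, G x • (𝓕 f : L2R) x = ∫ x, (g x : ℂ) • 𝓕 (f : ℝ → ℂ) x := by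
    rw [← h1]
    exact h2
  exact h3

theorem fourierU_ae {f : L2R} (hf : Integrable f) :
    ∀ᵐ x, fourierU f x = (Real.sqrt (2 * Real.pi)⁻¹ : ℂ) * ft f x := by
  have hc : (0 : ℝ) < (2 * Real.pi)⁻¹ := by positivity
  filter_upwards [dil_ae (2 * Real.pi)⁻¹ hc (Lp.fourierTransformₗᵢ ℝ ℂ f),
    (qmp_mul _ hc).ae (Lp_fourier_ae hf)] with x h1 h2
  refine h1.trans ?_
  rw [h2, fourier_eq_ft, mul_inv_cancel_left₀ Real.two_pi_pos.ne']

theorem ft_congr {f g : ℝ → ℂ} (h : f =ᵐ[volume] g) (x : ℝ) : ft f x = ft g x := by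
  refine integral_congr_ae ?_
  filter_upwards [h] with t ht
  rw [ht]

theorem fourierU_phi_ae (p : ℕ) :
    ∀ᵐ x, fourierU (phi p) x = (Real.sqrt (2 * Real.pi)⁻¹ : ℂ) * phiHat p x := by
  have h : Integrable (phi p) := by
    have : Integrable (phiFun p) := by
      rw [phiFun, integrable_indicator_iff measurableSet_Ioo]
      exact integrableOn_const (by simp)
    exact this.congr (Filter.EventuallyEq.symm (phi_ae p))
  filter_upwards [fourierU_ae h] with x hx
  rw [hx, ft_congr (phi_ae p)]
  rfl

/-- Schwartz functions are integrable and dense in `L²`. Identities for the `L²` transform thus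
reduce to computations with the Fourier integral. -/
theorem eq_of_eq_on_integrable {A B : L2R → L2R} (hA : Continuous A) (hB : Continuous B)
    (h : ∀ ψ : L2R, Integrable ψ → A ψ = B ψ) : A = B := by
  refine (SchwartzMap.denseRange_toLpCLM (E := ℝ) (F := ℂ) (p := 2) (μ := volume)
    (by simp)).equalizer hA hB ?_
  funext g
  refine h _ ?_
  exact g.integrable.congr (g.coeFn_toLp 2 volume).symm

theorem fourierU_waveU (ψ : L2R) : fourierU (waveU ψ) = waveUHat (fourierU ψ) := by
  refine congrFun (eq_of_eq_on_integrable (A := fun ψ => fourierU (waveU ψ))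
    (B := fun ψ => waveUHat (fourierU ψ)) (by fun_prop) (by fun_prop) fun ψ hψ => ?_) ψ
  have h1 : ∀ᵐ x, waveU ψ x = (Real.sqrt (1 / 2) : ℂ) * ψ (1 / 2 * x) := dil_ae _ _ ψ
  have h2 : Integrable (waveU ψ) :=
    ((hψ.comp_mul_left' (by norm_num : (1 / 2 : ℝ) ≠ 0)).const_mul _).congr
      (Filter.EventuallyEq.symm h1)
  refine Lp.ext ?_
  filter_upwards [fourierU_ae h2, dil_ae 2 (by norm_num) (fourierU ψ),
    (qmp_mul 2 (by norm_num)).ae (fourierU_ae hψ)] with x h3 h4 h5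
  rw [h3]
  refine Eq.trans ?_ h4.symm
  rw [h5, ft_congr h1, ft, ft]
  have h6 := Measure.integral_comp_mul_left (fun t : ℝ => (Real.sqrt (1 / 2) : ℂ) * (ψ t *
    Complex.exp (-(Complex.I * (t : ℂ) * ((2 * x : ℝ) : ℂ))))) (1 / 2 : ℝ)
  have h7 : ∀ t : ℝ, (Real.sqrt (1 / 2) : ℂ) * ψ (1 / 2 * t) *
      Complex.exp (-(Complex.I * (t : ℂ) * (x : ℂ))) = (Real.sqrt (1 / 2) : ℂ) * (ψ (1 / 2 * t) *
    Complex.exp (-(Complex.I * ((1 / 2 * t : ℝ) : ℂ) * ((2 * x : ℝ) : ℂ)))) := by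
    intro t
    rw [mul_assoc]; congr 3; push_cast; ring
  simp only [h7, h6]
  have h8 : (Real.sqrt 2 : ℂ) = 2 * Real.sqrt (1 / 2) := by
    rw [show (2 : ℂ) = ((2 : ℝ) : ℂ) by norm_num, ← Complex.ofReal_mul]
    congr 1
    rw [Real.sqrt_eq_iff_mul_self_eq (by norm_num) (by positivity)]
    have := Real.mul_self_sqrt (show (0 : ℝ) ≤ 1 / 2 by norm_num)
    linarith
  rw [h8, integral_const_mul, Complex.real_smul]
  norm_num
  ring

/-- The function `z` on the circle. -/
def idT : C(Circle, ℂ) := ⟨fun z => (z : ℂ), by fun_prop⟩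

theorem wavePi_idT (ψ : L2R) :
    ∀ᵐ x : ℝ, wavePi (ofCont idT) ψ x = ψ (x - 1) := by
  have hmp : MeasurePreserving (fun x : ℝ => x - 1) volume volume :=
    measurePreserving_sub_right volume 1
  let T : L2R →ₗᵢ[ℂ] L2R := Lp.compMeasurePreservingₗᵢ ℂ (fun x : ℝ => x - 1) hmp
  have hT : ∀ ψ : L2R, ∀ᵐ x, T ψ x = ψ (x - 1) := fun ψ => Lp.coeFn_compMeasurePreserving ψ hmp
  -- `T` is translation by `1`; on the Fourier side it must be multiplication by `e^{-ix}`, which is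
  -- the function `z`.
  suffices h : fourierU (T ψ) = wavePiHat (ofCont idT) (fourierU ψ) by
    have h' : wavePi (ofCont idT) ψ = T ψ := by
      change fourierU.symm (wavePiHat (ofCont idT) (fourierU ψ)) = T ψ
      rw [← h, LinearIsometryEquiv.symm_apply_apply]
    rw [h']
    exact hT ψ
  refine congrFun (eq_of_eq_on_integrable (A := fun ψ => fourierU (T ψ))
    (B := fun ψ => wavePiHat (ofCont idT) (fourierU ψ)) (by fun_prop) (by fun_prop)
    fun ψ hψ => ?_) ψ
  have h2 : Integrable (T ψ) := (hψ.comp_sub_right 1).congr (Filter.EventuallyEq.symm (hT ψ))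
  refine Lp.ext ?_
  filter_upwards [fourierU_ae h2, mulOp_ae (lift (ofCont idT)) (fourierU ψ), fourierU_ae hψ,
    lift_ae (ofCont idT), qmp_cis.ae (ofCont_ae idT)] with x h3 h4 h5 h6 h7
  rw [h3]
  refine Eq.trans ?_ h4.symm
  rw [h5, h6, h7, ft_congr (hT ψ), ft, ft,
    ← integral_sub_right_eq_self (fun t => ψ t * Complex.exp (-(Complex.I * t * x))) 1,
    mul_left_comm, ← integral_const_mul (idT (cis x))]
  congr 2; funext t
  have : idT (cis x) = Complex.exp (-(Complex.I * x)) := coe_cis x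
  rw [this, mul_left_comm, ← Complex.exp_add]
  congr 2; push_cast; ring

section

/-! ### The `p`-fold representation in coordinates -/

theorem ampPi_apply (p : ℕ) (π : LinfT → L2R →L[ℂ] L2R) (f : LinfT) (ξ : H1 p) (k : Fin p) :
    ampPi p π f ξ k = π (alpha (rhoPow p k) f) (ξ k) := rfl

theorem ampU_apply (p : ℕ) (hp : Odd p) (U : L2R ≃ₗᵢ[ℂ] L2R) (ξ : H1 p) (k : Fin p) :
    ampU p hp U ξ k = U (ξ (sigma p hp k)) := rfl

theorem ampU_symm_apply (p : ℕ) (hp : Odd p) (U : L2R ≃ₗᵢ[ℂ] L2R) (ξ : H1 p) (k : Fin p) :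
    (ampU p hp U).symm ξ k = U.symm (ξ ((sigma p hp).symm k)) := by
  obtain ⟨η, rfl⟩ := (ampU p hp U).surjective ξ
  rw [LinearIsometryEquiv.symm_apply_apply, ampU_apply, LinearIsometryEquiv.symm_apply_apply,
    Equiv.apply_symm_apply]

theorem fourier1_apply (p : ℕ) (ξ : H1 p) (k : Fin p) : fourier1 p ξ k = fourierU (ξ k) := rfl

theorem inner_L2 (ξ η : L2R) : inner ℂ ξ η = ∫ x, conj (ξ x) * η x := by
  rw [L2.inner_def]
  simp [RCLike.inner_apply, mul_comm]

theorem integrable_inner_L2 (ξ η : L2R) : Integrable fun x => conj (ξ x) * η x := by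
  have := L2.integrable_inner (𝕜 := ℂ) ξ η
  simpa [RCLike.inner_apply, mul_comm] using this

theorem inner_H1 {p : ℕ} (ξ η : H1 p) : inner ℂ ξ η = ∑ k, ∫ x, conj (ξ k x) * η k x := by
  rw [PiLp.inner_apply]
  simp only [inner_L2]

theorem H1_ext {p : ℕ} {ξ η : H1 p} (h : ∀ k, ∀ᵐ x, ξ k x = η k x) : ξ = η :=
  PiLp.ext fun k => Lp.ext (h k)

theorem waveUHat_ae (ψ : L2R) : ∀ᵐ x, waveUHat ψ x = (Real.sqrt 2 : ℂ) * ψ (2 * x) :=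
  dil_ae _ _ ψ

theorem waveUHat_symm_ae (ψ : L2R) :
    ∀ᵐ x, waveUHat.symm ψ x = (Real.sqrt (2⁻¹) : ℂ) * ψ (2⁻¹ * x) :=
  dilFun_ae 2⁻¹ (by norm_num) ψ

theorem smulT_ae (f g : LinfT) : ∀ᵐ z ∂haarT, (f • g : LinfT) z = f z * g z := Lp.coeFn_lpSMul f g

theorem starT_ae (f : LinfT) : ∀ᵐ z ∂haarT, (star f : LinfT) z = conj (f z) := Lp.coeFn_star f

theorem qmp_cis_affine (c a : ℝ) (hc : 0 < c) :
    Measure.QuasiMeasurePreserving (fun x : ℝ => cis (c * x - a)) (volume : Measure ℝ) haarT :=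
  qmp_cis.comp ((measurePreserving_sub_right volume a).quasiMeasurePreserving.comp (qmp_mul c hc))

theorem qmp_cis_sub (a : ℝ) :
    Measure.QuasiMeasurePreserving (fun x : ℝ => cis (x - a)) (volume : Measure ℝ) haarT :=
  qmp_cis.comp (measurePreserving_sub_right volume a).quasiMeasurePreserving

theorem pi1Hat_ae (p : ℕ) (f : LinfT) (ξ : H1 p) (k : Fin p) :
    ∀ᵐ x, pi1Hat p f ξ k x = f (cis (x - 2 * Real.pi * (k : ℕ) / p)) * ξ k x := by
  filter_upwards [mulOp_ae (lift (alpha (rhoPow p k) f)) (ξ k), lift_alpha_ae p k f] with x h1 h2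
  rw [← h2, ← h1]
  rfl

theorem U1Hat_ae (p : ℕ) (hp : Odd p) (ξ : H1 p) (k : Fin p) :
    ∀ᵐ x, U1Hat p hp ξ k x = (Real.sqrt 2 : ℂ) * ξ (sigma p hp k) (2 * x) :=
  waveUHat_ae _

theorem U1Hat_symm_ae (p : ℕ) (hp : Odd p) (ξ : H1 p) (k : Fin p) :
    ∀ᵐ x, (U1Hat p hp).symm ξ k x =
      (Real.sqrt (2⁻¹) : ℂ) * ξ ((sigma p hp).symm k) (2⁻¹ * x) := by
  rw [U1Hat, ampU_symm_apply]
  exact waveUHat_symm_ae _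

theorem integrable_bdd_mul {X Y : Type*} [MeasurableSpace X] [MeasurableSpace Y] {μ : Measure X}
    {ν : Measure Y} {g : X → Y} (hg : Measure.QuasiMeasurePreserving g μ ν) (f : Lp ℂ ∞ ν)
    {F : X → ℂ} (hF : Integrable F μ) : Integrable (fun x => f (g x) * F x) μ :=
  hF.smul_of_top_right (memLp_comp hg f)

theorem integrable_Linf_mul {X : Type*} [MeasurableSpace X] {μ : Measure X}
    (f : Lp ℂ ∞ μ) {F : X → ℂ} (hF : Integrable F μ) : Integrable (fun x => f x * F x) μ :=
  hF.smul_of_top_right (Lp.memLp f)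

/-- A vector state of the `p`-fold representation is given by a density on the circle. -/
theorem sum_integral_unfold (p : ℕ) {F : Fin p → ℝ → ℂ} (hF : ∀ k, Integrable (F k)) (f : LinfT) :
    (2 * Real.pi : ℂ)⁻¹ * ∑ k : Fin p, ∫ x, f (cis (x - 2 * Real.pi * (k : ℕ) / p)) * F k x =
      ∫ z, f z * ∑ k : Fin p, onCircle (per fun y => F k (y + 2 * Real.pi * (k : ℕ) / p)) z
        ∂haarT := by
  have hF' : ∀ k : Fin p, Integrable fun y => F k (y + 2 * Real.pi * (k : ℕ) / p) := fun k =>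
    (hF k).comp_add_right _
  simp_rw [Finset.mul_sum]
  rw [integral_finsetSum _ fun k _ => integrable_Linf_mul f (integrable_onCircle_per (hF' k))]
  refine Finset.sum_congr rfl fun k _ => ?_
  -- In component `k` the translation by `2πk/p` removes the rotation from the argument of `f`,
  -- after which the integral unfolds over periods.
  rw [← integral_unfold (hF' k) (Lp.aestronglyMeasurable f)
    (integrable_bdd_mul qmp_cis f (hF' k)),
    ← integral_add_right_eq_self _ (2 * Real.pi * (k : ℕ) / p)]
  simp only [add_sub_cancel_right]

theorem integrable_sum_onCircle_per (p : ℕ) {F : Fin p → ℝ → ℂ} (hF : ∀ k, Integrable (F k)) :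
    Integrable (fun z => ∑ k : Fin p,
      onCircle (per fun y => F k (y + 2 * Real.pi * (k : ℕ) / p)) z) haarT :=
  integrable_finsetSum _ fun k _ => integrable_onCircle_per ((hF k).comp_add_right _)

theorem inner_pi1Hat {p : ℕ} (ξ η : H1 p) (f : LinfT) :
    inner ℂ ξ (pi1Hat p f η) =
      ∑ k : Fin p, ∫ x, f (cis (x - 2 * Real.pi * (k : ℕ) / p)) * (conj (ξ k x) * η k x) := by
  rw [inner_H1]
  refine Finset.sum_congr rfl fun k _ => integral_congr_ae (μ := volume) ?_
  filter_upwards [pi1Hat_ae p f η k] with x hx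
  rw [hx]; ring

theorem isRep_pi1Hat (p : ℕ) (hp : Odd p) : IsRep 2 two_ne_zero (pi1Hat p) (U1Hat p hp) where
  map_one := by
    ext1 ξ
    refine H1_ext fun k => ?_
    filter_upwards [pi1Hat_ae p (ofCont 1) ξ k, (qmp_cis_sub _).ae (ofCont_ae 1)] with x h1 h2
    rw [h1, h2]
    simp
  map_add f g := by
    ext1 ξ
    refine H1_ext fun k => ?_
    filter_upwards [pi1Hat_ae p (f + g) ξ k, pi1Hat_ae p f ξ k, pi1Hat_ae p g ξ k,
      (qmp_cis_sub _).ae (Lp.coeFn_add f g), Lp.coeFn_add (pi1Hat p f ξ k) (pi1Hat p g ξ k)]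
      with x h1 h2 h3 h4 h5
    rw [h1, h4]
    refine Eq.trans ?_ h5.symm
    rw [Pi.add_apply, Pi.add_apply, h2, h3, add_mul]
  map_smul c f := by
    ext1 ξ
    refine H1_ext fun k => ?_
    filter_upwards [pi1Hat_ae p (c • f) ξ k, pi1Hat_ae p f ξ k,
      (qmp_cis_sub _).ae (Lp.coeFn_smul c f), Lp.coeFn_smul c (pi1Hat p f ξ k)]
      with x h1 h2 h4 h5
    rw [h1, h4]
    refine Eq.trans ?_ h5.symm
    rw [Pi.smul_apply, Pi.smul_apply, h2, smul_eq_mul, smul_eq_mul, mul_assoc]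
  map_mul f g := by
    ext1 ξ
    refine H1_ext fun k => ?_
    filter_upwards [pi1Hat_ae p (f • g : LinfT) ξ k, pi1Hat_ae p f (pi1Hat p g ξ) k,
      pi1Hat_ae p g ξ k, (qmp_cis_sub _).ae (smulT_ae f g)] with x h1 h2 h3 h4
    rw [h1, h4]
    refine Eq.trans ?_ h2.symm
    rw [h3, mul_assoc]
  map_star f ξ η := by
    rw [inner_pi1Hat, inner_H1]
    refine Finset.sum_congr rfl fun k _ => integral_congr_ae (μ := volume) ?_
    filter_upwards [pi1Hat_ae p (star f) ξ k, (qmp_cis_sub _).ae (starT_ae f)] with x h1 h2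
    rw [h1, h2, map_mul, Complex.conj_conj, mul_assoc]
  normal ξ η := by
    -- The factor `2π` compensates the `(2π)⁻¹` of the normalized Haar measure in
    -- `sum_integral_unfold`.
    have hF : ∀ k, Integrable fun x => (2 * Real.pi : ℂ) * (conj (ξ k x) * η k x) := fun k =>
      (integrable_inner_L2 (ξ k) (η k)).const_mul _
    have hi := integrable_sum_onCircle_per p hF
    refine ⟨hi.toL1, fun f => ?_⟩
    rw [inner_pi1Hat]
    have h1 := sum_integral_unfold p hF f
    have h2 : ∫ z, f z * hi.toL1 _ z ∂haarT = ∫ z, f z * ∑ k : Fin p, onCircle (per fun y =>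
        (2 * Real.pi : ℂ) * (conj (ξ k (y + 2 * Real.pi * (k : ℕ) / p)) *
          η k (y + 2 * Real.pi * (k : ℕ) / p))) z ∂haarT := by
      refine integral_congr_ae ?_
      filter_upwards [hi.coeFn_toL1] with z hz
      rw [hz]
    rw [h2, ← h1, Finset.mul_sum]
    refine Finset.sum_congr rfl fun k _ => ?_
    rw [← integral_const_mul]
    congr 1; funext x
    have : (Real.pi : ℂ) ≠ 0 := by exact_mod_cast Real.pi_ne_zero
    field_simp
  covariant f ξ := by
    obtain ⟨η, rfl⟩ := (U1Hat p hp).surjective ξ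
    rw [LinearIsometryEquiv.symm_apply_apply]
    refine H1_ext fun k => ?_
    filter_upwards [U1Hat_ae p hp (pi1Hat p f η) k, pi1Hat_ae p (powT 2 two_ne_zero f) (U1Hat p hp η) k,
      U1Hat_ae p hp η k, (qmp_mul 2 two_pos).ae (pi1Hat_ae p f η (sigma p hp k)),
      (qmp_cis_sub (2 * Real.pi * (k : ℕ) / p)).ae (powT_ae 2 two_ne_zero f)] with x h1 h2 h3 h4 h5
    rw [h1, h2, h3, h4, h5]
    -- This is why `U₁` permutes the components by `σ`: modulo `2π`, the rotation of component
    -- `σ(k)` is twice that of component `k`, so dilation by `2` squares the rotated point.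
    have : cis (2 * x - 2 * Real.pi * ((sigma p hp k : Fin p) : ℕ) / p) =
        cis (x - 2 * Real.pi * (k : ℕ) / p) ^ 2 := by
      rw [sub_eq_add_neg, cis_add, cis_neg, cis_sigma hp, ← cis_neg, ← cis_add, ← cis_nsmul]
      congr 1; push_cast; ring
    rw [this]; ring

/-! ### Transport of representations -/

section Transport

variable {H K : Type*} [NormedAddCommGroup H] [InnerProductSpace ℂ H] [NormedAddCommGroup K]
  [InnerProductSpace ℂ K] {π : LinfT → H →L[ℂ] H} {U : H ≃ₗᵢ[ℂ] H} {π' : LinfT → K →L[ℂ] K}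
  {U' : K ≃ₗᵢ[ℂ] K} {N : ℕ} {hN : N ≠ 0}

/-- All the axioms can be checked after an isometric intertwiner, which need not be onto. The lemma
covers unitary equivalence as well as restriction to an invariant subspace. -/
theorem IsRep.of_isometry (h : IsRep N hN π U) (T : K →ₗᵢ[ℂ] H)
    (hπ : ∀ f ξ, T (π' f ξ) = π f (T ξ)) (hU : ∀ ξ, T (U' ξ) = U (T ξ)) : IsRep N hN π' U' where
  map_one := by
    ext ξ; apply T.injective; rw [hπ, h.map_one]; rfl
  map_add f g := by
    ext ξ; apply T.injective; rw [hπ, h.map_add]; simp [hπ]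
  map_smul c f := by
    ext ξ; apply T.injective; rw [hπ, h.map_smul]; simp [hπ]
  map_mul f g := by
    ext ξ; apply T.injective; rw [hπ, h.map_mul]; simp [hπ]
  map_star f ξ η := by
    rw [← T.inner_map_map, ← T.inner_map_map, hπ, hπ, h.map_star]
  normal ξ η := by
    obtain ⟨k, hk⟩ := h.normal (T ξ) (T η)
    exact ⟨k, fun f => by rw [← T.inner_map_map, hπ, hk]⟩
  covariant f ξ := by
    obtain ⟨η, rfl⟩ := U'.surjective ξ
    apply T.injective
    rw [hπ, hU, hU, LinearIsometryEquiv.symm_apply_apply, hπ, ← h.covariant,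
      LinearIsometryEquiv.symm_apply_apply]

theorem zpow_intertwine (S : H →L[ℂ] K) (hU : ∀ ξ, S (U ξ) = U' (S ξ)) (n : ℤ) (ξ : H) :
    S ((U ^ n) ξ) = (U' ^ n) (S ξ) := by
  have hU' : ∀ ξ, S (U.symm ξ) = U'.symm (S ξ) := fun ξ => by
    apply U'.injective
    rw [← hU, LinearIsometryEquiv.apply_symm_apply, LinearIsometryEquiv.apply_symm_apply]
  induction n with
  | zero => rfl
  | succ n ih =>
    rw [add_comm, zpow_add, zpow_add, zpow_one, zpow_one]
    change S (U ((U ^ (n : ℤ)) ξ)) = U' ((U' ^ (n : ℤ)) (S ξ))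
    rw [hU, ih]
  | pred n ih =>
    rw [sub_eq_neg_add, zpow_add, zpow_add, zpow_neg_one, zpow_neg_one]
    change S (U.symm ((U ^ (-(n : ℤ))) ξ)) = U'.symm ((U' ^ (-(n : ℤ))) (S ξ))
    rw [hU', ih]

/-- A continuous surjection maps dense sets to dense sets, and an intertwiner maps the cyclic
subspace of `φ` into that of `S φ`. -/
theorem cyclic_of_surjective (S : H →L[ℂ] K) (hS : Function.Surjective S)
    (hπ : ∀ f ξ, S (π f ξ) = π' f (S ξ)) (hU : ∀ ξ, S (U ξ) = U' (S ξ)) {φ : H}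
    (h : (Submodule.span ℂ {ξ : H | ∃ (n : ℤ) (f : LinfT), ξ = (U ^ n) (π f φ)}).topologicalClosure
      = ⊤) :
    (Submodule.span ℂ {ξ : K | ∃ (n : ℤ) (f : LinfT),
      ξ = (U' ^ n) (π' f (S φ))}).topologicalClosure = ⊤ := by
  rw [← Submodule.dense_iff_topologicalClosure_eq_top] at h ⊢
  refine (hS.denseRange.dense_image S.continuous h).mono ?_
  rintro _ ⟨ξ, hξ, rfl⟩
  have : Submodule.span ℂ {ξ : H | ∃ (n : ℤ) (f : LinfT), ξ = (U ^ n) (π f φ)} ≤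
      (Submodule.span ℂ {ξ : K | ∃ (n : ℤ) (f : LinfT), ξ = (U' ^ n) (π' f (S φ))}).comap
        (S : H →ₗ[ℂ] K) := by
    rw [Submodule.span_le]
    rintro _ ⟨n, f, rfl⟩
    refine Submodule.subset_span ⟨n, f, ?_⟩
    change S _ = _
    rw [zpow_intertwine S hU, hπ]
  exact this hξ

end Transport

end

/-! ### Localization of the multiplication operators -/

/-- The operator `U^{-n} π(f) U^n`. -/
def conjPi (p : ℕ) (hp : Odd p) (n : ℕ) (f : LinfT) : H1 p →L[ℂ] H1 p :=
  ((U1Hat p hp ^ n).symm : H1 p →L[ℂ] H1 p) ∘L pi1Hat p f ∘L (U1Hat p hp ^ n : H1 p ≃ₗᵢ[ℂ] H1 p)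

theorem conjPi_apply (p : ℕ) (hp : Odd p) (n : ℕ) (f : LinfT) (ξ : H1 p) :
    conjPi p hp n f ξ = (U1Hat p hp ^ n).symm (pi1Hat p f ((U1Hat p hp ^ n) ξ)) := rfl

theorem conjPi_succ (p : ℕ) (hp : Odd p) (n : ℕ) (f : LinfT) (ξ : H1 p) :
    conjPi p hp (n + 1) f ξ = (U1Hat p hp).symm (conjPi p hp n f (U1Hat p hp ξ)) := by
  rw [conjPi_apply, conjPi_apply, pow_succ]; rfl

/-- Each conjugation by `U` halves the argument and replaces the component index by its preimage
under `σ`. For large `n`, component `k` sees `f` only near the root of unity with index `σ^{-n}(k)`,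
magnified by `2^n`. -/
theorem conjPi_ae (p : ℕ) (hp : Odd p) (n : ℕ) (f : LinfT) (ξ : H1 p) (k : Fin p) :
    ∀ᵐ x, conjPi p hp n f ξ k x =
      f (cis (((2 : ℝ) ^ n)⁻¹ * x - 2 * Real.pi * (((sigma p hp ^ n).symm k : Fin p) : ℕ) / p)) *
        ξ k x := by
  induction n generalizing ξ k with
  | zero =>
    filter_upwards [pi1Hat_ae p f ξ k] with x hx
    rw [pow_zero, inv_one, one_mul]
    exact hx
  | succ n ih =>
    rw [conjPi_succ]
    filter_upwards [U1Hat_symm_ae p hp (conjPi p hp n f (U1Hat p hp ξ)) k,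
      (qmp_mul 2⁻¹ (by norm_num)).ae (ih (U1Hat p hp ξ) ((sigma p hp).symm k)),
      (qmp_mul 2⁻¹ (by norm_num)).ae (U1Hat_ae p hp ξ ((sigma p hp).symm k))] with x h1 h2 h3
    rw [h1, h2, h3, Equiv.apply_symm_apply, mul_inv_cancel_left₀ two_ne_zero]
    have h4 : (sigma p hp ^ (n + 1)).symm k = (sigma p hp ^ n).symm ((sigma p hp).symm k) := by
      rw [pow_succ']; rfl
    have h5 : ((2 : ℝ) ^ (n + 1))⁻¹ * x = (2 ^ n)⁻¹ * (2⁻¹ * x) := by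
      rw [pow_succ, mul_inv, mul_assoc]
    have h6 : (Real.sqrt 2⁻¹ : ℂ) * Real.sqrt 2 = 1 := by
      rw [← Complex.ofReal_mul, ← Real.sqrt_mul (by norm_num)]; norm_num
    rw [h4, h5]
    linear_combination (f (cis ((2 ^ n)⁻¹ * (2⁻¹ * x) - 2 * Real.pi *
      (((sigma p hp ^ n).symm ((sigma p hp).symm k) : Fin p) : ℕ) / p)) * ξ k x) * h6

theorem norm_cis_sub_one_le (x : ℝ) : ‖(cis x : ℂ) - 1‖ ≤ |x| := by
  rw [coe_cis, show -(Complex.I * (x : ℂ)) = Complex.I * ((-x : ℝ) : ℂ) by push_cast; ring]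
  refine Real.norm_exp_I_mul_ofReal_sub_one_le.trans ?_
  rw [norm_neg, Real.norm_eq_abs]

theorem cis_root_injective {p : ℕ} {i j : Fin p}
    (h : cis (2 * Real.pi * (i : ℕ) / p) = cis (2 * Real.pi * (j : ℕ) / p)) : i = j := by
  have hp0 : (p : ℝ) ≠ 0 := by exact_mod_cast (i.pos).ne'
  obtain ⟨n, hn⟩ := cis_eq_cis.1 h
  have h1 : ((i : ℕ) : ℝ) = (j : ℕ) + p * n := by
    have h3 : 2 * Real.pi * (((i : ℕ) : ℝ) - ((j : ℕ) + p * n)) = 0 := by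
      field_simp at hn
      linear_combination 2 * hn * Real.pi
    have := (mul_eq_zero.1 h3).resolve_left Real.two_pi_pos.ne'
    linarith
  have h2 : ((i : ℕ) : ℤ) = (j : ℕ) + p * n := by exact_mod_cast h1
  have h3 : ((i : ℕ) : ℤ) ≡ ((j : ℕ) : ℤ) [ZMOD p] := by
    rw [h2]; exact Int.modEq_iff_dvd.2 ⟨-n, by ring⟩
  exact Fin.ext (Nat.ModEq.eq_of_lt_of_lt (Int.natCast_modEq_iff.1 h3) i.2 j.2)

theorem exists_root_separation (p : ℕ) : ∃ δ : ℝ, 0 < δ ∧ ∀ i j : Fin p, i ≠ j →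
    δ ≤ ‖(cis (2 * Real.pi * (i : ℕ) / p) : ℂ) - cis (2 * Real.pi * (j : ℕ) / p)‖ := by
  classical
  let s := (Finset.univ : Finset (Fin p × Fin p)).filter fun q => q.1 ≠ q.2
  let d : Fin p × Fin p → ℝ := fun q =>
    ‖(cis (2 * Real.pi * (q.1 : ℕ) / p) : ℂ) - cis (2 * Real.pi * (q.2 : ℕ) / p)‖
  by_cases hs : s.Nonempty
  · obtain ⟨q, hq, hmin⟩ := s.exists_min_image d hs
    refine ⟨d q, ?_, fun i j hij => hmin (i, j) (by simpa [s] using hij)⟩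
    refine norm_pos_iff.2 (sub_ne_zero.2 fun h => ?_)
    exact (by simpa [s] using hq : q.1 ≠ q.2) (cis_root_injective (Circle.ext h))
  -- There is no pair of distinct indices here, and any positive constant serves.
  · refine ⟨1, one_pos, fun i j hij => (hs ⟨(i, j), by simpa [s] using hij⟩).elim⟩

theorem tendsto_inv_two_pow_mul (c : ℝ) : Tendsto (fun n : ℕ => ((2 : ℝ) ^ n)⁻¹ * c) atTop (𝓝 0) := by
  have := (tendsto_pow_atTop_nhds_zero_of_lt_one (r := (2⁻¹ : ℝ)) (by norm_num)
    (by norm_num)).mul_const c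
  simpa [inv_pow] using this

/-- For `k = k₀` the two rotations cancel and the point is `e^{-i2^{-n}x}`, from which `2^n argNeg`
recovers `x` once `2^{-n}x` lies in `(-π, π)`. For `k ≠ k₀` the point stays away from `1`, so `2^n
argNeg` leaves the bounded set `E`. -/
theorem eventually_localized (p : ℕ) {E : Set ℝ} {M : ℝ} (hE : E ⊆ Icc (-M) M) (k k₀ : Fin p)
    (τ : ℕ → Equiv.Perm (Fin p)) (x : ℝ) :
    ∀ᶠ n : ℕ in atTop, E.indicator (fun _ => (1 : ℂ)) (2 ^ n * argNeg
      (cis (2 * Real.pi * (τ n k₀ : ℕ) / p) * cis ((2 ^ n)⁻¹ * x - 2 * Real.pi * (τ n k : ℕ) / p))) =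
      if k = k₀ then E.indicator (fun _ => (1 : ℂ)) x else 0 := by
  by_cases hk : k = k₀
  · subst hk
    have h1 := (tendsto_inv_two_pow_mul x).eventually (Ioo_mem_nhds (neg_lt_zero.2 Real.pi_pos)
      Real.pi_pos)
    filter_upwards [h1] with n hn
    rw [if_pos rfl, ← cis_add, add_sub_cancel, argNeg_cis hn.1.le hn.2,
      mul_inv_cancel_left₀ (by positivity)]
  · obtain ⟨δ, hδ, hsep⟩ := exists_root_separation p
    -- If the point `w` were in the support, it would be within `2^{-n}M` of `1`, and
    -- `e^{-i2^{-n}x}` is within `2^{-n}|x|` of `1`. The two roots of unity would then be closer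
    -- than the separation `δ`.
    have h1 := (tendsto_inv_two_pow_mul (M + |x|)).eventually (gt_mem_nhds hδ)
    filter_upwards [h1] with n hn
    rw [if_neg hk]
    refine indicator_of_notMem (fun hmem => ?_) _
    set w := cis (2 * Real.pi * (τ n k₀ : ℕ) / p) *
      cis ((2 ^ n)⁻¹ * x - 2 * Real.pi * (τ n k : ℕ) / p) with hw
    set a := cis (2 * Real.pi * (τ n k : ℕ) / p)
    set b := cis (2 * Real.pi * (τ n k₀ : ℕ) / p)
    have hθ : |argNeg w| ≤ (2 ^ n)⁻¹ * M := by
      have h2 : |2 ^ n * argNeg w| ≤ M := abs_le.2 (hE hmem)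
      rw [abs_mul, abs_of_pos (by positivity)] at h2
      rwa [inv_mul_eq_div, le_div_iff₀ (by positivity), mul_comm]
    have hwa : w * a = cis ((2 ^ n)⁻¹ * x) * b := by
      rw [hw, mul_assoc, ← cis_add, sub_add_cancel, mul_comm]
    have h3 : ‖(w : ℂ) - 1‖ ≤ (2 ^ n)⁻¹ * M := by
      rw [← cis_argNeg w]
      exact (norm_cis_sub_one_le _).trans hθ
    have h4 : ‖(cis ((2 ^ n)⁻¹ * x) : ℂ) - 1‖ ≤ (2 ^ n)⁻¹ * |x| := by
      refine (norm_cis_sub_one_le _).trans ?_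
      rw [abs_mul, abs_of_pos (by positivity)]
    have h5 : (a : ℂ) - b = -(((w : ℂ) - 1) * a) + ((cis ((2 ^ n)⁻¹ * x) : ℂ) - 1) * b := by
      have : (w : ℂ) * a = (cis ((2 ^ n)⁻¹ * x) : ℂ) * b := by
        exact_mod_cast congrArg (fun z : Circle => (z : ℂ)) hwa
      linear_combination this
    have h6 : ‖(a : ℂ) - b‖ ≤ (2 ^ n)⁻¹ * (M + |x|) := by
      rw [h5]
      refine (norm_add_le _ _).trans ?_
      rw [norm_neg, norm_mul, norm_mul, Circle.norm_coe, Circle.norm_coe, mul_one, mul_one, mul_add]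
      exact add_le_add h3 h4
    have h7 := hsep (τ n k) (τ n k₀) fun h => hk ((τ n).injective h)
    exact absurd (h7.trans h6) (not_le.2 hn)

theorem memLp_indicator_argNeg {E : Set ℝ} (hE : MeasurableSet E) (c : ℝ) (w : Circle) :
    MemLp (fun z : Circle => E.indicator (fun _ => (1 : ℂ)) (c * argNeg (w * z))) ∞ haarT := by
  refine memLp_top_of_bound (Measurable.aestronglyMeasurable ?_) 1 (ae_of_all _ fun z => ?_)
  · exact (measurable_const.indicator hE).comp
      ((measurable_argNeg.comp (measurable_const_mul w)).const_mul c)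
  · refine (norm_indicator_le_norm_self _ _).trans ?_
    simp

/-- Multiplication by the indicator of a bounded set in one component is a weak limit of operators
`U^{-n} π(f_n) U^n`. -/
theorem exists_localization (p : ℕ) (hp : Odd p) {E : Set ℝ} (hE : MeasurableSet E) {M : ℝ}
    (hEM : E ⊆ Icc (-M) M) (k₀ : Fin p) : ∃ f : ℕ → LinfT, ∀ ξ η : H1 p,
    Tendsto (fun n => inner ℂ η (conjPi p hp n (f n) ξ)) atTop
      (𝓝 (∫ x in E, conj (η k₀ x) * ξ k₀ x)) := by
  let τ : ℕ → Equiv.Perm (Fin p) := fun n => (sigma p hp ^ n).symm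
  let w : ℕ → Circle := fun n => cis (2 * Real.pi * (τ n k₀ : ℕ) / p)
  -- The set `E` is shrunk by `2^{-n}` and placed around the root of unity that component `k₀` sees
  -- at level `n`.
  let F : ℕ → Circle → ℂ := fun n z => E.indicator (fun _ => (1 : ℂ)) (2 ^ n * argNeg (w n * z))
  have hF : ∀ n, MemLp (F n) ∞ haarT := fun n => memLp_indicator_argNeg hE _ _
  refine ⟨fun n => (hF n).toLp, fun ξ η => ?_⟩
  let c : ℕ → Fin p → ℝ → ℂ := fun n k x =>
    F n (cis ((2 ^ n)⁻¹ * x - 2 * Real.pi * (τ n k : ℕ) / p))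
  have hc1 : ∀ n k x, ‖c n k x‖ ≤ 1 := fun n k x => by
    refine (norm_indicator_le_norm_self _ _).trans ?_
    simp
  have h1 : ∀ n, inner ℂ η (conjPi p hp n ((hF n).toLp) ξ) =
      ∑ k, ∫ x, c n k x * (conj (η k x) * ξ k x) := fun n => by
    rw [inner_H1]
    refine Finset.sum_congr rfl fun k _ => integral_congr_ae (μ := volume) ?_
    filter_upwards [conjPi_ae p hp n ((hF n).toLp) ξ k,
      (qmp_cis_affine ((2 : ℝ) ^ n)⁻¹ (2 * Real.pi * (τ n k : ℕ) / p) (by positivity)).ae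
        (hF n).coeFn_toLp] with x h2 h3
    rw [h2, h3]
    change conj (η k x) * (c n k x * ξ k x) = _
    ring
  have h2 : ∫ x in E, conj (η k₀ x) * ξ k₀ x = ∑ k, ∫ x,
      (if k = k₀ then E.indicator (fun _ => (1 : ℂ)) x else 0) * (conj (η k x) * ξ k x) := by
    rw [Finset.sum_eq_single k₀]
    · rw [← integral_indicator hE]
      congr 1; funext x
      by_cases hx : x ∈ E <;> simp [hx]
    · intro k _ hk; simp [hk]
    · simp
  rw [h2]
  simp only [h1]
  refine tendsto_finsetSum _ fun k _ => ?_
  have hi := integrable_inner_L2 (η k) (ξ k)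
  refine tendsto_integral_of_dominated_convergence (fun x => ‖conj (η k x) * ξ k x‖) (fun n => ?_)
    hi.norm (fun n => ae_of_all _ fun x => ?_) (ae_of_all _ fun x => ?_)
  · refine AEStronglyMeasurable.mul ?_ hi.aestronglyMeasurable
    refine Measurable.aestronglyMeasurable ?_
    refine (measurable_const.indicator hE).comp
      ((measurable_argNeg.comp ((measurable_const_mul _).comp ?_)).const_mul _)
    exact continuous_cis.measurable.comp ((measurable_const_mul _).sub_const _)
  · rw [norm_mul]
    exact mul_le_of_le_one_left (norm_nonneg _) (hc1 n k x)
  · refine (tendsto_const_nhds.congr' ?_).mul_const _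
    filter_upwards [eventually_localized p hEM k k₀ τ x] with n hn
    exact hn.symm

/-- Localization is available for bounded sets only; these suffice, since the line is a countable
union of bounded intervals. -/
theorem ae_eq_zero_of_bounded_sets {F : ℝ → ℂ} (hF : Integrable F)
    (h : ∀ (M : ℝ) (E : Set ℝ), MeasurableSet E → E ⊆ Icc (-M) M → ∫ x in E, F x = 0) :
    ∀ᵐ x, F x = 0 := by
  have h1 : ∀ n : ℕ, ∀ᵐ x, (Icc (-(n : ℝ)) n).indicator F x = 0 := fun n => by
    refine Integrable.ae_eq_zero_of_forall_setIntegral_eq_zero (hF.indicator measurableSet_Icc)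
      fun s hs _ => ?_
    rw [setIntegral_indicator measurableSet_Icc]
    exact h n _ (hs.inter measurableSet_Icc) inter_subset_right
  filter_upwards [ae_all_iff.2 h1] with x hx
  obtain ⟨n, hn⟩ := exists_nat_ge |x|
  have := hx n
  rwa [indicator_of_mem (mem_Icc.2 (abs_le.1 hn))] at this

/-! ### The Fourier transform of the cyclic vector -/

/-- `φ̂₁`, up to normalization. -/
def phi1Hat (p : ℕ) : H1 p := fourier1 p (phi1 p)

theorem phi1Hat_ae (p : ℕ) (k : Fin p) :
    ∀ᵐ x, phi1Hat p k x = (Real.sqrt (2 * Real.pi)⁻¹ : ℂ) * phiHat p x := fourierU_phi_ae p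

/-- The zeros of `sinc` are countable. Because of this one may divide by `φ̂₁`, both for cyclicity
and for the commutant. -/
theorem phiHat_ne_zero_ae {p : ℕ} (hp : Odd p) : ∀ᵐ x, phiHat p x ≠ 0 := by
  have hp0 : (p : ℝ) ≠ 0 := by exact_mod_cast hp.pos.ne'
  have hcount : (range fun n : ℤ => 2 * (n * Real.pi) / p).Countable := countable_range _
  filter_upwards [hcount.ae_notMem volume] with x hx h
  rw [phiHat_eq hp] at h
  have h1 : Real.sinc (p * x / 2) = 0 := by
    exact_mod_cast (mul_eq_zero.1 h).resolve_left (Complex.exp_ne_zero _)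
  by_cases h2 : (p : ℝ) * x / 2 = 0
  · rw [h2] at h1; simp at h1
  · rw [Real.sinc_of_ne_zero h2, div_eq_zero_iff] at h1
    obtain ⟨n, hn⟩ := Real.sin_eq_zero_iff.1 (h1.resolve_right h2)
    refine hx ⟨n, ?_⟩
    change 2 * (n * Real.pi) / p = x
    rw [hn]; field_simp

theorem sqrt_inv_two_pi_ne_zero : (Real.sqrt (2 * Real.pi)⁻¹ : ℂ) ≠ 0 := by
  have : 0 < (2 * Real.pi)⁻¹ := by positivity
  exact_mod_cast (Real.sqrt_pos.2 this).ne'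

theorem phi1Hat_ne_zero_ae {p : ℕ} (hp : Odd p) (k : Fin p) : ∀ᵐ x, phi1Hat p k x ≠ 0 := by
  filter_upwards [phi1Hat_ae p k, phiHat_ne_zero_ae hp] with x h1 h2
  rw [h1]
  exact mul_ne_zero sqrt_inv_two_pi_ne_zero h2

/-- The filter depends on `z^p` only, so the rotations by `p`-th roots of unity leave it unchanged
and one scaling relation serves all components. -/
theorem filter₀_cis_root {p : ℕ} (hp : Odd p) (x : ℝ) (k : ℕ) :
    filter₀ p (cis (x - 2 * Real.pi * k / p)) = filter₀ p (cis x) := by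
  have h1 : cis (x - 2 * Real.pi * k / p) ^ p = cis x ^ p := by
    have := cis_root_pow hp (-(k : ℤ))
    rw [show x - 2 * Real.pi * k / p = x + 2 * Real.pi * ((-(k : ℤ) : ℤ) : ℝ) / p by push_cast; ring,
      cis_add, mul_pow, this, mul_one]
  rw [filter₀_apply, filter₀_apply, ← Circle.coe_pow, h1, Circle.coe_pow]

theorem U1Hat_phi1Hat {p : ℕ} (hp : Odd p) :
    U1Hat p hp (phi1Hat p) = pi1Hat p (ofCont (filter₀ p)) (phi1Hat p) := by
  refine H1_ext fun k => ?_
  filter_upwards [U1Hat_ae p hp (phi1Hat p) k, pi1Hat_ae p (ofCont (filter₀ p)) (phi1Hat p) k,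
    (qmp_cis_sub _).ae (ofCont_ae (filter₀ p)), phi1Hat_ae p k,
    (qmp_mul 2 two_pos).ae (phi1Hat_ae p (sigma p hp k))] with x h1 h2 h3 h4 h5
  rw [h1, h2, h3, h4, h5, filter₀_cis_root hp, mul_left_comm, phiHat_two_mul hp]
  ring

/-- The vector `U^{-n} π(f) φ̂₁`. -/
def cycVec (p : ℕ) (hp : Odd p) (n : ℕ) (f : LinfT) : H1 p :=
  (U1Hat p hp ^ n).symm (pi1Hat p f (phi1Hat p))

theorem U1Hat_pi1Hat (p : ℕ) (hp : Odd p) (f : LinfT) (ξ : H1 p) :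
    U1Hat p hp (pi1Hat p f ξ) = pi1Hat p (powT 2 two_ne_zero f) (U1Hat p hp ξ) := by
  rw [← (isRep_pi1Hat p hp).covariant, LinearIsometryEquiv.symm_apply_apply]

theorem pi1Hat_smulT (p : ℕ) (hp : Odd p) (f g : LinfT) (ξ : H1 p) :
    pi1Hat p (f • g : LinfT) ξ = pi1Hat p f (pi1Hat p g ξ) := by
  rw [(isRep_pi1Hat p hp).map_mul]; rfl

/-- `f ↦ f(z²) m₀`. -/
def refine₀ (p : ℕ) (f : LinfT) : LinfT := (powT 2 two_ne_zero f • ofCont (filter₀ p) : LinfT)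

theorem U1Hat_pi1Hat_phi1Hat {p : ℕ} (hp : Odd p) (f : LinfT) :
    U1Hat p hp (pi1Hat p f (phi1Hat p)) = pi1Hat p (refine₀ p f) (phi1Hat p) := by
  rw [U1Hat_pi1Hat, U1Hat_phi1Hat, refine₀, pi1Hat_smulT p hp]

/-- The multiresolution property: every vector of level `n` is also one of level `n + 1`. -/
theorem cycVec_succ {p : ℕ} (hp : Odd p) (n : ℕ) (f : LinfT) :
    cycVec p hp n f = cycVec p hp (n + 1) (refine₀ p f) := by
  rw [cycVec, cycVec, pow_succ', ← U1Hat_pi1Hat_phi1Hat hp]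
  change _ = (U1Hat p hp ^ n).symm ((U1Hat p hp).symm _)
  rw [LinearIsometryEquiv.symm_apply_apply]

theorem exists_pow_phi1Hat {p : ℕ} (hp : Odd p) (n : ℕ) :
    ∃ m : LinfT, (U1Hat p hp ^ n) (phi1Hat p) = pi1Hat p m (phi1Hat p) := by
  induction n with
  | zero =>
    refine ⟨ofCont 1, ?_⟩
    rw [(isRep_pi1Hat p hp).map_one]; rfl
  | succ n ih =>
    obtain ⟨m, hm⟩ := ih
    refine ⟨refine₀ p m, ?_⟩
    rw [← U1Hat_pi1Hat_phi1Hat hp, ← hm, pow_succ']; rfl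

/-- Since `U^n φ̂₁` has the form `π(m)φ̂₁`, the hypothesis also covers the vectors `U^{-n} π(f) U^n
φ̂₁`. Localization then shows that `conj ξ · φ̂₁` vanishes a.e. in each component. -/
theorem eq_zero_of_inner_cycVec {p : ℕ} (hp : Odd p) {ξ : H1 p}
    (h : ∀ n f, inner ℂ ξ (cycVec p hp n f) = 0) : ξ = 0 := by
  have h0 : ∀ n f, inner ℂ ξ (conjPi p hp n f (phi1Hat p)) = 0 := fun n f => by
    obtain ⟨m, hm⟩ := exists_pow_phi1Hat hp n
    rw [conjPi_apply, hm, ← pi1Hat_smulT p hp]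
    exact h n _
  refine H1_ext fun k => ?_
  have h1 : ∀ᵐ x, conj (ξ k x) * phi1Hat p k x = 0 := by
    refine ae_eq_zero_of_bounded_sets (integrable_inner_L2 _ _) fun M E hE hEM => ?_
    obtain ⟨f, hf⟩ := exists_localization p hp hE hEM k
    have := hf (phi1Hat p) ξ
    simp only [h0] at this
    exact (tendsto_nhds_unique this tendsto_const_nhds)
  filter_upwards [h1, phi1Hat_ne_zero_ae hp k, Lp.coeFn_zero ℂ 2 (volume : Measure ℝ)]
    with x h2 h3 h4
  have h5 := (mul_eq_zero.1 h2).resolve_right h3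
  rw [map_eq_zero] at h5
  rw [h5]
  exact h4.symm

theorem cyclic_pi1Hat {p : ℕ} (hp : Odd p) :
    (Submodule.span ℂ {ξ : H1 p | ∃ (n : ℤ) (f : LinfT),
      ξ = (U1Hat p hp ^ n) (pi1Hat p f (phi1Hat p))}).topologicalClosure = ⊤ := by
  rw [Submodule.topologicalClosure_eq_top_iff, Submodule.eq_bot_iff]
  intro ξ hξ
  refine eq_zero_of_inner_cycVec hp fun n f => ?_
  refine (Submodule.mem_orthogonal' _ _).1 hξ _ (Submodule.subset_span ⟨-(n : ℤ), f, ?_⟩)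
  rw [zpow_neg, zpow_natCast]; rfl

/-! ### The commutant -/

theorem IsDiag.ae {p : ℕ} {A : H1 p →L[ℂ] H1 p} {f : Fin p → LinfR} (h : IsDiag p A f) (ξ : H1 p)
    (k : Fin p) : ∀ᵐ x, A ξ k x = f k x * ξ k x := by
  rw [h ξ k]
  exact mulOp_ae _ _

theorem commutant_conjPi {p : ℕ} {hp : Odd p} {A : H1 p →L[ℂ] H1 p}
    (hA : A ∈ commutant (pi1Hat p) (U1Hat p hp)) (n : ℕ) (f : LinfT) (ξ : H1 p) :
    A (conjPi p hp n f ξ) = conjPi p hp n f (A ξ) := by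
  induction n generalizing ξ with
  | zero => exact hA.1 f ξ
  | succ n ih =>
    rw [conjPi_succ, conjPi_succ]
    apply (U1Hat p hp).injective
    rw [LinearIsometryEquiv.apply_symm_apply, ← hA.2, LinearIsometryEquiv.apply_symm_apply, ih, hA.2]

open ContinuousLinearMap in
-- An operator in the commutant commutes with every `U^{-n} π(f_n) U^n`. In the weak limit, both
-- sides have the same integral over each bounded set `E`.
theorem commutant_local {p : ℕ} {hp : Odd p} {A : H1 p →L[ℂ] H1 p}
    (hA : A ∈ commutant (pi1Hat p) (U1Hat p hp)) (ξ η : H1 p) (k : Fin p) :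
    ∀ᵐ x, conj (adjoint A η k x) * ξ k x = conj (η k x) * A ξ k x := by
  have h1 : ∀ᵐ x, conj (adjoint A η k x) * ξ k x - conj (η k x) * A ξ k x = 0 := by
    refine ae_eq_zero_of_bounded_sets
      ((integrable_inner_L2 _ _).sub (integrable_inner_L2 _ _)) fun M E hE hEM => ?_
    obtain ⟨f, hf⟩ := exists_localization p hp hE hEM k
    rw [integral_sub (integrable_inner_L2 _ _).integrableOn (integrable_inner_L2 _ _).integrableOn,
      sub_eq_zero]
    have h2 := hf ξ (adjoint A η)
    simp only [adjoint_inner_left, commutant_conjPi hA] at h2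
    exact tendsto_nhds_unique h2 (hf (A ξ) η)
  filter_upwards [h1] with x hx
  exact sub_eq_zero.1 hx

theorem norm_apply_coord_le {p : ℕ} (ξ : H1 p) (k : Fin p) : ‖ξ k‖ ≤ ‖ξ‖ :=
  PiLp.norm_apply_le ξ k

/-- Testing with indicators of sets `s` of finite measure gives `∫_s |c|² ≤ C² |s|` for all of them,
hence `|c| ≤ C` a.e. -/
theorem memLp_top_of_mul_bounded {c : ℝ → ℂ} (hc : Measurable c) {C : ℝ} (hC : 0 ≤ C)
    (h : ∀ ψ : L2R, ∃ χ : L2R, (∀ᵐ x, χ x = c x * ψ x) ∧ ‖χ‖ ≤ C * ‖ψ‖) :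
    MemLp c ∞ volume := by
  have key : (fun x => ‖c x‖ₑ ^ 2) ≤ᵐ[volume] fun _ => ENNReal.ofReal C ^ 2 := by
    refine ae_le_of_forall_setLIntegral_le_of_sigmaFinite (hc.enorm.pow_const 2) fun s hs hfin => ?_
    let ψ : L2R := indicatorConstLp 2 hs hfin.ne (1 : ℂ)
    obtain ⟨χ, hχ, hn⟩ := h ψ
    have e : ∀ ζ : L2R, ∫⁻ x, ‖ζ x‖ₑ ^ 2 = ENNReal.ofReal (‖ζ‖ ^ 2) := fun ζ => by
      have h1 := eLpNorm_nnreal_pow_eq_lintegral (μ := (volume : Measure ℝ)) (f := ζ)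
        (p := 2) two_ne_zero
      have h2 : eLpNorm ζ 2 volume = ENNReal.ofReal ‖ζ‖ := by
        rw [Lp.norm_def, ENNReal.ofReal_toReal (Lp.eLpNorm_ne_top ζ)]
      simp only [NNReal.coe_ofNat, ENNReal.rpow_ofNat, ENNReal.coe_ofNat] at h1
      rw [← h1, h2, ENNReal.ofReal_pow (norm_nonneg _)]
    have e1 : ∫⁻ x in s, ‖c x‖ₑ ^ 2 = ∫⁻ x, ‖χ x‖ₑ ^ 2 := by
      rw [← lintegral_indicator hs]
      refine lintegral_congr_ae ?_
      filter_upwards [hχ, (indicatorConstLp_coeFn : ψ =ᵐ[volume] _)] with x h1 h2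
      rw [h1, h2]
      by_cases hx : x ∈ s <;> simp [hx]
    have e2 : ∫⁻ x, ‖ψ x‖ₑ ^ 2 = volume s := by
      rw [← setLIntegral_one, ← lintegral_indicator hs]
      refine lintegral_congr_ae ?_
      filter_upwards [(indicatorConstLp_coeFn : ψ =ᵐ[volume] _)] with x h2
      rw [h2]
      by_cases hx : x ∈ s <;> simp [hx]
    rw [e1, e, setLIntegral_const, ← e2, e, ← ENNReal.ofReal_pow hC, ← ENNReal.ofReal_mul (by positivity)]
    refine ENNReal.ofReal_le_ofReal ?_
    rw [← mul_pow]
    exact pow_le_pow_left₀ (norm_nonneg _) hn 2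
  refine memLp_top_of_bound hc.aestronglyMeasurable C ?_
  filter_upwards [key] with x hx
  have h1 : ‖c x‖ₑ ≤ ENNReal.ofReal C := (ENNReal.pow_le_pow_left_iff two_ne_zero).1 hx
  rw [← ofReal_norm] at h1
  exact (ENNReal.ofReal_le_ofReal_iff hC).1 h1

open ContinuousLinearMap in
theorem exists_diag_of_commutant {p : ℕ} {hp : Odd p} {A : H1 p →L[ℂ] H1 p}
    (hA : A ∈ commutant (pi1Hat p) (U1Hat p hp)) : ∃ f ∈ invFamilies p hp, IsDiag p A f := by
  -- The multiplier is `commutant_local` with `η = φ̂₁`, solved for `A ξ`.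
  let c : Fin p → ℝ → ℂ := fun k x =>
    conj (adjoint A (phi1Hat p) k x) * (conj (phi1Hat p k x))⁻¹
  have hcm : ∀ k, Measurable (c k) := fun k =>
    (Complex.continuous_conj.measurable.comp (Lp.stronglyMeasurable _).measurable).mul
      (Complex.continuous_conj.measurable.comp (Lp.stronglyMeasurable _).measurable).inv
  have hc : ∀ (ξ : H1 p) (k : Fin p), ∀ᵐ x, A ξ k x = c k x * ξ k x := fun ξ k => by
    filter_upwards [commutant_local hA ξ (phi1Hat p) k, phi1Hat_ne_zero_ae hp k] with x h1 h2
    have h3 : conj (phi1Hat p k x) ≠ 0 := (map_ne_zero _).2 h2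
    change _ = conj (adjoint A (phi1Hat p) k x) * (conj (phi1Hat p k x))⁻¹ * ξ k x
    rw [mul_right_comm, h1]
    field_simp
  have hmem : ∀ k, MemLp (c k) ∞ volume := fun k => by
    classical
    refine memLp_top_of_mul_bounded (hcm k) (norm_nonneg A) fun ψ => ?_
    refine ⟨A (PiLp.single 2 k ψ) k, ?_, ?_⟩
    · filter_upwards [hc (PiLp.single 2 k ψ) k] with x hx
      rw [hx, PiLp.single_eq_same]
    · refine (norm_apply_coord_le _ k).trans ((A.le_opNorm _).trans_eq ?_)
      rw [PiLp.norm_single]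
  have hdiag : IsDiag p A fun k => (hmem k).toLp := fun ξ k => by
    refine Lp.ext ?_
    filter_upwards [hc ξ k, mulOp_ae (hmem k).toLp (ξ k), (hmem k).coeFn_toLp] with x h1 h2 h3
    rw [h1, h2, h3]
  refine ⟨fun k => (hmem k).toLp, fun k => ?_, hdiag⟩
  -- Comparing `A U φ̂₁` with `U A φ̂₁` and dividing by `φ̂₁(2x)` gives the relation between `f_k`
  -- and `f_{σ(k)}`.
  have hU := congrArg (fun ξ : H1 p => ξ k) (hA.2 (phi1Hat p))
  have h1 := hdiag.ae (U1Hat p hp (phi1Hat p)) k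
  simp only at hU
  rw [hU] at h1
  filter_upwards [h1, U1Hat_ae p hp (A (phi1Hat p)) k, U1Hat_ae p hp (phi1Hat p) k,
    (qmp_mul 2 two_pos).ae (hdiag.ae (phi1Hat p) (sigma p hp k)),
    (qmp_mul 2 two_pos).ae (phi1Hat_ne_zero_ae hp (sigma p hp k))] with x h2 h3 h4 h5 h6
  rw [h3, h4, h5] at h2
  have hs : (Real.sqrt 2 : ℂ) ≠ 0 := by
    exact_mod_cast (Real.sqrt_pos.2 (two_pos : (0 : ℝ) < 2)).ne'
  have h7 : (Real.sqrt 2 : ℂ) * phi1Hat p (sigma p hp k) (2 * x) ≠ 0 := mul_ne_zero hs h6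
  refine mul_right_cancel₀ h7 ?_
  rw [← h2]; ring

theorem commutant_of_diag {p : ℕ} {hp : Odd p} {A : H1 p →L[ℂ] H1 p} {f : Fin p → LinfR}
    (hf : f ∈ invFamilies p hp) (hA : IsDiag p A f) : A ∈ commutant (pi1Hat p) (U1Hat p hp) := by
  refine ⟨fun g ξ => H1_ext fun k => ?_, fun ξ => H1_ext fun k => ?_⟩
  · filter_upwards [hA.ae (pi1Hat p g ξ) k, hA.ae ξ k, pi1Hat_ae p g ξ k,
      pi1Hat_ae p g (A ξ) k] with x h1 h2 h3 h4
    rw [h1, h3, h4, h2, mul_left_comm]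
  · filter_upwards [hA.ae (U1Hat p hp ξ) k, U1Hat_ae p hp ξ k, U1Hat_ae p hp (A ξ) k, hf k,
      (qmp_mul 2 two_pos).ae (hA.ae ξ (sigma p hp k))] with x h1 h2 h3 h4 h5
    rw [h1, h2, h3, h5, h4, mul_left_comm]

theorem commutant_pi1Hat (p : ℕ) (hp : Odd p) :
    commutant (pi1Hat p) (U1Hat p hp) = {A | ∃ f ∈ invFamilies p hp, IsDiag p A f} :=
  Set.ext fun _ => ⟨exists_diag_of_commutant, fun ⟨_, hf, hA⟩ => commutant_of_diag hf hA⟩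

/-! ### Duality of the transfer operator and composition with `z ↦ z²` -/

/-- `z ↦ (G(w) + G(-w))/2`, with `w² = z`. -/
def halfSum (G : Circle → ℂ) (z : Circle) : ℂ :=
  1 / 2 * (G (cis (argNeg z / 2)) + G (cis (argNeg z / 2 + Real.pi)))

theorem intervalIntegrable_half {g : ℝ → ℂ}
    (hg : ∀ a b : ℝ, IntervalIntegrable g volume a b) (c a b : ℝ) :
    IntervalIntegrable (fun x => g (x / 2 + c)) volume a b := by
  have h := ((hg (a / 2 + c) (b / 2 + c)).comp_add_right c).comp_mul_left (c := (2⁻¹ : ℝ))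
  have e1 : ∀ a : ℝ, (a / 2 + c - c) / 2⁻¹ = a := fun a => by ring
  rw [e1, e1] at h
  have e2 : (fun x => g (x / 2 + c)) = fun x => g (2⁻¹ * x + c) := by
    funext x; rw [div_eq_inv_mul]
  rw [e2]; exact h

/-- The substitutions send the period to `(-π/2, π/2)` and to `(π/2, 3π/2)`, which together form one
period of `g`; the Jacobian `2` cancels the factor `1/2`. -/
theorem integral_half_sum {g : ℝ → ℂ} (hg : ∀ a b : ℝ, IntervalIntegrable g volume a b)
    (hper : Function.Periodic g (2 * Real.pi)) :
    ∫ x in (-Real.pi)..Real.pi, 1 / 2 * (g (x / 2) + g (x / 2 + Real.pi)) =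
      ∫ x in (-Real.pi)..Real.pi, g x := by
  have i1 : IntervalIntegrable (fun x => g (x / 2)) volume (-Real.pi) Real.pi := by
    have := intervalIntegrable_half hg 0 (-Real.pi) Real.pi
    simpa only [add_zero] using this
  have i2 := intervalIntegrable_half hg Real.pi (-Real.pi) Real.pi
  rw [intervalIntegral.integral_const_mul, intervalIntegral.integral_add i1 i2,
    intervalIntegral.integral_comp_div g two_ne_zero,
    intervalIntegral.integral_comp_div_add g two_ne_zero, ← smul_add]
  have e1 : -Real.pi / 2 + Real.pi = Real.pi / 2 := by ring
  rw [e1, intervalIntegral.integral_add_adjacent_intervals (hg _ _) (hg _ _)]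
  have e2 := hper.intervalIntegral_add_eq (-Real.pi / 2) (-Real.pi)
  have e3 : -Real.pi / 2 + 2 * Real.pi = Real.pi / 2 + Real.pi := by ring
  have e4 : -Real.pi + 2 * Real.pi = Real.pi := by ring
  rw [e3, e4] at e2
  rw [e2, Complex.real_smul]
  push_cast; ring

theorem integrable_halfSum {G : Circle → ℂ} (hG : Integrable G haarT) :
    Integrable (halfSum G) haarT := by
  have hg := integrable_cis hG
  have i1 : IntervalIntegrable (fun x => G (cis (x / 2))) volume (-Real.pi) Real.pi := by
    have := intervalIntegrable_half hg 0 (-Real.pi) Real.pi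
    simpa only [add_zero] using this
  have i2 := intervalIntegrable_half hg Real.pi (-Real.pi) Real.pi
  have h1 : IntegrableOn (fun x => 1 / 2 * (G (cis (x / 2)) + G (cis (x / 2 + Real.pi))))
      (Ioc (-Real.pi) Real.pi) := by
    have h := (i1.add i2).const_mul (1 / 2 : ℂ)
    rw [intervalIntegrable_iff_integrableOn_Ioc_of_le (by linarith [Real.pi_pos])] at h
    exact h
  have hgp : Integrable (fun x => 1 / 2 * (G (cis (x / 2)) + G (cis (x / 2 + Real.pi))))
      periodMeasure := by
    refine Integrable.smul_measure ?_ (by simp)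
    rw [restrict_Ico_eq_restrict_Ioc]
    exact h1
  have h2 : halfSum G = (fun x => 1 / 2 * (G (cis (x / 2)) + G (cis (x / 2 + Real.pi)))) ∘ argNeg :=
    funext fun _ => rfl
  rw [h2]
  exact measurePreserving_argNeg.integrable_comp_of_integrable hgp

theorem integral_halfSum {G : Circle → ℂ} (hGm : Measurable G) (hG : Integrable G haarT) :
    ∫ z, halfSum G z ∂haarT = ∫ z, G z ∂haarT := by
  have hgm : Measurable fun x : ℝ => 1 / 2 * (G (cis (x / 2)) + G (cis (x / 2 + Real.pi))) := by
    have := continuous_cis.measurable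
    exact ((hGm.comp (this.comp (measurable_id.div_const 2))).add
      (hGm.comp (this.comp ((measurable_id.div_const 2).add_const _)))).const_mul _
  have h1 := integral_comp_argNeg hgm.aestronglyMeasurable
  refine h1.trans ?_
  rw [integral_periodMeasure, integral_circle hGm.aestronglyMeasurable,
    integral_Ico_eq_integral_Ioc,
    ← intervalIntegral.integral_of_le (by linarith [Real.pi_pos]),
    integral_half_sum (g := fun x => G (cis x)) (integrable_cis hG)
      fun x => by simp only [cis_periodic x]]

theorem ruelle_eq_halfSum (m : C(Circle, ℂ)) (f : Circle → ℂ) (z : Circle) :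
    ruelle 2 m f z = halfSum (fun w => ((‖m w‖ ^ 2 : ℝ) : ℂ) * f w) z := by
  conv_lhs => rw [← cis_argNeg z]
  exact ruelle_cis m f _

theorem halfSum_mul_comp_sq (k G : Circle → ℂ) (z : Circle) :
    halfSum (fun w => k (w ^ 2) * G w) z = k z * halfSum G z := by
  have h1 : cis (argNeg z / 2) ^ 2 = z := by
    rw [← cis_nsmul]
    conv_rhs => rw [← cis_argNeg z]
    congr 1; push_cast; ring
  have h2 : cis (argNeg z / 2 + Real.pi) ^ 2 = z := by
    rw [cis_add_pi, neg_sq, h1]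
  simp only [halfSum, h1, h2]
  ring

theorem measurable_normSq_mul (m : C(Circle, ℂ)) {f : Circle → ℂ} (hf : Measurable f) :
    Measurable fun w => ((‖m w‖ ^ 2 : ℝ) : ℂ) * f w := by
  have : Continuous fun w => ((‖m w‖ ^ 2 : ℝ) : ℂ) := by fun_prop
  exact this.measurable.mul hf

theorem integrable_normSq_mul (m : C(Circle, ℂ)) {f : Circle → ℂ} (hf : Integrable f haarT) :
    Integrable (fun w => ((‖m w‖ ^ 2 : ℝ) : ℂ) * f w) haarT := by
  have hc : Continuous fun w => ((‖m w‖ ^ 2 : ℝ) : ℂ) := by fun_prop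
  have hb : BddAbove (range fun w => ‖((‖m w‖ ^ 2 : ℝ) : ℂ)‖) := (isCompact_range hc.norm).bddAbove
  obtain ⟨C, hC⟩ := hb
  exact hf.bdd_mul hc.aestronglyMeasurable (ae_of_all _ fun w => hC ⟨w, rfl⟩)

theorem integrable_ruelle (m : C(Circle, ℂ)) {f : Circle → ℂ} (hf : Integrable f haarT) :
    Integrable (ruelle 2 m f) haarT := by
  rw [funext (ruelle_eq_halfSum m f)]
  exact integrable_halfSum (integrable_normSq_mul m hf)

theorem LinfT_integrable (f : LinfT) : Integrable f haarT :=
  (Lp.memLp f).integrable le_top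

/-- The duality of `R` with `f ↦ |m|² f(z²)`: averaging over the two square roots preserves the
integral, and `k(w²)` is constant on each pair of roots. -/
theorem integral_mul_ruelle (m : C(Circle, ℂ)) (k h : LinfT) :
    ∫ z, k (z ^ 2) * (((‖m z‖ ^ 2 : ℝ) : ℂ) * h z) ∂haarT = ∫ z, k z * ruelle 2 m h z ∂haarT := by
  have hk : Measurable k := (Lp.stronglyMeasurable k).measurable
  have hh : Measurable h := (Lp.stronglyMeasurable h).measurable
  have h1 := integral_halfSum (G := fun z => k (z ^ 2) * (((‖m z‖ ^ 2 : ℝ) : ℂ) * h z))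
    ((hk.comp (continuous_pow 2).measurable).mul (measurable_normSq_mul m hh))
    (integrable_bdd_mul (qmp_pow 2 two_ne_zero) k (integrable_normSq_mul m (LinfT_integrable h)))
  rw [← h1]
  congr 1; funext z
  rw [halfSum_mul_comp_sq k (fun z => ((‖m z‖ ^ 2 : ℝ) : ℂ) * h z), ruelle_eq_halfSum]

theorem ae_eq_of_integral_mul_eq {h₁ h₂ : Circle → ℂ} (i₁ : Integrable h₁ haarT)
    (i₂ : Integrable h₂ haarT)
    (h : ∀ g : LinfT, ∫ z, g z * h₁ z ∂haarT = ∫ z, g z * h₂ z ∂haarT) : h₁ =ᵐ[haarT] h₂ := by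
  refine Integrable.ae_eq_of_forall_setIntegral_eq _ _ i₁ i₂ fun s hs _ => ?_
  have h1 := h (indicatorConstLp ∞ hs (measure_ne_top _ _) (1 : ℂ))
  have e : ∀ f : Circle → ℂ, ∫ z, indicatorConstLp ∞ hs (measure_ne_top haarT s) (1 : ℂ) z * f z ∂haarT =
      ∫ z in s, f z ∂haarT := fun f => by
    rw [← integral_indicator hs]
    refine integral_congr_ae ?_
    filter_upwards [(indicatorConstLp_coeFn :
      indicatorConstLp ∞ hs (measure_ne_top haarT s) (1 : ℂ) =ᵐ[haarT] _)] with z hz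
    rw [hz]
    by_cases hx : z ∈ s <;> simp [hx]
  rwa [e, e] at h1

/-! ### Vector states of the cyclic vector -/

/-- The density of the state `g ↦ ⟨φ₁, π₁(g) A φ₁⟩`, for the diagonal operator `A` given by `f`. -/
def density (p : ℕ) (f : Fin p → LinfR) (z : Circle) : ℂ :=
  ∑ k : Fin p, onCircle (per fun y => f k (y + 2 * Real.pi * (k : ℕ) / p) *
    ((‖phiHat p (y + 2 * Real.pi * (k : ℕ) / p)‖ ^ 2 : ℝ) : ℂ)) z

theorem normSq_phi1Hat_ae (p : ℕ) (k : Fin p) : ∀ᵐ x, conj (phi1Hat p k x) * phi1Hat p k x =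
    (2 * Real.pi : ℂ)⁻¹ * ((‖phiHat p x‖ ^ 2 : ℝ) : ℂ) := by
  filter_upwards [phi1Hat_ae p k] with x hx
  rw [hx, map_mul, Complex.conj_ofReal, mul_mul_mul_comm, ← Complex.ofReal_mul,
    Real.mul_self_sqrt (by positivity), Complex.conj_mul']
  push_cast; ring

theorem integrable_normSq_phiHat (p : ℕ) (hp : Odd p) :
    Integrable fun x => ((‖phiHat p x‖ ^ 2 : ℝ) : ℂ) := by
  have h1 := (integrable_inner_L2 (phi1Hat p ⟨0, hp.pos⟩) (phi1Hat p ⟨0, hp.pos⟩)).const_mul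
    (2 * Real.pi : ℂ)
  refine h1.congr ?_
  filter_upwards [normSq_phi1Hat_ae p ⟨0, hp.pos⟩] with x hx
  have : (Real.pi : ℂ) ≠ 0 := by exact_mod_cast Real.pi_ne_zero
  rw [hx, mul_inv_cancel_left₀ (by simp [Real.pi_ne_zero])]

theorem inner_phi1Hat_diag {p : ℕ} {A : H1 p →L[ℂ] H1 p} {f : Fin p → LinfR}
    (hA : IsDiag p A f) (g : LinfT) :
    inner ℂ (phi1Hat p) (pi1Hat p g (A (phi1Hat p))) = (2 * Real.pi : ℂ)⁻¹ * ∑ k : Fin p,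
      ∫ x, g (cis (x - 2 * Real.pi * (k : ℕ) / p)) * (f k x * ((‖phiHat p x‖ ^ 2 : ℝ) : ℂ)) := by
  rw [inner_pi1Hat, Finset.mul_sum]
  refine Finset.sum_congr rfl fun k _ => ?_
  rw [← integral_const_mul]
  refine integral_congr_ae ?_
  filter_upwards [normSq_phi1Hat_ae p k, hA.ae (phi1Hat p) k] with x h1 h2
  rw [h2, mul_left_comm _ (f k x), h1]
  ring

theorem inner_phi1Hat_density {p : ℕ} (hp : Odd p) {A : H1 p →L[ℂ] H1 p} {f : Fin p → LinfR}
    (hA : IsDiag p A f) (g : LinfT) :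
    inner ℂ (phi1Hat p) (pi1Hat p g (A (phi1Hat p))) = ∫ z, g z * density p f z ∂haarT := by
  rw [inner_phi1Hat_diag hA, sum_integral_unfold p fun k =>
    integrable_Linf_mul (f k) (integrable_normSq_phiHat p hp)]
  rfl

theorem integrable_density {p : ℕ} (hp : Odd p) (f : Fin p → LinfR) :
    Integrable (density p f) haarT :=
  integrable_sum_onCircle_per p (F := fun k x => f k x * ((‖phiHat p x‖ ^ 2 : ℝ) : ℂ)) fun k =>
    integrable_Linf_mul (f k) (integrable_normSq_phiHat p hp)

theorem density_cis (p : ℕ) (f : Fin p → LinfR) (x : ℝ) :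
    density p f (cis x) = ∑ k : Fin p, per (fun y => f k (y + 2 * Real.pi * (k : ℕ) / p) *
      ((‖phiHat p (y + 2 * Real.pi * (k : ℕ) / p)‖ ^ 2 : ℝ) : ℂ)) x :=
  Finset.sum_congr rfl fun _ _ => onCircle_cis (per_periodic _) x

theorem ae_norm_le (f : LinfR) : ∀ᵐ x, ‖f x‖ ≤ ‖f‖ := by
  filter_upwards [ae_le_eLpNormEssSup (f := (f : ℝ → ℂ)) (μ := volume)] with x hx
  have h1 : eLpNormEssSup (f : ℝ → ℂ) volume ≠ ∞ := by
    have := Lp.eLpNorm_ne_top f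
    rwa [eLpNorm_exponent_top] at this
  have h2 := ENNReal.toReal_mono h1 hx
  rw [Lp.norm_def, eLpNorm_exponent_top]
  simpa using h2

/-- Each summand is at most `‖f_k‖` times a translate of `h_φ`, and `h_φ ≤ 1`. -/
theorem memLp_density {p : ℕ} (hp : Odd p) (f : Fin p → LinfR) : MemLp (density p f) ∞ haarT := by
  refine memLp_top_of_bound (integrable_density hp f).aestronglyMeasurable (∑ k, ‖f k‖) ?_
  rw [ae_circle_iff]
  have h1 : ∀ᵐ x : ℝ, ∀ (k : Fin p) (m : ℤ),
      ‖f k (x + 2 * m * Real.pi + 2 * Real.pi * (k : ℕ) / p)‖ ≤ ‖f k‖ := by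
    refine ae_all_iff.2 fun k => ae_all_iff.2 fun m => ?_
    have := (measurePreserving_add_right volume
      (2 * m * Real.pi + 2 * Real.pi * (k : ℕ) / p)).quasiMeasurePreserving.ae (ae_norm_le (f k))
    filter_upwards [this] with x hx
    rwa [← add_assoc] at hx
  filter_upwards [h1] with x hx
  rw [density_cis]
  refine (norm_sum_le _ _).trans (Finset.sum_le_sum fun k _ => ?_)
  have hs := (summable_norm_phiHat_sq hp (x + 2 * Real.pi * (k : ℕ) / p)).mul_left ‖f k‖
  refine (tsum_of_norm_bounded hs.hasSum fun m => ?_).trans ?_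
  · rw [norm_mul, Complex.norm_real, Real.norm_of_nonneg (sq_nonneg _),
      show x + 2 * m * Real.pi + 2 * Real.pi * (k : ℕ) / p =
        x + 2 * Real.pi * (k : ℕ) / p + 2 * m * Real.pi by ring]
    refine mul_le_mul_of_nonneg_right ?_ (sq_nonneg _)
    have := hx k m
    rwa [show x + 2 * m * Real.pi + 2 * Real.pi * (k : ℕ) / p =
        x + 2 * Real.pi * (k : ℕ) / p + 2 * m * Real.pi by ring] at this
  · rw [tsum_mul_left]
    refine mul_le_of_le_one_right (norm_nonneg _) ?_
    change hPhi p (x + 2 * Real.pi * (k : ℕ) / p) ≤ 1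
    have h2 := hOrb_le_one hp {k} x
    simpa [hOrb] using h2

/-! ### The states of the projections of the cyclic vector. -/

/-- The projection to the components in `O`, as a bounded operator. -/
def projCLM (p : ℕ) (O : Finset (Fin p)) : H1 p →L[ℂ] H1 p :=
  ((PiLp.continuousLinearEquiv 2 ℂ fun _ : Fin p => L2R).symm : (Fin p → L2R) →L[ℂ] H1 p) ∘L
    (ContinuousLinearMap.pi fun k : Fin p =>
      if k ∈ O then PiLp.proj 2 (fun _ : Fin p => L2R) k else 0)

theorem projO_apply (p : ℕ) (O : Finset (Fin p)) (ξ : H1 p) (k : Fin p) :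
    projO p O ξ k = if k ∈ O then ξ k else 0 := rfl

theorem projCLM_apply (p : ℕ) (O : Finset (Fin p)) (ξ : H1 p) : projCLM p O ξ = projO p O ξ := by
  ext1 k
  change (if k ∈ O then PiLp.proj 2 (fun _ : Fin p => L2R) k else 0 : H1 p →L[ℂ] L2R) ξ = _
  rw [projO_apply]
  split_ifs <;> rfl

theorem inner_projO_phi1Hat {p : ℕ} (hp : Odd p) (O : Finset (Fin p)) (f : LinfT) :
    inner ℂ (projO p O (phi1Hat p)) (pi1Hat p f (projO p O (phi1Hat p))) =
      ∫ z, f z * hOrbC p O z ∂haarT := by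
  let F : Fin p → ℝ → ℂ := fun k x => if k ∈ O then ((‖phiHat p x‖ ^ 2 : ℝ) : ℂ) else 0
  have hF : ∀ k, Integrable (F k) := fun k => by
    by_cases hk : k ∈ O
    · simpa [F, hk] using integrable_normSq_phiHat p hp
    · simp [F, hk]
  have h1 : ∀ z, ∑ k : Fin p, onCircle (per fun y => F k (y + 2 * Real.pi * (k : ℕ) / p)) z =
      hOrbC p O z := fun z => by
    obtain ⟨x, rfl⟩ := cis_surjective z
    rw [hOrbC_cis, hOrb, Complex.ofReal_sum, Finset.sum_congr rfl fun k _ =>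
      onCircle_cis (per_periodic _) x, ← Finset.sum_subset (Finset.subset_univ O)]
    · refine Finset.sum_congr rfl fun k hk => ?_
      rw [per_shift, hPhi, per, per, Complex.ofReal_tsum]
      simp [F, hk]
    · intro k _ hk
      simp [F, hk, per]
  simp only [← h1]
  rw [← sum_integral_unfold p hF, inner_pi1Hat, Finset.mul_sum]
  refine Finset.sum_congr rfl fun k _ => ?_
  rw [← integral_const_mul]
  refine integral_congr_ae ?_
  filter_upwards [normSq_phi1Hat_ae p k, Lp.coeFn_zero ℂ 2 (volume : Measure ℝ)] with x h2 h3
  rw [projO_apply]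
  by_cases hk : k ∈ O
  · simp only [F, if_pos hk]
    rw [h2]; ring
  · simp only [F, if_neg hk]
    rw [h3]; simp

theorem inner_phi1Hat {p : ℕ} (hp : Odd p) (f : LinfT) :
    inner ℂ (phi1Hat p) (pi1Hat p f (phi1Hat p)) = ∫ z, f z ∂haarT := by
  have h := inner_projO_phi1Hat hp Finset.univ f
  have h1 : projO p Finset.univ (phi1Hat p) = phi1Hat p := by
    ext1 k; simp [projO_apply]
  have h2 : ∀ z, hOrbC p Finset.univ z = 1 := fun z => by
    obtain ⟨x, rfl⟩ := cis_surjective z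
    rw [hOrbC_cis, hOrb_univ hp, Complex.ofReal_one]
  simp only [h1, h2, mul_one] at h
  exact h

section

/-! ### Weak limits of bounded sequences of operators -/

open ContinuousLinearMap in
-- Bounded sequences of scalars converge along an ultrafilter. The limits of the matrix coefficients
-- form a bounded sesquilinear form, and such a form is given by an operator.
theorem exists_weak_limit {H : Type*} [NormedAddCommGroup H] [InnerProductSpace ℂ H]
    [CompleteSpace H] (T : ℕ → H →L[ℂ] H) {C : ℝ} (hT : ∀ m ξ, ‖T m ξ‖ ≤ C * ‖ξ‖) :
    ∃ A : H →L[ℂ] H, ∀ ξ η, Tendsto (fun m => inner ℂ ξ (T m η)) (hyperfilter ℕ : Filter ℕ)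
      (𝓝 (inner ℂ ξ (A η))) := by
  have hb : ∀ ξ η m, ‖inner ℂ ξ (T m η)‖ ≤ C * ‖ξ‖ * ‖η‖ := fun ξ η m => by
    refine (norm_inner_le_norm _ _).trans ?_
    rw [mul_comm C, mul_assoc]
    exact mul_le_mul_of_nonneg_left (hT m η) (norm_nonneg _)
  have hex : ∀ ξ η, ∃ c : ℂ, ‖c‖ ≤ C * ‖ξ‖ * ‖η‖ ∧
      Tendsto (fun m => inner ℂ ξ (T m η)) (hyperfilter ℕ : Filter ℕ) (𝓝 c) := fun ξ η => by
    have h1 := (isCompact_closedBall (0 : ℂ) (C * ‖ξ‖ * ‖η‖)).ultrafilter_le_nhds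
      ((hyperfilter ℕ).map fun m => inner ℂ ξ (T m η)) (by
        rw [le_principal_iff]
        refine mem_map.2 (univ_mem' fun m => ?_)
        simpa using hb ξ η m)
    obtain ⟨c, hc, hc'⟩ := h1
    exact ⟨c, by simpa using hc, hc'⟩
  choose L hL hLt using hex
  let B : H →ₗ⋆[ℂ] H →ₗ[ℂ] ℂ := LinearMap.mk₂'ₛₗ (starRingEnd ℂ) (RingHom.id ℂ) L
    (fun ξ ξ' η => tendsto_nhds_unique (hLt _ _) (by
      simpa only [inner_add_left] using (hLt ξ η).add (hLt ξ' η)))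
    (fun c ξ η => tendsto_nhds_unique (hLt _ _) (by
      simpa only [inner_smul_left, smul_eq_mul] using (hLt ξ η).const_mul (conj c)))
    (fun ξ η η' => tendsto_nhds_unique (hLt _ _) (by
      simpa only [map_add, inner_add_right] using (hLt ξ η).add (hLt ξ η')))
    (fun c ξ η => tendsto_nhds_unique (hLt _ _) (by
      simpa only [map_smul, inner_smul_right, RingHom.id_apply, smul_eq_mul] using
        (hLt ξ η).const_mul c))
  -- The operator attached to a form acts on the first variable of the inner product; the adjoint
  -- moves it to the second.
  refine ⟨adjoint (InnerProductSpace.continuousLinearMapOfBilin (B.mkContinuous₂ C hL)),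
    fun ξ η => ?_⟩
  rw [adjoint_inner_right, InnerProductSpace.continuousLinearMapOfBilin_apply]
  exact hLt ξ η

/-! ### Matrix coefficients of the commutant -/

variable {p : ℕ} {hp : Odd p}

theorem inner_pi1Hat_left (hp : Odd p) (f : LinfT) (ξ η : H1 p) :
    inner ℂ (pi1Hat p f ξ) η = inner ℂ ξ (pi1Hat p (star f) η) := by
  rw [← (isRep_pi1Hat p hp).map_star, star_star]

theorem inner_pi1Hat_phi1Hat (hp : Odd p) (f g h : LinfT) :
    inner ℂ (pi1Hat p f (phi1Hat p)) (pi1Hat p h (pi1Hat p g (phi1Hat p))) =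
      ∫ z, (star f • g : LinfT) z * h z ∂haarT := by
  rw [inner_pi1Hat_left hp, ← pi1Hat_smulT p hp, ← pi1Hat_smulT p hp, inner_phi1Hat hp]
  refine integral_congr_ae ?_
  filter_upwards [smulT_ae (star f) g, smulT_ae (star f • h : LinfT) g,
    smulT_ae (star f) h] with z h1 h2 h3
  rw [h1, h2, h3]; ring

theorem refine₀_ae (p : ℕ) (f : LinfT) :
    ∀ᵐ z ∂haarT, refine₀ p f z = f (z ^ 2) * filter₀ p z := by
  filter_upwards [smulT_ae (powT 2 two_ne_zero f) (ofCont (filter₀ p)), powT_ae 2 two_ne_zero f,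
    ofCont_ae (filter₀ p)] with z h1 h2 h3
  rw [refine₀, h1, h2, h3]

/-- Refining `f` and `g` multiplies `conj f · g`, taken at `z²`, by `|m₀|²`. Duality turns this into
`R` acting on `h`, and `Rh = h`. -/
theorem integral_refine₀ {h : LinfT} (hh : ruelle 2 (filter₀ p) h =ᵐ[haarT] h) (f g : LinfT) :
    ∫ z, (star (refine₀ p f) • refine₀ p g : LinfT) z * h z ∂haarT =
      ∫ z, (star f • g : LinfT) z * h z ∂haarT := by
  have h1 : ∫ z, (star f • g : LinfT) z * h z ∂haarT =
      ∫ z, (star f • g : LinfT) z * ruelle 2 (filter₀ p) h z ∂haarT := by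
    refine integral_congr_ae ?_
    filter_upwards [hh] with z hz
    rw [hz]
  rw [h1, ← integral_mul_ruelle]
  refine integral_congr_ae ?_
  filter_upwards [smulT_ae (star (refine₀ p f)) (refine₀ p g), starT_ae (refine₀ p f),
    refine₀_ae p f, refine₀_ae p g, (qmp_pow 2 two_ne_zero).ae (smulT_ae (star f) g),
    (qmp_pow 2 two_ne_zero).ae (starT_ae f)] with z h2 h3 h4 h5 h6 h7
  rw [h2, h3, h4, h5, h6, h7, map_mul, Complex.ofReal_pow, ← Complex.conj_mul']
  ring

theorem inner_cycVec (hp : Odd p) (n : ℕ) (f : LinfT) (ξ : H1 p) :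
    inner ℂ (cycVec p hp n f) ξ = inner ℂ (pi1Hat p f (phi1Hat p)) ((U1Hat p hp ^ n) ξ) := by
  rw [← (U1Hat p hp ^ n).inner_map_map, cycVec, LinearIsometryEquiv.apply_symm_apply]

theorem pow_cycVec (hp : Odd p) (n : ℕ) (f : LinfT) :
    (U1Hat p hp ^ n) (cycVec p hp n f) = pi1Hat p f (phi1Hat p) :=
  LinearIsometryEquiv.apply_symm_apply _ _

theorem U1Hat_cycVec_succ (hp : Odd p) (n : ℕ) (f : LinfT) :
    U1Hat p hp (cycVec p hp (n + 1) f) = cycVec p hp n f := by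
  rw [cycVec, cycVec, pow_succ]
  exact (U1Hat p hp).apply_symm_apply _

/-- The value is independent of `j`: raising both vectors one level lowers `j` by one, and
`integral_refine₀` absorbs the refinement. -/
theorem inner_cycVec_conjPi {h : LinfT} (hh : ruelle 2 (filter₀ p) h =ᵐ[haarT] h) (n j : ℕ)
    (f g : LinfT) : inner ℂ (cycVec p hp n f) (conjPi p hp (n + j) h (cycVec p hp n g)) =
      ∫ z, (star f • g : LinfT) z * h z ∂haarT := by
  induction j generalizing n f g with
  | zero =>
    rw [inner_cycVec, conjPi_apply, add_zero, LinearIsometryEquiv.apply_symm_apply, pow_cycVec,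
      inner_pi1Hat_phi1Hat hp]
  | succ j ih =>
    rw [cycVec_succ hp n f, cycVec_succ hp n g, add_comm j 1, ← add_assoc, ih,
      integral_refine₀ hh]

theorem cycVec_add (hp : Odd p) (n j : ℕ) (f : LinfT) :
    ∃ g, cycVec p hp n f = cycVec p hp (n + j) g := by
  induction j with
  | zero => exact ⟨f, rfl⟩
  | succ j ih =>
    obtain ⟨g, hg⟩ := ih
    exact ⟨refine₀ p g, by rw [hg, cycVec_succ]; rfl⟩

open ContinuousLinearMap in
-- The vectors `U^{-n} π(f) φ̂₁` are total. Two of them with different levels can be brought to a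
-- common level, so equal levels suffice.
theorem eq_of_inner_cycVec (hp : Odd p) {A B : H1 p →L[ℂ] H1 p} (h : ∀ n f g,
    inner ℂ (cycVec p hp n f) (A (cycVec p hp n g)) =
      inner ℂ (cycVec p hp n f) (B (cycVec p hp n g))) : A = B := by
  have h1 : ∀ n f, A (cycVec p hp n f) = B (cycVec p hp n f) := fun n f => by
    refine sub_eq_zero.1 (eq_zero_of_inner_cycVec hp fun m g => inner_eq_zero_symm.1 ?_)
    obtain ⟨f', hf⟩ := cycVec_add hp n m f
    obtain ⟨g', hg⟩ := cycVec_add hp m n g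
    rw [add_comm] at hg
    rw [hf, hg, inner_sub_right, h, sub_self]
  ext1 η
  refine ext_inner_left ℂ fun ξ => ?_
  rw [← adjoint_inner_left, ← adjoint_inner_left]
  congr 1
  refine sub_eq_zero.1 (eq_zero_of_inner_cycVec hp fun n f => ?_)
  rw [inner_sub_left, adjoint_inner_left, adjoint_inner_left, h1, sub_self]

theorem commutant_symm_pow {A : H1 p →L[ℂ] H1 p} (hA : A ∈ commutant (pi1Hat p) (U1Hat p hp))
    (n : ℕ) (ξ : H1 p) : (U1Hat p hp ^ n) (A ((U1Hat p hp ^ n).symm ξ)) = A ξ := by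
  induction n generalizing ξ with
  | zero => rfl
  | succ n ih =>
    rw [pow_succ]
    change (U1Hat p hp ^ n) (U1Hat p hp (A ((U1Hat p hp).symm ((U1Hat p hp ^ n).symm ξ)))) = _
    rw [← hA.2, LinearIsometryEquiv.apply_symm_apply, ih]

/-- All matrix coefficients on a total set are expressed by the state `g ↦ ⟨φ̂₁, π(g) A φ̂₁⟩`; hence
the state determines the operator. -/
theorem commutant_inner_cycVec {A : H1 p →L[ℂ] H1 p}
    (hA : A ∈ commutant (pi1Hat p) (U1Hat p hp)) (n : ℕ) (f g : LinfT) :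
    inner ℂ (cycVec p hp n f) (A (cycVec p hp n g)) =
      inner ℂ (phi1Hat p) (pi1Hat p (star f • g : LinfT) (A (phi1Hat p))) := by
  rw [inner_cycVec, cycVec, commutant_symm_pow hA, hA.1, pi1Hat_smulT p hp, inner_pi1Hat_left hp]

theorem commutant_ext {A B : H1 p →L[ℂ] H1 p} (hA : A ∈ commutant (pi1Hat p) (U1Hat p hp))
    (hB : B ∈ commutant (pi1Hat p) (U1Hat p hp))
    (h : ∀ g, inner ℂ (phi1Hat p) (pi1Hat p g (A (phi1Hat p))) =
      inner ℂ (phi1Hat p) (pi1Hat p g (B (phi1Hat p)))) : A = B :=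
  eq_of_inner_cycVec hp fun n f g => by
    rw [commutant_inner_cycVec hA, commutant_inner_cycVec hB, h]

theorem ofCont_normSq_ae (m : C(Circle, ℂ)) (g : LinfT) : ∀ᵐ z ∂haarT,
    (star (ofCont m) • (g • ofCont m : LinfT) : LinfT) z = g z * ((‖m z‖ ^ 2 : ℝ) : ℂ) := by
  filter_upwards [smulT_ae (star (ofCont m)) (g • ofCont m : LinfT), smulT_ae g (ofCont m),
    starT_ae (ofCont m), ofCont_ae m] with z h1 h2 h3 h4
  rw [h1, h2, h3, h4, Complex.ofReal_pow, ← Complex.conj_mul']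
  ring

/-- By duality, `∫ g Rh` is the state at `conj m₀ · g(z²) m₀`. The two factors `m₀` turn into
`Uφ̂₁`, and unitarity of `U` together with `AU = UA` leads back to the state at `g`. -/
theorem ruelle_eq_of_commutant {A : H1 p →L[ℂ] H1 p}
    (hA : A ∈ commutant (pi1Hat p) (U1Hat p hp)) {h : LinfT}
    (hh : ∀ g : LinfT, inner ℂ (phi1Hat p) (pi1Hat p g (A (phi1Hat p))) =
      ∫ z, g z * h z ∂haarT) : ruelle 2 (filter₀ p) h =ᵐ[haarT] h := by
  refine ae_eq_of_integral_mul_eq (integrable_ruelle _ (LinfT_integrable h)) (LinfT_integrable h)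
    fun g => ?_
  have h1 : ∫ z, g z * ruelle 2 (filter₀ p) h z ∂haarT =
      ∫ z, (star (ofCont (filter₀ p)) • refine₀ p g : LinfT) z * h z ∂haarT := by
    rw [← integral_mul_ruelle]
    refine integral_congr_ae ?_
    filter_upwards [ofCont_normSq_ae (filter₀ p) (powT 2 two_ne_zero g),
      powT_ae 2 two_ne_zero g] with z h2 h3
    rw [refine₀, h2, h3, mul_assoc]
  rw [h1, ← hh, ← hh, pi1Hat_smulT p hp, ← inner_pi1Hat_left hp, ← U1Hat_phi1Hat hp, ← hA.1,
    ← U1Hat_pi1Hat_phi1Hat hp, hA.2, LinearIsometryEquiv.inner_map_map, hA.1]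

theorem conjPi_pi1Hat (hp : Odd p) (n : ℕ) (f g : LinfT) (ξ : H1 p) :
    conjPi p hp n f (pi1Hat p g ξ) = pi1Hat p g (conjPi p hp n f ξ) := by
  refine H1_ext fun k => ?_
  filter_upwards [conjPi_ae p hp n f (pi1Hat p g ξ) k, conjPi_ae p hp n f ξ k, pi1Hat_ae p g ξ k,
    pi1Hat_ae p g (conjPi p hp n f ξ) k] with x h1 h2 h3 h4
  rw [h1, h3, h4, h2, mul_left_comm]

theorem norm_conjPi_le (hp : Odd p) (n : ℕ) (f : LinfT) (ξ : H1 p) :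
    ‖conjPi p hp n f ξ‖ ≤ ‖pi1Hat p f‖ * ‖ξ‖ := by
  rw [conjPi_apply, LinearIsometryEquiv.norm_map]
  refine (ContinuousLinearMap.le_opNorm _ _).trans_eq ?_
  rw [LinearIsometryEquiv.norm_map]

/-- The operator is a weak limit of `U^{-m} π(h) U^m`. Each of these is a multiplication in every
component, so the limit commutes with `π`. -/
theorem exists_commutant_of_ruelle (hp : Odd p) {h : LinfT}
    (hh : ruelle 2 (filter₀ p) h =ᵐ[haarT] h) : ∃ A ∈ commutant (pi1Hat p) (U1Hat p hp),
      ∀ g : LinfT, inner ℂ (phi1Hat p) (pi1Hat p g (A (phi1Hat p))) = ∫ z, g z * h z ∂haarT := by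
  obtain ⟨A, hA⟩ := exists_weak_limit (fun m => conjPi p hp m h) (norm_conjPi_le hp · h)
  have hc : ∀ n f g, inner ℂ (cycVec p hp n f) (A (cycVec p hp n g)) =
      ∫ z, (star f • g : LinfT) z * h z ∂haarT := fun n f g => by
    refine tendsto_nhds_unique (hA _ _) (tendsto_const_nhds.congr' ?_)
    -- The coefficients are constant for `m ≥ n`, and the ultrafilter contains every such tail.
    refine Nat.hyperfilter_le_atTop ?_
    filter_upwards [eventually_ge_atTop n] with m hm
    obtain ⟨j, rfl⟩ := Nat.exists_eq_add_of_le hm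
    exact (inner_cycVec_conjPi hh n j f g).symm
  have hπ : ∀ g ξ, A (pi1Hat p g ξ) = pi1Hat p g (A ξ) := fun g η => by
    refine ext_inner_left ℂ fun ξ => ?_
    rw [← (isRep_pi1Hat p hp).map_star]
    refine tendsto_nhds_unique (hA _ _) ?_
    simp only [conjPi_pi1Hat, ← (isRep_pi1Hat p hp).map_star]
    exact hA _ _
  -- `U⁻¹ A U` has the same coefficients as `A`: on vectors of level `n + 1`, `U` lowers the level
  -- by one, and `integral_refine₀` shows that the coefficient is unchanged.
  have hU : A = (((U1Hat p hp).symm : H1 p →L[ℂ] H1 p) ∘L A) ∘L (U1Hat p hp : H1 p →L[ℂ] H1 p) := by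
    refine eq_of_inner_cycVec hp fun n f g => ?_
    rw [cycVec_succ hp n f, cycVec_succ hp n g, hc]
    change _ = inner ℂ _ ((U1Hat p hp).symm (A (U1Hat p hp _)))
    rw [← (U1Hat p hp).inner_map_map, LinearIsometryEquiv.apply_symm_apply, U1Hat_cycVec_succ,
      U1Hat_cycVec_succ, hc, integral_refine₀ hh]
  refine ⟨A, ⟨hπ, fun ξ => ?_⟩, fun g => ?_⟩
  · conv_rhs => rw [hU]
    exact ((U1Hat p hp).apply_symm_apply _).symm
  · have h0 := hc 0 (ofCont 1) g
    have h1 : ∀ f, cycVec p hp 0 f = pi1Hat p f (phi1Hat p) := fun _ => rfl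
    rw [h1, h1, (isRep_pi1Hat p hp).map_one, hπ] at h0
    refine h0.trans (integral_congr_ae ?_)
    filter_upwards [smulT_ae (star (ofCont 1)) g, starT_ae (ofCont 1), ofCont_ae 1] with z h2 h3 h4
    rw [h2, h3, h4]
    simp

end

section

/-! ### The Fourier transform of the `p`-fold representation -/

theorem fourierU_wavePi (f : LinfT) (ψ : L2R) : fourierU (wavePi f ψ) = wavePiHat f (fourierU ψ) :=
  fourierU.apply_symm_apply _

theorem fourier1_pi1 (p : ℕ) (f : LinfT) (ξ : H1 p) :
    fourier1 p (pi1 p f ξ) = pi1Hat p f (fourier1 p ξ) :=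
  PiLp.ext fun _ => fourierU_wavePi _ _

theorem fourier1_U1 (p : ℕ) (hp : Odd p) (ξ : H1 p) :
    fourier1 p (U1 p hp ξ) = U1Hat p hp (fourier1 p ξ) :=
  PiLp.ext fun _ => fourierU_waveU _

variable {p : ℕ} {hp : Odd p} {A B : H1 p →L[ℂ] H1 p}

theorem mem_commutant_iff (hAB : ∀ ξ, fourier1 p (A ξ) = B (fourier1 p ξ)) :
    A ∈ commutant (pi1 p) (U1 p hp) ↔ B ∈ commutant (pi1Hat p) (U1Hat p hp) := by
  constructor
  · refine fun hA => ⟨fun f ξ => ?_, fun ξ => ?_⟩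
    · obtain ⟨η, rfl⟩ := (fourier1 p).surjective ξ
      rw [← fourier1_pi1, ← hAB, ← hAB, hA.1, fourier1_pi1]
    · obtain ⟨η, rfl⟩ := (fourier1 p).surjective ξ
      rw [← fourier1_U1, ← hAB, ← hAB, hA.2, fourier1_U1]
  · refine fun hB => ⟨fun f ξ => (fourier1 p).injective ?_, fun ξ => (fourier1 p).injective ?_⟩
    · rw [hAB, fourier1_pi1, hB.1, fourier1_pi1, hAB]
    · rw [hAB, fourier1_U1, hB.2, fourier1_U1, hAB]

theorem corresponds_iff (hAB : ∀ ξ, fourier1 p (A ξ) = B (fourier1 p ξ)) (h : LinfT) :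
    Corresponds p A h ↔ ∀ g : LinfT,
      inner ℂ (phi1Hat p) (pi1Hat p g (B (phi1Hat p))) = ∫ z, g z * h z ∂haarT := by
  refine forall_congr' fun g => ?_
  rw [phi1Hat, ← hAB, ← fourier1_pi1, LinearIsometryEquiv.inner_map_map]

theorem exists_fourier_conj (A : H1 p →L[ℂ] H1 p) :
    ∃ B : H1 p →L[ℂ] H1 p, ∀ ξ, fourier1 p (A ξ) = B (fourier1 p ξ) := by
  refine ⟨(fourier1 p : H1 p →L[ℂ] H1 p) ∘L A ∘L ((fourier1 p).symm : H1 p →L[ℂ] H1 p),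
    fun ξ => ?_⟩
  change _ = fourier1 p (A ((fourier1 p).symm (fourier1 p ξ)))
  rw [LinearIsometryEquiv.symm_apply_apply]

theorem exists_fourier_conj_symm (B : H1 p →L[ℂ] H1 p) :
    ∃ A : H1 p →L[ℂ] H1 p, ∀ ξ, fourier1 p (A ξ) = B (fourier1 p ξ) := by
  refine ⟨((fourier1 p).symm : H1 p →L[ℂ] H1 p) ∘L B ∘L (fourier1 p : H1 p →L[ℂ] H1 p),
    fun ξ => ?_⟩
  exact (fourier1 p).apply_symm_apply _

theorem corresponds_iff_density (hp : Odd p) {f : Fin p → LinfR} (hB : IsDiag p B f)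
    (hAB : ∀ ξ, fourier1 p (A ξ) = B (fourier1 p ξ)) (h : LinfT) :
    Corresponds p A h ↔ h =ᵐ[haarT] density p f := by
  rw [corresponds_iff hAB]
  simp only [inner_phi1Hat_density hp hB]
  constructor
  · exact fun H => (ae_eq_of_integral_mul_eq (integrable_density hp f) (LinfT_integrable h) H).symm
  · intro H g
    refine integral_congr_ae ?_
    filter_upwards [H] with z hz
    rw [hz]

theorem corresponds_iff_ae (hp : Odd p) {f : Fin p → LinfR} (hB : IsDiag p B f)
    (hAB : ∀ ξ, fourier1 p (A ξ) = B (fourier1 p ξ)) (h : LinfT) :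
    Corresponds p A h ↔ ∀ᵐ x : ℝ, h (cis x) = ∑ k : Fin p,
      per (fun y => f k (y + 2 * k * Real.pi / p) *
        ((‖phiHat p (y + 2 * k * Real.pi / p)‖ ^ 2 : ℝ) : ℂ)) x := by
  rw [corresponds_iff_density hp hB hAB, EventuallyEq, ae_circle_iff]
  simp only [density_cis, mul_right_comm (2 : ℝ) Real.pi]

theorem corresponds_iff_integral {f : Fin p → LinfR} (hB : IsDiag p B f)
    (hAB : ∀ ξ, fourier1 p (A ξ) = B (fourier1 p ξ)) (h : LinfT) :
    Corresponds p A h ↔ ∀ g : LinfT,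
      (1 / (2 * Real.pi : ℂ)) * ∑ k : Fin p, ∫ x : ℝ,
        (starRingEnd ℂ) (phiHat p x) * (lift (alpha (rhoPow p k) g) x * f k x * phiHat p x) =
      ∫ z, g z * h z ∂haarT := by
  rw [corresponds_iff hAB]
  refine forall_congr' fun g => ?_
  rw [inner_phi1Hat_diag hB, one_div]
  refine Eq.congr_left (congrArg _ (Finset.sum_congr rfl fun k _ => integral_congr_ae ?_))
  filter_upwards [lift_alpha_ae p k g] with x hx
  rw [hx, Complex.ofReal_pow, ← Complex.conj_mul']
  ring

theorem exists_diag (p : ℕ) (f : Fin p → LinfR) : ∃ B : H1 p →L[ℂ] H1 p, IsDiag p B f :=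
  ⟨((PiLp.continuousLinearEquiv 2 ℂ fun _ : Fin p => L2R).symm : (Fin p → L2R) →L[ℂ] H1 p) ∘L
    (ContinuousLinearMap.pi fun k : Fin p => mulOp (f k) ∘L PiLp.proj 2 (fun _ : Fin p => L2R) k),
    fun _ _ => rfl⟩

theorem ruelle_eq_of_corresponds (hA : A ∈ commutant (pi1 p) (U1 p hp)) {h : LinfT}
    (hh : Corresponds p A h) : ruelle 2 (filter₀ p) h =ᵐ[haarT] h := by
  obtain ⟨B, hAB⟩ := exists_fourier_conj A
  exact ruelle_eq_of_commutant ((mem_commutant_iff hAB).1 hA) ((corresponds_iff hAB h).1 hh)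

theorem existsUnique_eigenfunction (hA : A ∈ commutant (pi1 p) (U1 p hp)) :
    ∃! h : LinfT, (ruelle 2 (filter₀ p) h =ᵐ[haarT] h) ∧ Corresponds p A h := by
  obtain ⟨B, hAB⟩ := exists_fourier_conj A
  obtain ⟨f, -, hf⟩ := exists_diag_of_commutant ((mem_commutant_iff hAB).1 hA)
  have hc : Corresponds p A (memLp_density hp f).toLp :=
    (corresponds_iff_density hp hf hAB _).2 (memLp_density hp f).coeFn_toLp
  refine ⟨_, ⟨ruelle_eq_of_corresponds hA hc, hc⟩, fun h hh => Lp.ext ?_⟩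
  exact ((corresponds_iff_density hp hf hAB h).1 hh.2).trans (memLp_density hp f).coeFn_toLp.symm

theorem existsUnique_commutant (hp : Odd p) {h : LinfT} (hh : ruelle 2 (filter₀ p) h =ᵐ[haarT] h) :
    ∃! A : H1 p →L[ℂ] H1 p, A ∈ commutant (pi1 p) (U1 p hp) ∧ Corresponds p A h := by
  obtain ⟨B, hB, hBh⟩ := exists_commutant_of_ruelle hp hh
  obtain ⟨A, hAB⟩ := exists_fourier_conj_symm B
  refine ⟨A, ⟨(mem_commutant_iff hAB).2 hB, (corresponds_iff hAB h).2 hBh⟩, fun A' hA' => ?_⟩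
  obtain ⟨B', hAB'⟩ := exists_fourier_conj A'
  have h1 : B' = B := commutant_ext ((mem_commutant_iff hAB').1 hA'.1) hB fun g => by
    rw [hBh, (corresponds_iff hAB' h).1 hA'.2]
  ext1 ξ
  apply (fourier1 p).injective
  rw [hAB, hAB', h1]

theorem ruelle_eq_iff_exists_invFamily (hp : Odd p) (h : LinfT) :
    ruelle 2 (filter₀ p) h =ᵐ[haarT] h ↔
      ∃ f ∈ invFamilies p hp, ∀ᵐ x : ℝ, h (cis x) = ∑ k : Fin p,
        per (fun y => f k (y + 2 * k * Real.pi / p) *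
          ((‖phiHat p (y + 2 * k * Real.pi / p)‖ ^ 2 : ℝ) : ℂ)) x := by
  constructor
  · intro hh
    obtain ⟨A, ⟨hA, hAh⟩, -⟩ := existsUnique_commutant hp hh
    obtain ⟨B, hAB⟩ := exists_fourier_conj A
    obtain ⟨f, hf, hd⟩ := exists_diag_of_commutant ((mem_commutant_iff hAB).1 hA)
    exact ⟨f, hf, (corresponds_iff_ae hp hd hAB h).1 hAh⟩
  · rintro ⟨f, hf, hh⟩
    obtain ⟨B, hB⟩ := exists_diag p f
    obtain ⟨A, hAB⟩ := exists_fourier_conj_symm B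
    exact ruelle_eq_of_corresponds ((mem_commutant_iff hAB).2 (commutant_of_diag hf hB))
      ((corresponds_iff_ae hp hB hAB h).2 hh)

end

/-! ### Cyclic representations -/

theorem isRep_pi1 (p : ℕ) (hp : Odd p) : IsRep 2 two_ne_zero (pi1 p) (U1 p hp) :=
  (isRep_pi1Hat p hp).of_isometry (fourier1 p).toLinearIsometry (fourier1_pi1 p) (fourier1_U1 p hp)

theorem U1_phi1 {p : ℕ} (hp : Odd p) : U1 p hp (phi1 p) = pi1 p (ofCont (filter₀ p)) (phi1 p) := by
  apply (fourier1 p).injective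
  rw [fourier1_U1, fourier1_pi1]
  exact U1Hat_phi1Hat hp

theorem cyclic_pi1 {p : ℕ} (hp : Odd p) :
    (Submodule.span ℂ {ξ : H1 p | ∃ (n : ℤ) (f : LinfT),
      ξ = (U1 p hp ^ n) (pi1 p f (phi1 p))}).topologicalClosure = ⊤ := by
  have h := cyclic_of_surjective (π' := pi1 p) (U' := U1 p hp)
    ((fourier1 p).symm : H1 p →L[ℂ] H1 p) (fourier1 p).symm.surjective
    (fun f ξ => (fourier1 p).injective ?_) (fun ξ => (fourier1 p).injective ?_) (cyclic_pi1Hat hp)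
  · have e : ((fourier1 p).symm : H1 p →L[ℂ] H1 p) (phi1Hat p) = phi1 p :=
      (fourier1 p).symm_apply_apply _
    rwa [e] at h
  · rw [fourier1_pi1]
    change fourier1 p ((fourier1 p).symm _) = pi1Hat p f (fourier1 p ((fourier1 p).symm ξ))
    rw [LinearIsometryEquiv.apply_symm_apply, LinearIsometryEquiv.apply_symm_apply]
  · rw [fourier1_U1]
    change fourier1 p ((fourier1 p).symm _) = U1Hat p hp (fourier1 p ((fourier1 p).symm ξ))
    rw [LinearIsometryEquiv.apply_symm_apply, LinearIsometryEquiv.apply_symm_apply]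

theorem projO_pi1 (p : ℕ) (O : Finset (Fin p)) (f : LinfT) (ξ : H1 p) :
    projO p O (pi1 p f ξ) = pi1 p f (projO p O ξ) := by
  ext1 k
  rw [projO_apply, pi1, ampPi_apply, ampPi_apply, projO_apply]
  split_ifs
  · rfl
  · rw [map_zero]

theorem projO_U1 {p : ℕ} {hp : Odd p} {O : Finset (Fin p)}
    (hO : ∀ l, sigma p hp l ∈ O ↔ l ∈ O) (ξ : H1 p) :
    projO p O (U1 p hp ξ) = U1 p hp (projO p O ξ) := by
  ext1 k
  rw [projO_apply, U1, ampU_apply, ampU_apply, projO_apply]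
  simp only [hO]
  split_ifs
  · rfl
  · rw [map_zero]

theorem fourier1_projO (p : ℕ) (O : Finset (Fin p)) (ξ : H1 p) :
    fourier1 p (projO p O ξ) = projO p O (fourier1 p ξ) := by
  ext1 k
  rw [projO_apply, fourier1_apply, projO_apply, fourier1_apply]
  split_ifs
  · rfl
  · rw [map_zero]

theorem inner_projO_phi1 {p : ℕ} (hp : Odd p) (O : Finset (Fin p)) (f : LinfT) :
    inner ℂ (projO p O (phi1 p)) (pi1 p f (projO p O (phi1 p))) =
      ∫ z, f z * hOrbC p O z ∂haarT := by
  rw [← inner_projO_phi1Hat hp, ← (fourier1 p).inner_map_map, fourier1_pi1, fourier1_projO]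
  rfl

theorem integrable_hOrb {p : ℕ} (hp : Odd p) (O : Finset (Fin p)) :
    Integrable (onCircle (hOrb p O)) haarT :=
  (continuous_onCircle (continuous_hOrb hp O) (hOrb_periodic p O)).integrable_of_hasCompactSupport
    (HasCompactSupport.of_compactSpace _)

/-- A copy of the components of the `p`-fold representation in a set invariant under `σ`. -/
theorem isCyclicRep_of_projO {p : ℕ} {hp : Odd p} {O : Finset (Fin p)}
    (hO : ∀ l, sigma p hp l ∈ O ↔ l ∈ O) {K : Type*} [NormedAddCommGroup K] [InnerProductSpace ℂ K]
    {π : LinfT → K →L[ℂ] K} {U : K ≃ₗᵢ[ℂ] K} (T : K →ₗᵢ[ℂ] H1 p) (S : H1 p →L[ℂ] K)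
    (hS : Function.Surjective S) (hTS : ∀ ξ, T (S ξ) = projO p O ξ)
    (hπ : ∀ f ξ, T (π f ξ) = pi1 p f (T ξ)) (hU : ∀ ξ, T (U ξ) = U1 p hp (T ξ)) :
    IsCyclicRep 2 two_ne_zero (filter₀ p) (onCircle (hOrb p O)) π U (S (phi1 p)) := by
  have hSπ : ∀ f ξ, S (pi1 p f ξ) = π f (S ξ) := fun f ξ => T.injective (by
    rw [hTS, hπ, hTS, projO_pi1])
  have hSU : ∀ ξ, S (U1 p hp ξ) = U (S ξ) := fun ξ => T.injective (by
    rw [hTS, hU, hTS, projO_U1 hO])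
  exact
    { rep := (isRep_pi1 p hp).of_isometry T hπ hU
      integrable := integrable_hOrb hp O
      nonneg := ae_of_all _ fun _ => hOrb_nonneg p O _
      eigen := ae_of_all _ fun z => congrFun (hOrbC_mem_contSol hp hO).2 z
      scaling := by rw [← hSU, U1_phi1, hSπ]
      state := fun f => by
        rw [← T.inner_map_map, hπ, hTS, inner_projO_phi1 hp]
        rfl
      cyclic := cyclic_of_surjective S hS hSπ hSU (cyclic_pi1 hp) }

theorem isCyclicRep_pi1 {p : ℕ} (hp : Odd p) :
    IsCyclicRep 2 two_ne_zero (filter₀ p) (fun _ => 1) (pi1 p) (U1 p hp) (phi1 p) := by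
  have h := isCyclicRep_of_projO (hp := hp) (O := Finset.univ) (by simp) (π := pi1 p) (U := U1 p hp)
    LinearIsometry.id (ContinuousLinearMap.id ℂ (H1 p)) Function.surjective_id
    (fun ξ => by ext1 k; simp [projO_apply]) (fun _ _ => rfl) fun _ => rfl
  have e : onCircle (hOrb p Finset.univ) = fun _ => 1 := funext fun _ => hOrb_univ hp _
  rwa [e] at h

/-! ### The component with index `0`: the wavelet representation on the line. -/

theorem alpha_rhoPow_zero (p : ℕ) (f : LinfT) : alpha (rhoPow p 0) f = f := by
  refine Lp.ext ?_
  filter_upwards [alpha_ae (rhoPow p 0) f] with z hz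
  rw [hz, rhoPow, pow_zero, one_mul]

theorem hOrb_zero {p : ℕ} (hp : Odd p) : hOrb p {⟨0, hp.pos⟩} = hPhi p := by
  funext x
  rw [hOrb, Finset.sum_singleton]
  simp

/-- The inclusion of a component. -/
def inclusion₁ (p : ℕ) (k : Fin p) : L2R →ₗᵢ[ℂ] H1 p where
  toFun ψ := WithLp.toLp 2 fun j => if j = k then ψ else 0
  map_add' ψ χ := by
    refine PiLp.ext fun j => ?_
    change (if j = k then ψ + χ else 0) = (if j = k then ψ else 0) + if j = k then χ else 0
    split_ifs
    · rfl
    · exact (add_zero 0).symm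
  map_smul' c ψ := by
    refine PiLp.ext fun j => ?_
    change (if j = k then c • ψ else 0) = c • if j = k then ψ else 0
    split_ifs
    · rfl
    · exact (smul_zero c).symm
  norm_map' ψ := by
    refine Eq.trans (congrArg norm (PiLp.ext fun j => ?_))
      (PiLp.norm_single 2 (fun _ : Fin p => L2R) k ψ)
    change (if j = k then ψ else 0) = PiLp.single 2 (β := fun _ : Fin p => L2R) k ψ j
    split_ifs with h
    · subst h; rw [PiLp.single_eq_same]
    · rw [PiLp.single_eq_of_ne 2 h]

theorem inclusion₁_apply {p : ℕ} (k j : Fin p) (ψ : L2R) :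
    inclusion₁ p k ψ j = if j = k then ψ else 0 := rfl

/-- The index `0` is fixed by `σ` and carries the trivial rotation, so the inclusion of this
component intertwines `(π, U)` with `(π₁, U₁)`. -/
theorem isCyclicRep_wavePi {p : ℕ} (hp : Odd p) :
    IsCyclicRep 2 two_ne_zero (filter₀ p) (onCircle (hPhi p)) wavePi waveU (phi p) := by
  have h0 : ∀ l : Fin p, sigma p hp l = ⟨0, hp.pos⟩ ↔ l = ⟨0, hp.pos⟩ := fun l => by
    have : sigma p hp ⟨0, hp.pos⟩ = ⟨0, hp.pos⟩ := Fin.ext (Nat.zero_mod p)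
    exact ⟨fun h => (sigma p hp).injective (h.trans this.symm), fun h => by rw [h, this]⟩
  let k₀ : Fin p := ⟨0, hp.pos⟩
  let S : H1 p →L[ℂ] L2R := PiLp.proj 2 (fun _ : Fin p => L2R) k₀
  have hS : ∀ ξ, S ξ = ξ k₀ := fun _ => rfl
  have h := isCyclicRep_of_projO (hp := hp) (O := {k₀}) (by simpa using h0)
    (π := wavePi) (U := waveU) (inclusion₁ p k₀) S (fun ψ => ⟨inclusion₁ p k₀ ψ, ?_⟩)
    (fun ξ => ?_) (fun f ψ => ?_) fun ψ => ?_
  · rw [hOrb_zero hp] at h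
    exact h
  · rw [hS, inclusion₁_apply, if_pos rfl]
  · refine PiLp.ext fun k => ?_
    rw [inclusion₁_apply, projO_apply, hS]
    simp only [Finset.mem_singleton]
    split_ifs with h
    · rw [h]
    · rfl
  · refine PiLp.ext fun k => ?_
    rw [pi1, ampPi_apply, inclusion₁_apply, inclusion₁_apply]
    split_ifs with h
    · rw [h, alpha_rhoPow_zero]
    · rw [map_zero]
  · refine PiLp.ext fun k => ?_
    rw [U1, ampU_apply, inclusion₁_apply, inclusion₁_apply]
    simp only [k₀, h0]
    split_ifs
    · rfl
    · rw [map_zero]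

/-! ### The subrepresentation on the components in an invariant set. -/

theorem projO_mem (p : ℕ) (O : Finset (Fin p)) (ξ : H1 p) : projO p O ξ ∈ subH p O :=
  fun _ hk => if_neg hk

theorem projO_of_mem {p : ℕ} {O : Finset (Fin p)} {ξ : H1 p} (hξ : ξ ∈ subH p O) :
    projO p O ξ = ξ := by
  ext1 k
  rw [projO_apply]
  split_ifs with h
  · rfl
  · exact (hξ k h).symm

/-- The projection to the components in `O`, with values in their span. -/
def projSub (p : ℕ) (O : Finset (Fin p)) : H1 p →L[ℂ] subH p O :=
  (projCLM p O).codRestrict (subH p O) fun ξ => by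
    rw [projCLM_apply]
    exact projO_mem p O ξ

theorem coe_projSub (p : ℕ) (O : Finset (Fin p)) (ξ : H1 p) :
    (projSub p O ξ : H1 p) = projO p O ξ := projCLM_apply p O ξ

theorem projSub_surjective (p : ℕ) (O : Finset (Fin p)) : Function.Surjective (projSub p O) :=
  fun ξ => ⟨ξ, Subtype.ext ((coe_projSub p O ξ).trans (projO_of_mem ξ.2))⟩

theorem exists_subU {p : ℕ} {hp : Odd p} {O : Finset (Fin p)}
    (hO : ∀ l, sigma p hp l ∈ O ↔ l ∈ O) :
    ∃ U : subH p O ≃ₗᵢ[ℂ] subH p O, ∀ ξ, (U ξ : H1 p) = U1 p hp ξ := by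
  have hmem : ∀ ξ : subH p O, U1 p hp ξ ∈ subH p O := fun ξ => by
    rw [← projO_of_mem ξ.2, ← projO_U1 hO]
    exact projO_mem p O _
  let V : subH p O →ₗᵢ[ℂ] subH p O :=
    { toLinearMap := ((U1 p hp).toLinearEquiv.toLinearMap ∘ₗ (subH p O).subtype).codRestrict
        (subH p O) hmem
      norm_map' := fun ξ => (U1 p hp).norm_map ξ }
  refine ⟨LinearIsometryEquiv.ofSurjective V fun η => ?_, fun ξ => rfl⟩
  obtain ⟨ξ, hξ⟩ := (U1 p hp).surjective η
  -- The preimage of `η` in the full space is replaced by its projection, which `U₁` still maps to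
  -- `η` because the two commute.
  refine ⟨projSub p O ξ, Subtype.ext ?_⟩
  change U1 p hp (projSub p O ξ : H1 p) = η
  rw [coe_projSub, ← projO_U1 hO, hξ, projO_of_mem η.2]

theorem exists_isCyclicRep_subH {p : ℕ} {hp : Odd p} {O : Finset (Fin p)}
    (hO : ∀ l, sigma p hp l ∈ O ↔ l ∈ O) : ∃ (π : LinfT → subH p O →L[ℂ] subH p O)
      (U : subH p O ≃ₗᵢ[ℂ] subH p O) (φ : subH p O),
      (∀ f ξ, (π f ξ : H1 p) = projO p O (pi1 p f ξ)) ∧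
      (∀ ξ, (U ξ : H1 p) = projO p O (U1 p hp ξ)) ∧
      (φ : H1 p) = projO p O (phi1 p) ∧
      IsCyclicRep 2 two_ne_zero (filter₀ p) (onCircle (hOrb p O)) π U φ := by
  obtain ⟨U, hU⟩ := exists_subU hO
  have hπ : ∀ f (ξ : subH p O), ((projSub p O ∘L pi1 p f ∘L (subH p O).subtypeL) ξ : H1 p) =
      projO p O (pi1 p f ξ) := fun f ξ => coe_projSub p O _
  refine ⟨fun f => projSub p O ∘L pi1 p f ∘L (subH p O).subtypeL, U, projSub p O (phi1 p), hπ,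
    fun ξ => ?_, coe_projSub p O _, isCyclicRep_of_projO hO (subH p O).subtypeₗᵢ (projSub p O)
      (projSub_surjective p O) (coe_projSub p O) (fun f ξ => ?_) hU⟩
  · rw [hU, projO_U1 hO, projO_of_mem ξ.2]
  · refine (hπ f ξ).trans ?_
    rw [projO_pi1, projO_of_mem ξ.2]
    rfl

/-! ### The case `p = 9` -/

theorem odd_nine : Odd 9 := by decide

theorem sameCycle_mem_iff {ι : Type*} {s : Equiv.Perm ι} {O : Finset ι}
    (hO : ∀ l, s l ∈ O ↔ l ∈ O) {k l : ι} (h : s.SameCycle k l) : k ∈ O ↔ l ∈ O := by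
  obtain ⟨n, rfl⟩ := h
  induction n with
  | zero => rfl
  | succ n ih => rw [ih, add_comm, zpow_add, zpow_one, Equiv.Perm.mul_apply, hO]
  | pred n ih =>
    rw [ih, sub_eq_neg_add, zpow_add, zpow_neg_one, Equiv.Perm.mul_apply, ← hO (s⁻¹ _),
      ← Equiv.Perm.mul_apply s, mul_inv_cancel, Equiv.Perm.one_apply]

/-- Invariance and reachability from `k` by iteration are finite checks, which `decide` can settle
for `p = 9`. -/
theorem mem_cycles_of_pow {ι : Type*} {s : Equiv.Perm ι} {O : Finset ι} {k : ι} (hk : k ∈ O)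
    (hO : ∀ l, s l ∈ O ↔ l ∈ O) (h : ∀ l ∈ O, ∃ n : ℕ, s^[n] k = l) : O ∈ cycles s := by
  refine ⟨k, fun l => ⟨fun hl => ?_, fun hl => (sameCycle_mem_iff hO hl).1 hk⟩⟩
  obtain ⟨n, hn⟩ := h l hl
  exact ⟨n, by rw [zpow_natCast, ← Equiv.Perm.iterate_eq_pow, hn]⟩

theorem sigma_nine (l : Fin 9) : sigma 9 odd_nine l = 2 * l := by
  revert l; decide

theorem cycles_nine :
    cycles (sigma 9 odd_nine) = {{0}, {1, 2, 4, 5, 7, 8}, {3, 6}} := by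
  have hs : (sigma 9 odd_nine : Fin 9 → Fin 9) = fun l => 2 * l := funext sigma_nine
  have h1 : {0} ∈ cycles (sigma 9 odd_nine) :=
    mem_cycles_of_pow (k := 0) (by decide) (by rw [hs]; decide) (by
      rw [hs]
      have : ∀ l ∈ ({0} : Finset (Fin 9)), ∃ n < 6, (fun l => 2 * l)^[n] 0 = l := by decide
      exact fun l hl => (this l hl).imp fun _ h => h.2)
  have h2 : {1, 2, 4, 5, 7, 8} ∈ cycles (sigma 9 odd_nine) :=
    mem_cycles_of_pow (k := 1) (by decide) (by rw [hs]; decide) (by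
      rw [hs]
      -- The order of `2` modulo `9` is `6`; bounding the number of steps makes the statement
      -- decidable.
      have : ∀ l ∈ ({1, 2, 4, 5, 7, 8} : Finset (Fin 9)),
        ∃ n < 6, (fun l => 2 * l)^[n] 1 = l := by decide
      exact fun l hl => (this l hl).imp fun _ h => h.2)
  have h3 : {3, 6} ∈ cycles (sigma 9 odd_nine) :=
    mem_cycles_of_pow (k := 3) (by decide) (by rw [hs]; decide) (by
      rw [hs]
      have : ∀ l ∈ ({3, 6} : Finset (Fin 9)), ∃ n < 6, (fun l => 2 * l)^[n] 3 = l := by decide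
      exact fun l hl => (this l hl).imp fun _ h => h.2)
  refine Subset.antisymm (fun O hO => ?_) ?_
  · obtain ⟨m, hm⟩ := cycle_nonempty hO
    have key : ∀ O' (hO' : O' ∈ cycles (sigma 9 odd_nine)), m ∈ O' → O = O' := fun O' hO' hm' =>
      congrArg Subtype.val (cycle_eq (O := ⟨O, hO⟩) (O' := ⟨O', hO'⟩) hm hm')
    have hcov : ∀ m : Fin 9, m ∈ ({0} : Finset (Fin 9)) ∨
      m ∈ ({1, 2, 4, 5, 7, 8} : Finset (Fin 9)) ∨ m ∈ ({3, 6} : Finset (Fin 9)) := by decide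
    rcases hcov m with h | h | h
    · exact Or.inl (key _ h1 h)
    · exact Or.inr (Or.inl (key _ h2 h))
    · exact Or.inr (Or.inr (key _ h3 h))
  · rintro O (rfl | rfl | rfl)
    exacts [h1, h2, h3]

theorem hOrb_union {p : ℕ} {O O' : Finset (Fin p)} (h : Disjoint O O') (x : ℝ) :
    hOrb p (O ∪ O') x = hOrb p O x + hOrb p O' x := Finset.sum_union h

theorem hOrb_nine_sum (x : ℝ) :
    hOrb 9 {0} x + hOrb 9 {1, 2, 4, 5, 7, 8} x + hOrb 9 {3, 6} x = 1 := by
  rw [← hOrb_union (by decide), ← hOrb_union (by decide), ← hOrb_univ odd_nine x]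
  exact congrArg (hOrb 9 · x) (by decide)

/-- The factor in front of `h_φ` for `p = 3` is periodic under `2π/3`. The hypothesis gives
`sin(t/2) ≠ 0` by the triple angle formula. -/
theorem hPhi_nine {t : ℝ} (ht : Real.sin (3 * t / 2) ≠ 0) : hPhi 9 t =
    1 / 3 ^ 2 * (Real.sin (9 * t / 2) ^ 2 / Real.sin (3 * t / 2) ^ 2) * hPhi 3 t := by
  have h1 : Real.sin (t / 2) ≠ 0 := fun h => ht (by
    rw [show 3 * t / 2 = 3 * (t / 2) by ring, Real.sin_three_mul, h]; ring)
  rw [hPhi_closed_form odd_nine h1, hPhi_closed_form (p := 3) (by decide) h1]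
  push_cast
  generalize Real.sin (3 * t / 2) = a at ht ⊢
  field_simp
  ring

theorem sin_sq_add_nat_mul_pi (x : ℝ) (n : ℕ) :
    Real.sin (x + n * Real.pi) ^ 2 = Real.sin x ^ 2 := by
  rw [Real.sin_add_nat_mul_pi, mul_pow, ← pow_mul, mul_comm n, pow_mul, neg_one_sq, one_pow,
    one_mul]

/-- The shifts with indices `0, 3, 6` are multiples of `2π/3`. The common factor of `hPhi_nine` can
be taken out, and the three translates of `h_φ` for `p = 3` add up to `1`. -/
theorem hOrb_nine_zero_add {x : ℝ} (hx : Real.sin (3 * x / 2) ≠ 0) :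
    hOrb 9 {0} x + hOrb 9 {3, 6} x =
      1 / 3 ^ 2 * (Real.sin (9 * x / 2) ^ 2 / Real.sin (3 * x / 2) ^ 2) := by
  have h3 : ∀ j : ℕ, Real.sin (3 * (x + 2 * Real.pi * j / 3) / 2) ^ 2 =
      Real.sin (3 * x / 2) ^ 2 := fun j => by
    rw [show 3 * (x + 2 * Real.pi * j / 3) / 2 = 3 * x / 2 + j * Real.pi by ring,
      sin_sq_add_nat_mul_pi]
  have h9 : ∀ j : ℕ, Real.sin (9 * (x + 2 * Real.pi * j / 3) / 2) ^ 2 =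
      Real.sin (9 * x / 2) ^ 2 := fun j => by
    rw [show 9 * (x + 2 * Real.pi * j / 3) / 2 = 9 * x / 2 + (3 * j : ℕ) * Real.pi by
      push_cast; ring, sin_sq_add_nat_mul_pi]
  have h : ∀ j : ℕ, hPhi 9 (x + 2 * Real.pi * j / 3) =
      1 / 3 ^ 2 * (Real.sin (9 * x / 2) ^ 2 / Real.sin (3 * x / 2) ^ 2) *
        hPhi 3 (x + 2 * Real.pi * j / 3) := fun j => by
    rw [hPhi_nine, h3, h9]
    refine fun h0 => hx (pow_eq_zero_iff two_ne_zero |>.1 ?_)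
    rw [← h3 j, h0]; ring
  have hs := hOrb_univ (p := 3) (by decide) x
  rw [hOrb, Fin.sum_univ_three] at hs
  have e : hOrb 9 {0} x + hOrb 9 {3, 6} x = hPhi 9 (x + 2 * Real.pi * (0 : ℕ) / 3) +
      hPhi 9 (x + 2 * Real.pi * (1 : ℕ) / 3) + hPhi 9 (x + 2 * Real.pi * (2 : ℕ) / 3) := by
    rw [hOrb, hOrb, Finset.sum_singleton, Finset.sum_pair (by decide), ← add_assoc]
    have e3 : ((3 : Fin 9) : ℕ) = 3 := rfl
    have e6 : ((6 : Fin 9) : ℕ) = 6 := rfl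
    rw [e3, e6]
    congr 2
    · congr 1; simp
    · congr 1; push_cast; ring
    · congr 1; push_cast; ring
  rw [e, h, h, h, ← mul_add, ← mul_add]
  refine mul_right_eq_self₀.2 (Or.inl ?_)
  simpa using hs

theorem hOrb_nine_zero {x : ℝ} (hx : Real.sin (x / 2) ≠ 0) :
    hOrb 9 {0} x = 1 / 9 ^ 2 * (Real.sin (9 * x / 2) ^ 2 / Real.sin (x / 2) ^ 2) :=
  (congrFun (hOrb_zero odd_nine) x).trans (by exact_mod_cast hPhi_closed_form odd_nine hx)

/-- A basis of the space of continuous solutions for `p = 9`. -/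
def nineBasis : Fin 3 → Circle → ℂ := ![1, hOrbC 9 {0} + hOrbC 9 {3, 6}, hOrbC 9 {0}]

theorem linearIndependent_nineBasis : LinearIndependent ℂ nineBasis := by
  rw [Fintype.linearIndependent_iff]
  intro c hc
  have h : ∀ m : Fin 9, c 0 + c 1 * ((if m ∈ ({0} : Finset (Fin 9)) then 1 else 0) +
      if m ∈ ({3, 6} : Finset (Fin 9)) then 1 else 0) +
      c 2 * (if m ∈ ({0} : Finset (Fin 9)) then 1 else 0) = 0 := fun m => by
    have := congrFun hc (cis (-(2 * Real.pi * (m : ℕ) / (9 : ℕ))))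
    rw [Fin.sum_univ_three] at this
    simp only [nineBasis, Matrix.cons_val_zero, Matrix.cons_val_one, Matrix.cons_val, Pi.add_apply,
      Pi.smul_apply, Pi.one_apply, Pi.zero_apply, smul_eq_mul, mul_one, hOrbC_cis,
      hOrb_root odd_nine] at this
    simpa only [apply_ite Complex.ofReal, Complex.ofReal_one, Complex.ofReal_zero] using this
  -- One node from each cycle gives a triangular system: node `1` yields `c₀ = 0`, node `3` then `c₁
  -- = 0`, node `0` finally `c₂ = 0`.
  have h0 := h 0
  have h1 := h 1
  have h3 := h 3
  simp at h0 h1 h3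
  rw [h1, zero_add] at h0 h3
  rw [h3, zero_add] at h0
  intro i
  fin_cases i
  exacts [h1, h3, h0]

theorem contSol_nine :
    contSol 9 = (Submodule.span ℂ (Set.range nineBasis) : Set (Circle → ℂ)) := by
  have h0 : ∀ i, nineBasis i ∈ Submodule.span ℂ (Set.range nineBasis) := fun i =>
    Submodule.subset_span ⟨i, rfl⟩
  have hm : ∀ O ∈ cycles (sigma 9 odd_nine), hOrbC 9 O ∈ contSol 9 := fun O hO =>
    hOrbC_mem_contSol odd_nine (sigma_mem_cycle odd_nine hO)
  rw [cycles_nine] at hm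
  have e : hOrbC 9 {1, 2, 4, 5, 7, 8} = nineBasis 0 - nineBasis 1 := by
    funext z
    obtain ⟨x, rfl⟩ := cis_surjective z
    have := congrArg (fun r : ℝ => (r : ℂ)) (hOrb_nine_sum x)
    push_cast at this
    simp only [nineBasis, Matrix.cons_val_zero, Matrix.cons_val_one, Pi.sub_apply, Pi.add_apply,
      Pi.one_apply, hOrbC_cis]
    linear_combination this
  refine Subset.antisymm ?_ ?_
  · rw [contSol_eq_span odd_nine]
    refine Submodule.span_le.2 ?_
    rintro _ ⟨⟨O, hO⟩, rfl⟩
    rw [cycles_nine] at hO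
    change hOrbC 9 O ∈ Submodule.span ℂ (Set.range nineBasis)
    rcases hO with rfl | rfl | rfl
    · exact h0 2
    · rw [e]; exact sub_mem (h0 0) (h0 1)
    · have : hOrbC 9 {3, 6} = nineBasis 1 - nineBasis 2 := (add_sub_cancel_left _ _).symm
      rw [this]; exact sub_mem (h0 1) (h0 2)
  · change Submodule.span ℂ (Set.range nineBasis) ≤ contSolSub 9 odd_nine
    refine Submodule.span_le.2 ?_
    rintro _ ⟨i, rfl⟩
    fin_cases i
    · exact one_mem_contSol odd_nine
    · exact (contSolSub 9 odd_nine).add_mem (hm _ (Or.inl rfl)) (hm _ (Or.inr (Or.inr rfl)))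
    · exact hm _ (Or.inl rfl)

end RuelleExample

end

theorem mainTheorem8 :
    (∀ (p : ℕ) (hp : Odd p),
      -- the constant function is an eigenfunction
      (∀ z, ruelle 2 (filter₀ p) (fun _ => 1) z = 1) ∧
      -- the scaling function and its function `h_φ`
      (∀ x : ℝ, x ≠ 0 → phiHat p x = Complex.exp (-(Complex.I * (p * x / 2 : ℝ))) *
        ((Real.sin (p * x / 2) / (p * x / 2) : ℝ) : ℂ)) ∧
      (∀ t : ℝ, Real.sin (t / 2) ≠ 0 →
        hPhi p t = 1 / (p : ℝ) ^ 2 * (Real.sin (p * t / 2) ^ 2 / Real.sin (t / 2) ^ 2)) ∧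
      (∀ t : ℝ, ∑ k : Fin p, hPhi p (t + 2 * Real.pi * (k : ℕ) / p) = 1) ∧
      -- the wavelet representation is the cyclic representation associated to `h_φ`
      (∀ ψ : L2R, ∀ᵐ x : ℝ,
        wavePi (ofCont ⟨fun z => (z : ℂ), by fun_prop⟩) ψ x = ψ (x - 1)) ∧
      IsCyclicRep 2 two_ne_zero (filter₀ p) (onCircle (hPhi p)) wavePi waveU (phi p) ∧
      -- the `p`-fold representation is the cyclic representation associated to the constant `1`
      IsCyclicRep 2 two_ne_zero (filter₀ p) (fun _ => 1) (pi1 p) (U1 p hp) (phi1 p) ∧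
      -- the Fourier transform turns it into the representation by multiplication operators
      (∀ f ξ, fourier1 p (pi1 p f ξ) = pi1Hat p f (fourier1 p ξ)) ∧
      (∀ ξ, fourier1 p (U1 p hp ξ) = U1Hat p hp (fourier1 p ξ)) ∧
      -- the commutant
      (commutant (pi1Hat p) (U1Hat p hp) = {A | ∃ f ∈ invFamilies p hp, IsDiag p A f}) ∧
      -- the bijection between the commutant and the bounded solutions
      (∀ A ∈ commutant (pi1 p) (U1 p hp), ∃! h : LinfT,
        (ruelle 2 (filter₀ p) h =ᵐ[haarT] h) ∧ Corresponds p A h) ∧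
      (∀ h : LinfT, ruelle 2 (filter₀ p) h =ᵐ[haarT] h →
        ∃! A : H1 p →L[ℂ] H1 p, A ∈ commutant (pi1 p) (U1 p hp) ∧ Corresponds p A h) ∧
      -- the bounded solution given by a family `(f_k)`
      (∀ f ∈ invFamilies p hp, ∀ A B : H1 p →L[ℂ] H1 p, IsDiag p B f →
        (∀ ξ, fourier1 p (A ξ) = B (fourier1 p ξ)) → ∀ h : LinfT,
        (Corresponds p A h ↔ ∀ g : LinfT,
          (1 / (2 * Real.pi : ℂ)) * ∑ k : Fin p, ∫ x : ℝ,
            (starRingEnd ℂ) (phiHat p x) * (lift (alpha (rhoPow p k) g) x * f k x * phiHat p x) =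
          ∫ z, g z * h z ∂haarT) ∧
        (Corresponds p A h ↔ ∀ᵐ x : ℝ, h (cis x) = ∑ k : Fin p,
          per (fun y => f k (y + 2 * k * Real.pi / p) *
            ((‖phiHat p (y + 2 * k * Real.pi / p)‖ ^ 2 : ℝ) : ℂ)) x)) ∧
      (∀ h : LinfT, ruelle 2 (filter₀ p) h =ᵐ[haarT] h ↔
        ∃ f ∈ invFamilies p hp, ∀ᵐ x : ℝ, h (cis x) = ∑ k : Fin p,
          per (fun y => f k (y + 2 * k * Real.pi / p) *
            ((‖phiHat p (y + 2 * k * Real.pi / p)‖ ^ 2 : ℝ) : ℂ)) x) ∧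
      -- the continuous solutions
      (contSol p = (Submodule.span ℂ
        (Set.range fun O : cycles (sigma p hp) => hOrbC p O) : Set (Circle → ℂ))) ∧
      (LinearIndependent ℂ fun O : cycles (sigma p hp) => hOrbC p O) ∧
      (∀ O ∈ cycles (sigma p hp), ∀ x : ℝ, hOrb p O x = 0 ↔
        ∃ l : Fin p, l ∉ O ∧ ∃ n : ℤ, x = -(2 * Real.pi * (l : ℕ) / p) + 2 * Real.pi * n) ∧
      -- the cyclic representations associated to the functions of the basis
      (∀ O ∈ cycles (sigma p hp), ∃ (π : LinfT → subH p O →L[ℂ] subH p O)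
        (U : subH p O ≃ₗᵢ[ℂ] subH p O) (φ : subH p O),
        (∀ f ξ, (π f ξ : H1 p) = projO p O (pi1 p f ξ)) ∧
        (∀ ξ, (U ξ : H1 p) = projO p O (U1 p hp ξ)) ∧
        (φ : H1 p) = projO p O (phi1 p) ∧
        IsCyclicRep 2 two_ne_zero (filter₀ p) (onCircle (hOrb p O)) π U φ)) ∧
    -- the case `p = 9`
    (cycles (sigma 9 (by decide)) = {{0}, {1, 2, 4, 5, 7, 8}, {3, 6}} ∧
      hOrb 9 {0} = hPhi 9 ∧
      (∀ x : ℝ, hOrb 9 {0} x + hOrb 9 {1, 2, 4, 5, 7, 8} x + hOrb 9 {3, 6} x = 1) ∧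
      (∀ x : ℝ, Real.sin (3 * x / 2) ≠ 0 → hOrb 9 {0} x + hOrb 9 {3, 6} x =
        1 / 3 ^ 2 * (Real.sin (9 * x / 2) ^ 2 / Real.sin (3 * x / 2) ^ 2)) ∧
      (∀ x : ℝ, Real.sin (x / 2) ≠ 0 → hOrb 9 {0} x =
        1 / 9 ^ 2 * (Real.sin (9 * x / 2) ^ 2 / Real.sin (x / 2) ^ 2)) ∧
      ∃ b : Fin 3 → Circle → ℂ,
        LinearIndependent ℂ b ∧ contSol 9 = (Submodule.span ℂ (Set.range b) : Set (Circle → ℂ)) ∧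
        b 0 = 1 ∧
        (∀ x : ℝ, Real.sin (3 * x / 2) ≠ 0 → b 1 (cis x) =
          ((1 / 3 ^ 2 * (Real.sin (9 * x / 2) ^ 2 / Real.sin (3 * x / 2) ^ 2) : ℝ) : ℂ)) ∧
        (∀ x : ℝ, Real.sin (x / 2) ≠ 0 → b 2 (cis x) =
          ((1 / 9 ^ 2 * (Real.sin (9 * x / 2) ^ 2 / Real.sin (x / 2) ^ 2) : ℝ) : ℂ))) := by
  refine ⟨fun p hp => ⟨ruelle_one hp, fun x hx => phiHat_of_ne_zero hp hx,
    fun t ht => hPhi_closed_form hp ht, hOrb_univ hp, wavePi_idT, isCyclicRep_wavePi hp,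
    isCyclicRep_pi1 hp, fourier1_pi1 p, fourier1_U1 p hp, commutant_pi1Hat p hp,
    fun A hA => existsUnique_eigenfunction hA, fun h hh => existsUnique_commutant hp hh,
    fun f _ A B hB hAB h => ⟨corresponds_iff_integral hB hAB h, corresponds_iff_ae hp hB hAB h⟩,
    ruelle_eq_iff_exists_invFamily hp, contSol_eq_span hp, linearIndependent_hOrbC hp,
    fun O hO x => hOrb_eq_zero_iff hp (cycle_nonempty hO) x,
    fun O hO => exists_isCyclicRep_subH (sigma_mem_cycle hp hO)⟩,
    cycles_nine, hOrb_zero odd_nine, hOrb_nine_sum, fun x hx => hOrb_nine_zero_add hx,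
    fun x hx => ?_, nineBasis, linearIndependent_nineBasis, contSol_nine, rfl, fun x hx => ?_,
    fun x hx => ?_⟩
  · rw [hOrb_nine_zero hx]
  · rw [← hOrb_nine_zero_add hx, Complex.ofReal_add, ← hOrbC_cis, ← hOrbC_cis]
    rfl
  · rw [← hOrb_nine_zero hx, ← hOrbC_cis]
    rfl
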